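/- Let $k$ be a field and $d\ge 0$ an integer. A symmetric collection (in sets or in $k$-vector spaces) is a contravariant functor on the groupoid of finite sets and bijections; $\underline m=\{1,\dots,m\}$. Let $X_1,\dots,X_d$ be symmetric collections of sets such that $S_m$ acts freely on $X_i(\underline m)$ for all $i,m$, and $X_i(\underline 0)=X_i(\underline 1)=\varnothing$. Choose free generators of the $X_i$, that is, sets $G_i(m)\subseteq X_i(\underline m)$ meeting each $S_m$-orbit in exactly one element. *Cut operad.* The $X_\bullet$-subdivisions of a box $R=\prod_j[a_j,b_j]\subset\mathbb R^d$ are defined recursively: the box $R$ itself without cuts is a subdivision; and if $1\le i\le d$, $m\ge 2$ and $g\in G_i(m)$, one may cut $R$ into $m$ equal parts by the $m-1$ hyperplane pieces $R\cap\{x_i=((m-l)a_i+l\,b_i)/m\}$, $1\le l\le m-1$, label all points of these pieces by $g$ (and the direction $i$), and impose arbitrary subdivisions on the $m$ parts. A subdivision consists of its set of parts and its set of labelled cuts, regardless of the order in which the cuts were made. The cut operad $\mathcal C=\mathcal C^{(d)}_{X_\bullet}$ is the set operad for which $\mathcal C(U)$ consists of the $X_\bullet$-subdivisions of $[0,1]^d$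 with parts labelled bijectively by $U$; composition substitutes rescaled subdivisions, with their labelled cuts, for the parts. Its linearisation is denoted $k\mathcal C$. *Products.* Let $\mathbb I$ be the unit collection ($k$, or a point in the set context, on one-element sets; zero, or empty, otherwise). The matrix product is $$(Y_1\Box\cdots\Box Y_d)(U)=\bigoplus_{(\pi_1,\dots,\pi_d)}Y_1(\pi_1)\otimes\cdots\otimes Y_d(\pi_d),$$ the sum being over $d$-tuples of partitions of $U$ which are orthogonal: any choice of one block from each partition has exactly one common element. Let $\mathcal H=(\mathbb I\oplus kX_1)\Box\cdots\Box(\mathbb I\oplus kX_d)$, graded by giving each factor $\mathbb I$ homological degree $0$ and each $kX_i$ homological degree $1$, and let $\mathcal H_s$ be the part of degree $s$. For a collection $\mathcal A$, the free right $k\mathcal C$-module generated by $\mathcal A$ is $$(\mathcal A\circ k\mathcal C)(U)=\bigoplus_{\pi}\mathcal A(\pi)\otimes\bigotimes_{B\in\pi}k\mathcal C(B)\qquad(\pi\text{ running over the partitions of }U),$$ with $k\mathcal C$ acting by composition in each block. *Augmentation.* Let $\epsilon\colon k\mathcal C\to\mathbb I$ be the augmentation, which is zero in arities different from $1$ and is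 the sum of the coefficients in arity $1$. The augmentation module is $\mathbb I$ with $k\mathcal C$ acting through $\epsilon$. **Claim.** There are morphisms of right $k\mathcal C$-modules $\delta_s\colon\mathcal H_{s+1}\circ k\mathcal C\to\mathcal H_s\circ k\mathcal C$ ($s\ge 0$) and $\varepsilon\colon\mathcal H_0\circ k\mathcal C\to\mathbb I$ such that $$\cdots\xrightarrow{\delta_1}\mathcal H_1\circ k\mathcal C\xrightarrow{\delta_0}\mathcal H_0\circ k\mathcal C\xrightarrow{\varepsilon}\mathbb I\to 0$$ is a complex which is exact on every finite set. Thus $\mathcal H\circ k\mathcal C$ carries a differential making it a resolution of the augmentation module $\mathbb I$ by free right $k\mathcal C$-modules. Moreover, this resolution is minimal: the image of each $\delta_s$ is contained in the decomposable part of $\mathcal H_s\circ k\mathcal C$, that is, in the span of the results $m\cdot(b_v)_v$ of the action for which at least one $b_v$ lies in the augmentation ideal $\ker\epsilon$. -/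

import Mathlib

universe u v w w'

namespace CutRes

/-! ### Symmetric collections of sets -/

/-- The obvious identification of a disjoint union over a one-point set. -/
def unitSigma (W : Type) : (Σ _ : Unit, W) ≃ W where
  toFun p := p.2
  invFun w := ⟨(), w⟩
  left_inv _ := rfl
  right_inv _ := rfl

/-- A symmetric collection of sets: a contravariant functor from the groupoid of finite sets and
bijections to sets.  `obj (Fin n)` carries the right action `x.σ = map σ x` of the symmetric
group. -/
structure SymColl where
  obj : (U : Type) → [Finite U] → Type u
  map : ∀ {U V : Type} [Finite U] [Finite V], (U ≃ V) → obj V → obj U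
  map_refl : ∀ {U : Type} [Finite U] (x : obj U), map (Equiv.refl U) x = x
  map_trans : ∀ {U V W : Type} [Finite U] [Finite V] [Finite W] (e : U ≃ V) (f : V ≃ W)
    (x : obj W), map (e.trans f) x = map e (map f x)

namespace SymColl

/-- A symmetric collection is free if every symmetric group acts freely. -/
def IsFree (X : SymColl.{u}) : Prop :=
  ∀ (n : ℕ) (σ : Equiv.Perm (Fin n)) (x : X.obj (Fin n)), X.map σ x = x → σ = 1

/-- `G` meets every orbit of the action of the symmetric group on `X (Fin n)` in exactly one
element; for a free collection `X`, this says that `G` is a set of free generators. -/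
def IsGenerating (X : SymColl.{u}) (G : ∀ n, Set (X.obj (Fin n))) : Prop :=
  ∀ (n : ℕ) (x : X.obj (Fin n)), ∃! g, g ∈ G n ∧ ∃ σ : Equiv.Perm (Fin n), X.map σ g = x

theorem map_map_congr (X : SymColl.{u}) {U V V' W : Type} [Finite U] [Finite V] [Finite V']
    [Finite W] (e : U ≃ V) (f : V ≃ W) (e' : U ≃ V') (f' : V' ≃ W) (x : X.obj W)
    (h : ∀ y, f (e y) = f' (e' y)) : X.map e (X.map f x) = X.map e' (X.map f' x) := by
  rw [← X.map_trans, ← X.map_trans]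
  exact congrArg (fun g => X.map g x) (Equiv.ext h)

/-- The unit collection: a point on one-element sets, empty otherwise. -/
def unit : SymColl.{u} where
  obj U _ := ULift.{u} (PLift (Nat.card U = 1))
  map e x := ⟨⟨(Nat.card_congr e).trans x.down.down⟩⟩
  map_refl _ := rfl
  map_trans _ _ _ := rfl

/-- The disjoint union of two collections. -/
def sum (X Y : SymColl.{u}) : SymColl.{u} where
  obj U _ := X.obj U ⊕ Y.obj U
  map e := Sum.map (X.map e) (Y.map e)
  map_refl x := by cases x <;> simp [map_refl]
  map_trans e f x := by cases x <;> simp [map_trans]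

end SymColl

/-! ### The matrix product -/

/-- For a surjection `f : U → V` and an equivalence relation on `V`, the blocks of the pulled back
relation on `U` are in bijection with the blocks of the given one. -/
noncomputable def quotEquiv {U V : Type} (f : U → V) (hf : Function.Surjective f)
    (S : Setoid V) : Quotient (Setoid.comap f S) ≃ Quotient S :=
  Equiv.ofBijective (Quotient.map f (fun _ _ h => h)) (by
    constructor
    · intro a b
      induction a using Quotient.inductionOn
      induction b using Quotient.inductionOn
      intro h
      exact Quotient.sound (Quotient.exact h : _)
    · intro b
      induction b using Quotient.inductionOn with
      | h v =>
        obtain ⟨x, rfl⟩ := hf v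
        exact ⟨Quotient.mk _ x, rfl⟩)

theorem quotEquiv_mk {U V : Type} (f : U → V) (hf : Function.Surjective f) (S : Setoid V)
    (x : U) : quotEquiv f hf S (Quotient.mk _ x) = Quotient.mk S (f x) := rfl

theorem quotEquiv_refl {U : Type} (S : Setoid U) :
    quotEquiv (Equiv.refl U) (Equiv.refl U).surjective S = Equiv.refl _ := by
  ext q
  induction q using Quotient.inductionOn
  rfl

theorem quotEquiv_trans {U V W : Type} (f : U → V) (hf : Function.Surjective f) (g : V → W)
    (hg : Function.Surjective g) (hgf : Function.Surjective (fun x => g (f x)))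
    (S : Setoid W) :
    quotEquiv (fun x => g (f x)) hgf S =
      (quotEquiv f hf (Setoid.comap g S)).trans (quotEquiv g hg S) := by
  ext q
  induction q using Quotient.inductionOn
  rfl

/-- A family of partitions of `U` is orthogonal if any choice of one block from each of them
has exactly one common element. -/
def Orthogonal {d : ℕ} {U : Type} (π : Fin d → Setoid U) : Prop :=
  ∀ B : ∀ i, Quotient (π i), ∃! u : U, ∀ i, Quotient.mk (π i) u = B i

theorem Orthogonal.comap {d : ℕ} {U V : Type} (e : U ≃ V) {π : Fin d → Setoid V}
    (h : Orthogonal π) : Orthogonal (fun i => Setoid.comap e (π i)) := by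
  intro B
  obtain ⟨v, hv, hu⟩ := h (fun i => quotEquiv e e.surjective (π i) (B i))
  refine ⟨e.symm v, fun i => ?_, fun u h => ?_⟩
  · apply (quotEquiv e e.surjective (π i)).injective
    rw [quotEquiv_mk, e.apply_symm_apply]
    exact hv i
  · rw [Equiv.eq_symm_apply]
    refine hu _ (fun i => ?_)
    rw [← h i]
    rfl

/-- The matrix product `Y₁ □ ⋯ □ Y_d`: its value on `U` is the disjoint union, over all
orthogonal `d`-tuples of partitions `π₁, …, π_d` of `U`, of `Y₁ (π₁) × ⋯ × Y_d (π_d)`. -/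
noncomputable def matrixProd {d : ℕ} (Y : Fin d → SymColl.{u}) : SymColl.{u} where
  obj U _ := Σ π : {π : Fin d → Setoid U // Orthogonal π}, ∀ i, (Y i).obj (Quotient (π.1 i))
  map e x := ⟨⟨fun i => Setoid.comap e (x.1.1 i), x.1.2.comap e⟩,
    fun i => (Y i).map (quotEquiv e e.surjective (x.1.1 i)) (x.2 i)⟩
  map_refl {U} _ x := by
    refine Sigma.ext rfl (heq_of_eq (funext fun i => ?_))
    exact (congrArg (fun e => (Y i).map e (x.2 i)) (quotEquiv_refl (x.1.1 i))).trans
      ((Y i).map_refl _)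
  map_trans {U V W} _ _ _ e f x := by
    refine Sigma.ext rfl (heq_of_eq (funext fun i => ?_))
    exact (congrArg (fun e => (Y i).map e (x.2 i))
      (quotEquiv_trans e e.surjective f f.surjective (e.trans f).surjective (x.1.1 i))).trans
      ((Y i).map_trans _ _ _)

/-- The set-level model of `(𝕀 ⊕ 𝕜X₁) □ ⋯ □ (𝕀 ⊕ 𝕜X_d)`. -/
noncomputable def cutGen {d : ℕ} (X : Fin d → SymColl.{u}) : SymColl.{u} :=
  matrixProd (fun i => SymColl.unit.sum (X i))

/-- The homological degree: the number of factors taken in some `X i` and not in the unit. -/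
noncomputable def cutDegree {d : ℕ} (X : Fin d → SymColl.{u}) {U : Type} [Finite U]
    (h : (cutGen X).obj U) : ℕ :=
  (Finset.univ.filter (fun i : Fin d => (h.2 i).isRight = true)).card

theorem cutDegree_map {d : ℕ} (X : Fin d → SymColl.{u}) {U V : Type} [Finite U] [Finite V]
    (e : U ≃ V) (h : (cutGen X).obj V) : cutDegree X ((cutGen X).map e h) = cutDegree X h := by
  unfold cutDegree
  congr 1
  ext i
  simp [cutGen, matrixProd, SymColl.sum]

/-- The part of homological degree `s` of `(𝕀 ⊕ 𝕜X₁) □ ⋯ □ (𝕀 ⊕ 𝕜X_d)` (set-level model). -/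
noncomputable def cutGenDeg {d : ℕ} (X : Fin d → SymColl.{u}) (s : ℕ) : SymColl.{u} where
  obj U _ := {h : (cutGen X).obj U // cutDegree X h = s}
  map e h := ⟨(cutGen X).map e h.1, (cutDegree_map X e h.1).trans h.2⟩
  map_refl h := Subtype.ext ((cutGen X).map_refl h.1)
  map_trans e f h := Subtype.ext ((cutGen X).map_trans e f h.1)

/-! ### Set operads and their right modules -/

/-- A reduced symmetric operad in sets.  The composition `γ(a; (b_v)_{v ∈ V})` of an operation
`a` with inputs `V` and operations `b_v` with inputs `W v` has the disjoint union of the `W v` as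
its set of inputs. -/
structure SetOperad extends SymColl.{u} where
  reduced : ∀ (U : Type) [Finite U] [IsEmpty U], IsEmpty (obj U)
  one : obj Unit
  comp : ∀ {V : Type} {W : V → Type} [Finite V] [∀ v, Finite (W v)],
    obj V → (∀ v, obj (W v)) → obj (Σ v, W v)
  comp_map : ∀ {V : Type} {W W' : V → Type} [Finite V] [∀ v, Finite (W v)]
    [∀ v, Finite (W' v)] (e : ∀ v, W v ≃ W' v) (a : obj V) (b : ∀ v, obj (W' v)),
    comp a (fun v => map (e v) (b v)) = map (Equiv.sigmaCongrRight e) (comp a b)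
  map_comp : ∀ {V V' : Type} {W : V' → Type} [Finite V] [Finite V'] [∀ v, Finite (W v)]
    (e : V ≃ V') (a : obj V') (b : ∀ v, obj (W v)),
    comp (map e a) (fun v => b (e v)) = map (Equiv.sigmaCongrLeft e) (comp a b)
  one_comp : ∀ {W : Type} [Finite W] (b : obj W),
    comp one (fun _ => b) = map (unitSigma W) b
  comp_one : ∀ {V : Type} [Finite V] (a : obj V),
    comp a (fun _ => one) = map (Equiv.sigmaPUnit V) a
  comp_assoc : ∀ {V : Type} {W : V → Type} {Z : ∀ v, W v → Type} [Finite V]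
    [∀ v, Finite (W v)] [∀ v w, Finite (Z v w)] (a : obj V) (b : ∀ v, obj (W v))
    (c : ∀ v w, obj (Z v w)),
    comp (comp a b) (fun p => c p.1 p.2) =
      map (Equiv.sigmaAssoc Z) (comp a (fun v => comp (b v) (c v)))

/-- A right module over a set operad. -/
structure SetModule (P : SetOperad.{u}) extends SymColl.{w} where
  act : ∀ {V : Type} {W : V → Type} [Finite V] [∀ v, Finite (W v)],
    obj V → (∀ v, P.obj (W v)) → obj (Σ v, W v)
  act_map : ∀ {V : Type} {W W' : V → Type} [Finite V] [∀ v, Finite (W v)]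
    [∀ v, Finite (W' v)] (e : ∀ v, W v ≃ W' v) (a : obj V) (b : ∀ v, P.obj (W' v)),
    act a (fun v => P.map (e v) (b v)) = map (Equiv.sigmaCongrRight e) (act a b)
  map_act : ∀ {V V' : Type} {W : V' → Type} [Finite V] [Finite V'] [∀ v, Finite (W v)]
    (e : V ≃ V') (a : obj V') (b : ∀ v, P.obj (W v)),
    act (map e a) (fun v => b (e v)) = map (Equiv.sigmaCongrLeft e) (act a b)
  act_one : ∀ {V : Type} [Finite V] (a : obj V),
    act a (fun _ => P.one) = map (Equiv.sigmaPUnit V) a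
  act_assoc : ∀ {V : Type} {W : V → Type} {Z : ∀ v, W v → Type} [Finite V]
    [∀ v, Finite (W v)] [∀ v w, Finite (Z v w)] (a : obj V) (b : ∀ v, P.obj (W v))
    (c : ∀ v w, P.obj (Z v w)),
    act (act a b) (fun p => c p.1 p.2) =
      map (Equiv.sigmaAssoc Z) (act a (fun v => P.comp (b v) (c v)))

/-! ### The composition product and free right modules -/

/-- The values of the composition product `A ∘ P`, for `P` vanishing on the empty set: a partition
of `U`, an element of `A` on the set of its blocks, and an element of `P` on each block. -/
def CompObj (A : SymColl.{w}) (P : SymColl.{u}) (U : Type) [Finite U] : Type (max w u) :=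
  Σ S : Setoid U, A.obj (Quotient S) × ∀ q : Quotient S, P.obj {x : U // Quotient.mk S x = q}

theorem CompObj.ext {A : SymColl.{w}} {P : SymColl.{u}} {U : Type} [Finite U] {S : Setoid U}
    {a a' : A.obj (Quotient S)} {p p' : ∀ q : Quotient S, P.obj {x : U // Quotient.mk S x = q}}
    (h : a = a') (h' : ∀ x : U, p (Quotient.mk S x) = p' (Quotient.mk S x)) :
    (⟨S, a, p⟩ : CompObj A P U) = ⟨S, a', p'⟩ := by
  subst h
  have : p = p' := funext fun q => Quotient.inductionOn q h'
  rw [this]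

/-- A bijection `e : U ≃ V` restricts to bijections of blocks. -/
noncomputable def blockEquiv {U V : Type} (e : U ≃ V) (S : Setoid V)
    (q : Quotient (Setoid.comap e S)) :
    {x : U // Quotient.mk (Setoid.comap e S) x = q} ≃
      {y : V // Quotient.mk S y = quotEquiv e e.surjective S q} :=
  e.subtypeEquiv (fun x => by
    rw [← quotEquiv_mk e e.surjective S, EmbeddingLike.apply_eq_iff_eq])

/-- The block of `⨆ W v` lying over a block of `V`. -/
noncomputable def blockSigma {V : Type} {W : V → Type} (S : Setoid V)
    (hf : Function.Surjective (Sigma.fst : (Σ v, W v) → V))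
    (q : Quotient (Setoid.comap (Sigma.fst : (Σ v, W v) → V) S)) :
    {x : Σ v, W v // Quotient.mk (Setoid.comap Sigma.fst S) x = q} ≃
      Σ y : {y : V // Quotient.mk S y = quotEquiv Sigma.fst hf S q}, W y.1 where
  toFun x := ⟨⟨x.1.1, congrArg (quotEquiv Sigma.fst hf S) x.2⟩, x.1.2⟩
  invFun y := ⟨⟨y.1.1, y.2⟩, (quotEquiv Sigma.fst hf S).injective y.1.2⟩
  left_inv _ := rfl
  right_inv _ := rfl

theorem SetOperad.fst_surjective (P : SetOperad.{u}) {V : Type} {W : V → Type}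
    [∀ v, Finite (W v)] (b : ∀ v, P.obj (W v)) :
    Function.Surjective (Sigma.fst : (Σ v, W v) → V) := by
  intro v
  by_contra h
  have : IsEmpty (W v) := ⟨fun w => h ⟨⟨v, w⟩, rfl⟩⟩
  exact (P.reduced (W v)).false (b v)

/-- The composition product `A ∘ P` of symmetric collections. -/
noncomputable def compColl (A : SymColl.{w}) (P : SymColl.{u}) : SymColl.{max w u} where
  obj U _ := CompObj A P U
  map e x := ⟨Setoid.comap e x.1, A.map (quotEquiv e e.surjective x.1) x.2.1,
    fun q => P.map (blockEquiv e x.1 q) (x.2.2 _)⟩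
  map_refl {U} _ x := by
    obtain ⟨S, a, p⟩ := x
    refine CompObj.ext (S := S) ?_ (fun x => ?_)
    · exact (congrArg (fun e => A.map e a) (quotEquiv_refl S)).trans (A.map_refl _)
    · exact P.map_refl _
  map_trans {U V W} _ _ _ e f x := by
    obtain ⟨S, a, p⟩ := x
    refine CompObj.ext (S := Setoid.comap (e.trans f) S) ?_ (fun x => ?_)
    · exact (congrArg (fun e => A.map e a)
        (quotEquiv_trans e e.surjective f f.surjective (e.trans f).surjective S)).trans
        (A.map_trans _ _ _)
    · exact P.map_trans (blockEquiv e (Setoid.comap f S) (Quotient.mk _ x)) (blockEquiv f S _) _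

/-- The free right module `A ∘ P` over the operad `P` generated by the collection `A`; `P` acts
through its composition, applied in each block. -/
noncomputable def freeModule (A : SymColl.{w}) (P : SetOperad.{u}) : SetModule.{u, max w u} P where
  toSymColl := compColl A P.toSymColl
  act {V W} _ _ x b :=
    have hf : Function.Surjective (Sigma.fst : (Σ v, W v) → V) := P.fst_surjective b
    ⟨Setoid.comap Sigma.fst x.1, A.map (quotEquiv Sigma.fst hf x.1) x.2.1,
      fun q => P.map (blockSigma x.1 hf q)
        (P.comp (x.2.2 (quotEquiv Sigma.fst hf x.1 q)) (fun y => b y.1))⟩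
  act_map {V W W'} _ _ _ e x b := by
    obtain ⟨S, a, p⟩ := x
    refine CompObj.ext (S := Setoid.comap Sigma.fst S) ?_ (fun z => ?_)
    · exact (congrArg (fun e => A.map e a)
        (quotEquiv_trans (Equiv.sigmaCongrRight e) (Equiv.sigmaCongrRight e).surjective Sigma.fst
          (P.fst_surjective b) (P.fst_surjective fun v => P.map (e v) (b v)) S)).trans
        (A.map_trans _ _ _)
    · exact (congrArg _ (P.comp_map (fun y : {y : V // Quotient.mk S y = _} => e y.1) _ _)).trans
        (P.map_map_congr _ _ _ _ _ (fun _ => rfl))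
  map_act {V V' W} _ _ _ e x b := by
    obtain ⟨S, a, p⟩ := x
    refine CompObj.ext (S := Setoid.comap Sigma.fst (Setoid.comap e S)) ?_ (fun z => ?_)
    · refine A.map_map_congr _ _ _ _ _ (fun q => ?_)
      induction q using Quotient.inductionOn
      rfl
    · exact (congrArg _ (P.map_comp (blockEquiv e S _) _
        (fun y : {y : V' // Quotient.mk S y = _} => b y.1))).trans
        (P.map_map_congr _ _ _ _ _ (fun _ => rfl))
  act_one {V} _ x := by
    obtain ⟨S, a, p⟩ := x
    refine CompObj.ext (S := Setoid.comap Sigma.fst S) ?_ (fun z => ?_)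
    · rfl
    · exact (congrArg _ (P.comp_one _)).trans (P.map_trans _ _ _).symm
  act_assoc {V W Z} _ _ _ x b c := by
    obtain ⟨S, a, p⟩ := x
    refine CompObj.ext (S := Setoid.comap Sigma.fst (Setoid.comap Sigma.fst S)) ?_ (fun z => ?_)
    · refine A.map_map_congr _ _ _ _ _ (fun q => ?_)
      induction q using Quotient.inductionOn
      rfl
    · refine (congrArg _ ((P.map_comp (blockSigma S (P.fst_surjective b) _) _
        (fun y : (Σ y : {y : V // Quotient.mk S y = _}, W y.1) => c y.1.1 y.2)).trans
        (congrArg _ (P.comp_assoc _ (fun y : {y : V // Quotient.mk S y = _} => b y.1)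
          (fun y => c y.1))))).trans ?_
      refine (congrArg _ (P.map_trans _ _ _).symm).trans ?_
      exact P.map_map_congr _ _ _ _ _ (fun _ => rfl)

/-! ### Linear symmetric collections, operads and right modules -/

/-- A symmetric collection of `k`-vector spaces. -/
structure LinColl (k : Type v) [Field k] where
  obj : (U : Type) → [Finite U] → Type w
  addCommGroup : ∀ (U : Type) [Finite U], AddCommGroup (obj U)
  module : ∀ (U : Type) [Finite U], Module k (obj U)
  map : ∀ {U V : Type} [Finite U] [Finite V], (U ≃ V) → obj V →ₗ[k] obj U
  map_refl : ∀ {U : Type} [Finite U] (x : obj U), map (Equiv.refl U) x = x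
  map_trans : ∀ {U V W : Type} [Finite U] [Finite V] [Finite W] (e : U ≃ V) (f : V ≃ W)
    (x : obj W), map (e.trans f) x = map e (map f x)

attribute [instance] LinColl.addCommGroup LinColl.module

/-- An augmented `k`-linear symmetric operad.  The composition is multilinear, that is, it is
given by maps `O V ⊗ ⨂ v, O (W v) → O (⨆ v, W v)`.  The augmentation `aug` is a morphism from `O`
to the unit operad, which is `k` on one-element sets and zero otherwise. -/
structure LinOperad (k : Type v) [Field k] extends LinColl.{v, w} k where
  one : obj Unit
  comp : ∀ {V : Type} {W : V → Type} [Finite V] [∀ v, Finite (W v)],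
    obj V →ₗ[k] MultilinearMap k (fun v => obj (W v)) (obj (Σ v, W v))
  comp_map : ∀ {V : Type} {W W' : V → Type} [Finite V] [∀ v, Finite (W v)]
    [∀ v, Finite (W' v)] (e : ∀ v, W v ≃ W' v) (a : obj V) (b : ∀ v, obj (W' v)),
    comp a (fun v => map (e v) (b v)) = map (Equiv.sigmaCongrRight e) (comp a b)
  map_comp : ∀ {V V' : Type} {W : V' → Type} [Finite V] [Finite V'] [∀ v, Finite (W v)]
    (e : V ≃ V') (a : obj V') (b : ∀ v, obj (W v)),
    comp (map e a) (fun v => b (e v)) = map (Equiv.sigmaCongrLeft e) (comp a b)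
  one_comp : ∀ {W : Type} [Finite W] (b : obj W),
    comp one (fun _ => b) = map (unitSigma W) b
  comp_one : ∀ {V : Type} [Finite V] (a : obj V),
    comp a (fun _ => one) = map (Equiv.sigmaPUnit V) a
  comp_assoc : ∀ {V : Type} {W : V → Type} {Z : ∀ v, W v → Type} [Finite V]
    [∀ v, Finite (W v)] [∀ v w, Finite (Z v w)] (a : obj V) (b : ∀ v, obj (W v))
    (c : ∀ v w, obj (Z v w)),
    comp (comp a b) (fun p => c p.1 p.2) =
      map (Equiv.sigmaAssoc Z) (comp a (fun v => comp (b v) (c v)))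
  aug : ∀ {U : Type} [Finite U], obj U →ₗ[k] k
  aug_eq_zero : ∀ {U : Type} [Finite U], Nat.card U ≠ 1 → ∀ x : obj U, aug x = 0
  aug_map : ∀ {U V : Type} [Finite U] [Finite V] (e : U ≃ V) (x : obj V), aug (map e x) = aug x
  aug_one : aug one = 1
  aug_comp : ∀ {V : Type} {W : V → Type} [Fintype V] [∀ v, Finite (W v)]
    (a : obj V) (b : ∀ v, obj (W v)), aug (comp a b) = aug a * ∏ v, aug (b v)

/-- A right module over a linear operad, given by maps `M V ⊗ ⨂ v, O (W v) → M (⨆ v, W v)`. -/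
structure RightModule {k : Type v} [Field k] (O : LinOperad.{v, w} k)
    extends LinColl.{v, w'} k where
  act : ∀ {V : Type} {W : V → Type} [Finite V] [∀ v, Finite (W v)],
    obj V →ₗ[k] MultilinearMap k (fun v => O.obj (W v)) (obj (Σ v, W v))
  act_map : ∀ {V : Type} {W W' : V → Type} [Finite V] [∀ v, Finite (W v)]
    [∀ v, Finite (W' v)] (e : ∀ v, W v ≃ W' v) (a : obj V) (b : ∀ v, O.obj (W' v)),
    act a (fun v => O.map (e v) (b v)) = map (Equiv.sigmaCongrRight e) (act a b)
  map_act : ∀ {V V' : Type} {W : V' → Type} [Finite V] [Finite V'] [∀ v, Finite (W v)]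
    (e : V ≃ V') (a : obj V') (b : ∀ v, O.obj (W v)),
    act (map e a) (fun v => b (e v)) = map (Equiv.sigmaCongrLeft e) (act a b)
  act_one : ∀ {V : Type} [Finite V] (a : obj V),
    act a (fun _ => O.one) = map (Equiv.sigmaPUnit V) a
  act_assoc : ∀ {V : Type} {W : V → Type} {Z : ∀ v, W v → Type} [Finite V]
    [∀ v, Finite (W v)] [∀ v w, Finite (Z v w)] (a : obj V) (b : ∀ v, O.obj (W v))
    (c : ∀ v w, O.obj (Z v w)),
    act (act a b) (fun p => c p.1 p.2) =
      map (Equiv.sigmaAssoc Z) (act a (fun v => O.comp (b v) (c v)))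

namespace RightModule

variable {k : Type v} [Field k] {O : LinOperad.{v, w} k}

/-- Morphisms of right modules. -/
structure Hom (M : RightModule.{v, w, w'} O) (N : RightModule.{v, w, u} O) where
  app : ∀ (U : Type) [Finite U], M.obj U →ₗ[k] N.obj U
  app_map : ∀ {U V : Type} [Finite U] [Finite V] (e : U ≃ V) (x : M.obj V),
    app U (M.map e x) = N.map e (app V x)
  app_act : ∀ {V : Type} {W : V → Type} [Finite V] [∀ v, Finite (W v)] (x : M.obj V)
    (b : ∀ v, O.obj (W v)), app (Σ v, W v) (M.act x b) = N.act (app V x) b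

/-- The decomposable part `M · Ō`, where `Ō` is the augmentation ideal: the span of the elements
`m · (b_v)` for which at least one of the `b_v` belongs to the augmentation ideal. -/
def decomposables (M : RightModule.{v, w, w'} O) (U : Type) [Finite U] :
    Submodule k (M.obj U) :=
  Submodule.span k {x | ∃ (V : Type) (W : V → Type) (_ : Finite V) (_ : ∀ v, Finite (W v))
    (e : U ≃ Σ v, W v) (m : M.obj V) (b : ∀ v, O.obj (W v)),
    (∃ v, O.aug (b v) = 0) ∧ x = M.map e (M.act m b)}

/-- `⋯ → F 2 → F 1 → F 0 → M → 0` is a resolution of the right module `M` (exact on every finite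
set), and it is minimal: the differentials take values in the decomposable part. -/
structure IsMinimalResolution (F : ℕ → RightModule.{v, w, w'} O) (M : RightModule.{v, w, u} O)
    (δ : ∀ s, Hom (F (s + 1)) (F s)) (ε : Hom (F 0) M) : Prop where
  comp_eq_zero : ∀ (s : ℕ) (U : Type) [Finite U],
    (δ s).app U ∘ₗ (δ (s + 1)).app U = 0
  exact : ∀ (s : ℕ) (U : Type) [Finite U],
    LinearMap.ker ((δ s).app U) = LinearMap.range ((δ (s + 1)).app U)
  exact_zero : ∀ (U : Type) [Finite U],
    LinearMap.ker (ε.app U) = LinearMap.range ((δ 0).app U)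
  surjective : ∀ (U : Type) [Finite U], Function.Surjective (ε.app U)
  minimal : ∀ (s : ℕ) (U : Type) [Finite U],
    LinearMap.range ((δ s).app U) ≤ (F s).decomposables U

end RightModule

/-- The value of the unit collection `𝕀` on `U`: the field `k` if `U` has exactly one element, and
zero otherwise. -/
def unitSpace (k : Type v) [Field k] (U : Type) : Submodule k k where
  carrier := {x | Nat.card U ≠ 1 → x = 0}
  add_mem' ha hb h := by simp [ha h, hb h]
  zero_mem' _ := rfl
  smul_mem' c x hx h := by simp [hx h]

theorem LinOperad.aug_mem_unitSpace {k : Type v} [Field k] (O : LinOperad.{v, w} k) {V : Type}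
    {W : V → Type} [Fintype V] [∀ v, Finite (W v)] (m : unitSpace k V)
    (b : ∀ v, O.obj (W v)) :
    (m : k) * ∏ v, O.aug (b v) ∈ unitSpace k (Σ v, W v) := by
  intro h
  by_contra h0
  obtain ⟨hm, hb⟩ := mul_ne_zero_iff.1 h0
  have hV : Nat.card V = 1 := by
    by_contra hV
    exact hm (m.2 hV)
  have hW : ∀ v, Nat.card (W v) = 1 := fun v => by
    by_contra hW
    exact (Finset.prod_ne_zero_iff.1 hb v (Finset.mem_univ v)) (O.aug_eq_zero hW _)
  apply h
  rw [Nat.card_sigma, Finset.sum_congr rfl (fun v _ => hW v)]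
  simpa [Nat.card_eq_fintype_card] using hV

/-- The action of `O` on the unit collection through the augmentation:
`m · (b_v) = m ∏ aug (b_v)`. -/
noncomputable def augAct {k : Type v} [Field k] (O : LinOperad.{v, w} k) {V : Type}
    {W : V → Type} [Fintype V] [∀ v, Finite (W v)] :
    unitSpace k V →ₗ[k] MultilinearMap k (fun v => O.obj (W v)) (unitSpace k (Σ v, W v)) where
  toFun m :=
    { toFun := fun b => ⟨(m : k) * ∏ v, O.aug (b v), O.aug_mem_unitSpace m b⟩
      map_update_add' := by
        intro _ b i x y
        apply Subtype.ext
        have := (((MultilinearMap.mkPiAlgebra k V k).compLinearMap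
          (fun v => (O.aug : O.obj (W v) →ₗ[k] k)))).map_update_add b i x y
        simp only [MultilinearMap.compLinearMap_apply, MultilinearMap.mkPiAlgebra_apply] at this
        simp [this, mul_add]
      map_update_smul' := by
        intro _ b i c x
        apply Subtype.ext
        have := (((MultilinearMap.mkPiAlgebra k V k).compLinearMap
          (fun v => (O.aug : O.obj (W v) →ₗ[k] k)))).map_update_smul b i c x
        simp only [MultilinearMap.compLinearMap_apply, MultilinearMap.mkPiAlgebra_apply] at this
        simp [this, mul_left_comm] }
  map_add' m m' := by
    ext b
    simp [add_mul]
  map_smul' c m := by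
    ext b
    simp [mul_assoc]

/-- The augmentation module: the unit collection `𝕀`, on which `O` acts through its
augmentation. -/
noncomputable def augModule {k : Type v} [Field k] (O : LinOperad.{v, w} k) :
    RightModule.{v, w, v} O where
  obj U _ := unitSpace k U
  addCommGroup U _ := inferInstance
  module U _ := inferInstance
  map {U V} _ _ e := (unitSpace k V).subtype.codRestrict (unitSpace k U)
    (fun x h => x.2 (by rwa [← Nat.card_congr e]))
  map_refl _ := rfl
  map_trans _ _ _ := rfl
  act {V W} _ _ := @augAct k _ O V W (Fintype.ofFinite V) _
  act_map {V W W'} _ _ _ e a b := by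
    letI := Fintype.ofFinite V
    refine Subtype.ext (?_ : (a : k) * ∏ v, O.aug (O.map (e v) (b v)) = a * ∏ v, O.aug (b v))
    simp only [O.aug_map]
  map_act {V V' W} _ _ _ e a b := by
    letI := Fintype.ofFinite V
    letI := Fintype.ofFinite V'
    exact Subtype.ext (congrArg ((a : k) * ·) (Equiv.prod_comp e (fun v => O.aug (b v))))
  act_one {V} _ a := by
    letI := Fintype.ofFinite V
    refine Subtype.ext (?_ : (a : k) * ∏ v : V, O.aug O.one = a)
    simp only [O.aug_one, Finset.prod_const_one, mul_one]
  act_assoc {V W Z} _ _ _ a b c := by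
    letI := Fintype.ofFinite V
    letI := fun v => Fintype.ofFinite (W v)
    refine Subtype.ext ?_
    have h1 : ∀ v, O.aug (O.comp (b v) (c v)) = O.aug (b v) * ∏ w, O.aug (c v w) :=
      fun v => O.aug_comp _ _
    have h2 : @Finset.prod _ _ _ (@Finset.univ _ (Fintype.ofFinite (Σ v, W v)))
        (fun p => O.aug (c p.1 p.2)) = ∏ v, ∏ w, O.aug (c v w) := by
      rw [← Fintype.prod_sigma (fun p : (Σ v, W v) => O.aug (c p.1 p.2))]
      congr
      exact Subsingleton.elim _ _
    have h3 : ((a : k) * ∏ v, O.aug (b v)) *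
        @Finset.prod _ _ _ (@Finset.univ _ (Fintype.ofFinite (Σ v, W v)))
          (fun p => O.aug (c p.1 p.2)) = (a : k) * ∏ v, O.aug (O.comp (b v) (c v)) := by
      rw [h2, mul_assoc, ← Finset.prod_mul_distrib]
      simp only [h1]
    exact h3

/-! ### Linearisation -/

/-- The multilinear extension of a map `F : A × ∏ v, κ v → B` to the vector spaces with bases
`A`, `κ v`, `B`. -/
noncomputable def multiExt (k : Type v) [Field k] {V : Type} [Finite V] {κ : V → Type u}
    {A : Type w} {B : Type w'} (F : A → (∀ v, κ v) → B) :
    (A →₀ k) →ₗ[k] MultilinearMap k (fun v => κ v →₀ k) (B →₀ k) :=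
  letI := Fintype.ofFinite V
  letI := Classical.decEq V
  letI := Classical.decEq k
  letI := fun v => Classical.decEq (κ v)
  Finsupp.linearCombination k (fun a =>
    (Finsupp.lmapDomain k k (F a) ∘ₗ
      (PiTensorProduct.ofFinsuppEquiv' (R := k) (κ := κ)).toLinearMap).compMultilinearMap
        (PiTensorProduct.tprod k))

theorem multiExt_single (k : Type v) [Field k] {V : Type} [Finite V] {κ : V → Type u}
    {A : Type w} {B : Type w'} (F : A → (∀ v, κ v) → B) (a : A) (c : ∀ v, κ v) :
    multiExt k F (Finsupp.single a 1) (fun v => Finsupp.single (c v) 1) =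
      Finsupp.single (F a c) 1 := by
  letI := Fintype.ofFinite V
  letI := Classical.decEq V
  letI := Classical.decEq k
  letI := fun v => Classical.decEq (κ v)
  simp only [multiExt, Finsupp.linearCombination_single, one_smul,
    LinearMap.compMultilinearMap_apply, LinearMap.comp_apply, LinearEquiv.coe_coe]
  erw [PiTensorProduct.ofFinsuppEquiv'_tprod_single]
  simp

section Ext

variable {k : Type v} [Field k]

theorem lin_induction {A : Type u} {p : (A →₀ k) → Prop} (x : A →₀ k) (zero : p 0)
    (add : ∀ x y, p x → p y → p (x + y)) (smul : ∀ (c : k) x, p x → p (c • x))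
    (single : ∀ a, p (Finsupp.single a 1)) : p x := by
  induction x using Finsupp.induction_linear with
  | zero => exact zero
  | add f g hf hg => exact add _ _ hf hg
  | single a r =>
    have := smul r _ (single a)
    rwa [Finsupp.smul_single, smul_eq_mul, mul_one] at this

/-- Linearity in each variable separately: if all components of `c'` but the one at `v` are kept
fixed, then `f c'` is a linear function of `c' v`. -/
def IsMulti {V : Type} {κ : V → Type u} {N : Type w} [AddCommGroup N] [Module k N]
    (f : (∀ v, κ v →₀ k) → N) : Prop :=
  ∀ (c : ∀ v, κ v →₀ k) (v : V), ∃ L : (κ v →₀ k) →ₗ[k] N,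
    ∀ c', (∀ j, j ≠ v → c' j = c j) → f c' = L (c' v)

/-- A function of several vectors that is linear in each of them is determined by its values on
basis vectors. -/
theorem multi_ext {V : Type} [Finite V] {κ : V → Type u}
    {N : Type w} [AddCommGroup N] [Module k N] {f g : (∀ v, κ v →₀ k) → N}
    (hf : IsMulti f) (hg : IsMulti g)
    (h : ∀ c : ∀ v, κ v, f (fun v => Finsupp.single (c v) 1) =
      g (fun v => Finsupp.single (c v) 1)) (c : ∀ v, κ v →₀ k) : f c = g c := by
  classical
  have key : ∀ f : (∀ v, κ v →₀ k) → N, IsMulti f → ∀ c v, ∃ L : (κ v →₀ k) →ₗ[k] N,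
      ∀ x, f (Function.update c v x) = L x := fun f hf c v => by
    obtain ⟨L, hL⟩ := hf c v
    exact ⟨L, fun x => by
      rw [hL _ (fun j hj => Function.update_of_ne hj _ _), Function.update_self]⟩
  let mk : ∀ f : (∀ v, κ v →₀ k) → N, IsMulti f → MultilinearMap k (fun v => κ v →₀ k) N :=
    fun f hf => MultilinearMap.mk' f
      (fun c v x y => by
        obtain ⟨L, hL⟩ := key f hf c v
        have h1 := hL (x + y)
        have h2 := hL x
        have h3 := hL y
        rw [map_add, ← h2, ← h3] at h1
        convert h1)
      (fun c v r x => by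
        obtain ⟨L, hL⟩ := key f hf c v
        have h1 := hL (r • x)
        have h2 := hL x
        rw [map_smul, ← h2] at h1
        convert h1)
  have : mk f hf = mk g hg :=
    Module.Basis.ext_multilinear (fun _ => Finsupp.basisSingleOne) (by simpa [mk] using h)
  exact congrArg (fun F : MultilinearMap k (fun v => κ v →₀ k) N => F c) this

section

variable {V : Type} {κ : V → Type u} {N : Type w} [AddCommGroup N] [Module k N]

theorem isMulti_map (f : MultilinearMap k (fun v => κ v →₀ k) N) : IsMulti f := by
  classical
  intro c v
  refine ⟨f.toLinearMap c v, fun c' h => ?_⟩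
  rw [MultilinearMap.toLinearMap_apply]
  refine congrArg f (funext fun j => ?_)
  by_cases hj : j = v
  · subst hj
    rw [Function.update_self]
  · rw [Function.update_of_ne hj, h j hj]

theorem IsMulti.linear {f : (∀ v, κ v →₀ k) → N} (hf : IsMulti f) {N' : Type w'}
    [AddCommGroup N'] [Module k N'] (L : N →ₗ[k] N') : IsMulti (fun c => L (f c)) := by
  intro c v
  obtain ⟨L', h⟩ := hf c v
  exact ⟨L ∘ₗ L', fun c' hc => congrArg L (h c' hc)⟩

theorem IsMulti.left {f : (∀ v, κ v →₀ k) → N} (hf : IsMulti f) {V' : Type} {κ' : V' → Type u}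
    {N' : Type w'} [AddCommGroup N'] [Module k N']
    (L : N →ₗ[k] MultilinearMap k (fun v => κ' v →₀ k) N') (b : ∀ v, κ' v →₀ k) :
    IsMulti (fun c => L (f c) b) :=
  hf.linear (N' := N')
    { toFun := fun n => L n b
      map_add' := fun x y => by simp
      map_smul' := fun r x => by simp }

end

theorem multiExt_map {V : Type} [Finite V] {κ κ' : V → Type u} {A : Type w} {B B' : Type w'}
    (F : A → (∀ v, κ v) → B) (F' : A → (∀ v, κ' v) → B') (g : ∀ v, κ' v → κ v) (h : B' → B)
    (H : ∀ a b, F a (fun v => g v (b v)) = h (F' a b)) (a : A →₀ k) (b : ∀ v, κ' v →₀ k) :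
    multiExt k F a (fun v => Finsupp.lmapDomain k k (g v) (b v)) =
      Finsupp.lmapDomain k k h (multiExt k F' a b) := by
  induction a using lin_induction with
  | zero => simp only [map_zero, zero_apply]
  | add x y hx hy => simp only [map_add, add_apply, hx, hy]
  | smul r x hx => simp only [map_smul, smul_apply, hx]
  | single a =>
    refine multi_ext (f := fun b => multiExt k F (Finsupp.single a 1)
        (fun v => Finsupp.lmapDomain k k (g v) (b v)))
      (isMulti_map ((multiExt k F (Finsupp.single a 1)).compLinearMap
        (fun v => Finsupp.lmapDomain k k (g v))))
      ((isMulti_map (multiExt k F' (Finsupp.single a 1))).linear (Finsupp.lmapDomain k k h))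
      (fun c => ?_) b
    simp [multiExt_single, H]

theorem map_multiExt {V V' : Type} [Finite V] [Finite V'] {κ : V' → Type u} {A A' : Type w}
    {B B' : Type w'} (e : V ≃ V') (F : A → (∀ v, κ (e v)) → B) (F' : A' → (∀ v, κ v) → B')
    (g : A' → A) (h : B' → B) (H : ∀ a b, F (g a) (fun v => b (e v)) = h (F' a b))
    (a : A' →₀ k) (b : ∀ v, κ v →₀ k) :
    multiExt k F (Finsupp.lmapDomain k k g a) (fun v => b (e v)) =
      Finsupp.lmapDomain k k h (multiExt k F' a b) := by
  induction a using lin_induction with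
  | zero => simp only [map_zero, zero_apply]
  | add x y hx hy => simp only [map_add, add_apply, hx, hy]
  | smul r x hx => simp only [map_smul, smul_apply, hx]
  | single a =>
    refine multi_ext (f := fun b => multiExt k F (Finsupp.lmapDomain k k g (Finsupp.single a 1))
        (fun v => b (e v))) ?_
      ((isMulti_map (multiExt k F' (Finsupp.single a 1))).linear (Finsupp.lmapDomain k k h))
      (fun c => ?_) b
    · intro c v'
      obtain ⟨v, rfl⟩ := e.surjective v'
      obtain ⟨L, hL⟩ := isMulti_map (multiExt k F
        (Finsupp.lmapDomain k k g (Finsupp.single a 1))) (fun v => c (e v)) v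
      exact ⟨L, fun c' h => hL (fun v => c' (e v)) (fun j hj => h _ (e.injective.ne hj))⟩
    · have := multiExt_single k F (g a) (fun v => c (e v))
      simp [multiExt_single, H, this]

theorem multiExt_one {V : Type} [Finite V] {κ : V → Type u} {A : Type w} {B : Type w'}
    (F : A → (∀ v, κ v) → B) (o : ∀ v, κ v) (h : A → B) (H : ∀ a, F a o = h a) (a : A →₀ k) :
    multiExt k F a (fun v => Finsupp.single (o v) 1) = Finsupp.lmapDomain k k h a := by
  induction a using lin_induction with
  | zero => simp only [map_zero, zero_apply]
  | add x y hx hy => simp only [map_add, add_apply, hx, hy]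
  | smul r x hx => simp only [map_smul, smul_apply, hx]
  | single a =>
    simp [multiExt_single, H]

theorem one_multiExt {κ : Type u} {A : Type w} {B : Type w'}
    (F : A → (Unit → κ) → B) (o : A) (h : κ → B) (H : ∀ b, F o (fun _ => b) = h b)
    (b : κ →₀ k) :
    multiExt k F (Finsupp.single o 1) (fun _ => b) = Finsupp.lmapDomain k k h b := by
  refine multi_ext (V := Unit) (κ := fun _ => κ)
    (isMulti_map (multiExt k F (Finsupp.single o 1)))
    (g := fun c => Finsupp.lmapDomain k k h (c ())) ?_ (fun c => ?_) (fun _ => b)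
  · intro c v
    exact ⟨Finsupp.lmapDomain k k h, fun _ _ => rfl⟩
  · rw [multiExt_single]
    simp [← H]

theorem multiExt_assoc {V : Type} {W : V → Type} [Finite V] [∀ v, Finite (W v)]
    {κ : V → Type u} {μ : ∀ v, W v → Type u} {κ' : V → Type u} {A B : Type w} {C C' : Type w'}
    (F1 : A → (∀ v, κ v) → B) (F2 : B → (∀ p : (Σ v, W v), μ p.1 p.2) → C)
    (F3 : ∀ v, κ v → (∀ w, μ v w) → κ' v) (F4 : A → (∀ v, κ' v) → C') (h : C' → C)
    (H : ∀ a b (c : ∀ v w, μ v w), F2 (F1 a b) (fun p => c p.1 p.2) = h (F4 a (fun v => F3 v (b v) (c v))))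
    (a : A →₀ k) (b : ∀ v, κ v →₀ k) (c : ∀ v w, μ v w →₀ k) :
    multiExt k F2 (multiExt k F1 a b) (fun p => c p.1 p.2) =
      Finsupp.lmapDomain k k h
        (multiExt k F4 a (fun v => multiExt k (F3 v) (b v) (c v))) := by
  classical
  induction a using lin_induction with
  | zero => simp only [map_zero, zero_apply]
  | add x y hx hy => simp only [map_add, add_apply, hx, hy]
  | smul r x hx => simp only [map_smul, smul_apply, hx]
  | single a =>
    refine multi_ext (f := fun b => multiExt k F2 (multiExt k F1 (Finsupp.single a 1) b)
        (fun p => c p.1 p.2))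
      (g := fun b => Finsupp.lmapDomain k k h
          (multiExt k F4 (Finsupp.single a 1) (fun v => multiExt k (F3 v) (b v) (c v))))
      ((isMulti_map _).left _ _) (IsMulti.linear ?_ _) (fun b => ?_) b
    · intro b v
      obtain ⟨L, hL⟩ := isMulti_map (multiExt k F4 (Finsupp.single a 1))
        (fun v => multiExt k (F3 v) (b v) (c v)) v
      exact ⟨L ∘ₗ
        { toFun := fun x => multiExt k (F3 v) x (c v)
          map_add' := fun x y => by simp
          map_smul' := fun r x => by simp },
        fun b' h => hL (fun v => multiExt k (F3 v) (b' v) (c v)) (fun j hj => by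
          simp only [h j hj])⟩
    · refine multi_ext (V := Σ v, W v) (κ := fun p => μ p.1 p.2)
        (f := fun c => multiExt k F2
          (multiExt k F1 (Finsupp.single a 1) (fun v => Finsupp.single (b v) 1)) c)
        (g := fun c => Finsupp.lmapDomain k k h
          (multiExt k F4 (Finsupp.single a 1)
            (fun v => multiExt k (F3 v) (Finsupp.single (b v) 1) (fun w => c ⟨v, w⟩))))
        (isMulti_map _) (IsMulti.linear ?_ _) (fun c => ?_) (fun p => c p.1 p.2)
      · rintro c ⟨v, w⟩
        obtain ⟨L, hL⟩ := isMulti_map (multiExt k F4 (Finsupp.single a 1))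
          (fun v => multiExt k (F3 v) (Finsupp.single (b v) 1) (fun w => c ⟨v, w⟩)) v
        obtain ⟨L', hL'⟩ := isMulti_map (multiExt k (F3 v) (Finsupp.single (b v) 1))
          (fun w => c ⟨v, w⟩) w
        refine ⟨L ∘ₗ L', fun c' h => ?_⟩
        rw [LinearMap.comp_apply, ← hL' (fun w => c' ⟨v, w⟩) (fun i hi => h _ (fun h' =>
          hi (eq_of_heq (Sigma.mk.inj h').2)))]
        refine hL (fun v => multiExt k (F3 v) (Finsupp.single (b v) 1) (fun w => c' ⟨v, w⟩))
          (fun j hj => ?_)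
        refine congrArg (DFunLike.coe _) (funext fun i => h _ (fun h' => ?_))
        exact hj (Sigma.mk.inj h').1
      · have h1 : ∀ v, multiExt k (F3 v) (Finsupp.single (b v) 1)
            (fun w => Finsupp.single (c ⟨v, w⟩) 1) =
            Finsupp.single (F3 v (b v) (fun w => c ⟨v, w⟩)) 1 :=
          fun v => multiExt_single k (F3 v) (b v) (fun w => c ⟨v, w⟩)
        simp only [h1, multiExt_single, Finsupp.lmapDomain_apply, Finsupp.mapDomain_single]
        rw [← H a b (fun v w => c ⟨v, w⟩)]

end Ext

/-- The linearisation of a symmetric collection of sets. -/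
noncomputable def SymColl.lin (X : SymColl.{u}) (k : Type v) [Field k] :
    LinColl.{v, max u v} k where
  obj U _ := X.obj U →₀ k
  addCommGroup U _ := inferInstance
  module U _ := inferInstance
  map e := Finsupp.lmapDomain k k (X.map e)
  map_refl {U} _ x := by
    have : X.map (Equiv.refl U) = id := funext X.map_refl
    simp [this]
  map_trans e f x := by
    rw [← LinearMap.comp_apply, ← Finsupp.lmapDomain_comp]
    exact congrArg (fun g => Finsupp.lmapDomain k k g x) (funext fun y => X.map_trans e f y)

/-- The augmentation of the linearisation: the sum of the coefficients in arity one, and zero in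
other arities. -/
noncomputable def linAug (k : Type v) [Field k] (U : Type) (A : Type u) : (A →₀ k) →ₗ[k] k :=
  open Classical in
  if Nat.card U = 1 then Finsupp.linearCombination k (fun _ => (1 : k)) else 0

theorem linAug_single (k : Type v) [Field k] (U : Type) {A : Type u} (a : A)
    [Decidable (Nat.card U = 1)] :
    linAug k U A (Finsupp.single a 1) = if Nat.card U = 1 then 1 else 0 := by
  unfold linAug
  split_ifs <;> simp

theorem card_sigma_eq_one {V : Type} [Finite V] {W : V → Type} [∀ v, Finite (W v)]
    [∀ v, Nonempty (W v)] :
    Nat.card (Σ v, W v) = 1 ↔ Nat.card V = 1 ∧ ∀ v, Nat.card (W v) = 1 := by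
  simp only [Nat.card_eq_one_iff_unique]
  constructor
  · rintro ⟨hs, ⟨⟨v, w⟩⟩⟩
    refine ⟨⟨⟨fun a b => ?_⟩, ⟨v⟩⟩, fun a => ⟨⟨fun x y => ?_⟩, inferInstance⟩⟩
    · obtain ⟨x⟩ : Nonempty (W a) := inferInstance
      obtain ⟨y⟩ : Nonempty (W b) := inferInstance
      exact congrArg Sigma.fst (hs.elim ⟨a, x⟩ ⟨b, y⟩)
    · exact eq_of_heq (Sigma.mk.inj (hs.elim ⟨a, x⟩ ⟨a, y⟩)).2
  · rintro ⟨⟨hs, ⟨v⟩⟩, h⟩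
    obtain ⟨w⟩ : Nonempty (W v) := inferInstance
    refine ⟨⟨?_⟩, ⟨⟨v, w⟩⟩⟩
    rintro ⟨a, x⟩ ⟨b, y⟩
    obtain rfl := hs.elim a b
    rw [(h a).1.elim x y]

theorem linAug_map {k : Type v} [Field k] (P : SymColl.{u}) {U V : Type} [Finite U] [Finite V]
    (e : U ≃ V) (x : P.obj V →₀ k) :
    linAug k U _ (Finsupp.lmapDomain k k (P.map e) x) = linAug k V _ x := by
  classical
  induction x using lin_induction with
  | zero => simp only [map_zero]
  | add x y hx hy => simp only [map_add, hx, hy]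
  | smul r x hx => simp only [map_smul, hx]
  | single a =>
    rw [Finsupp.lmapDomain_apply, Finsupp.mapDomain_single, linAug_single, linAug_single,
      Nat.card_congr e]

theorem linAug_comp {k : Type v} [Field k] (P : SetOperad.{u}) {V : Type} {W : V → Type}
    [Fintype V] [∀ v, Finite (W v)] (a : P.obj V →₀ k) (b : ∀ v, P.obj (W v) →₀ k) :
    linAug k (Σ v, W v) _ (multiExt k P.comp a b) =
      linAug k V _ a * ∏ v, linAug k (W v) _ (b v) := by
  classical
  induction a using lin_induction with
  | zero => simp only [map_zero, zero_apply, zero_mul]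
  | add x y hx hy => simp only [map_add, add_apply, hx, hy, add_mul]
  | smul r x hx => simp only [map_smul, smul_apply, hx, smul_mul_assoc]
  | single a =>
    refine multi_ext
      (f := fun b => linAug k (Σ v, W v) _ (multiExt k P.comp (Finsupp.single a 1) b))
      (g := fun b => linAug k V (P.obj V) (Finsupp.single a 1) *
        ∏ v, linAug k (W v) (P.obj (W v)) (b v))
      ((isMulti_map (multiExt k P.comp (Finsupp.single a 1))).linear (linAug k _ _))
      ((isMulti_map ((MultilinearMap.mkPiAlgebra k V k).compLinearMap
        (fun v => linAug k (W v) (P.obj (W v))))).linear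
          (LinearMap.mulLeft k (linAug k V (P.obj V) (Finsupp.single a 1))))
      (fun b => ?_) b
    have : ∀ v, Nonempty (W v) := fun v => by
      by_contra hv
      have := not_nonempty_iff.1 hv
      exact (P.reduced (W v)).false (b v)
    simp only [multiExt_single, linAug_single, card_sigma_eq_one]
    by_cases h1 : Nat.card V = 1
    · by_cases h2 : ∀ v, Nat.card (W v) = 1
      · rw [if_pos ⟨h1, h2⟩, if_pos h1, Finset.prod_congr rfl (fun v _ => if_pos (h2 v))]
        simp
      · obtain ⟨v, hv⟩ := not_forall.1 h2
        rw [if_neg (fun h => h2 h.2), Finset.prod_eq_zero (Finset.mem_univ v) (if_neg hv),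
          mul_zero]
    · rw [if_neg h1, if_neg (fun h => h1 h.1), zero_mul]

/-- The linearisation of a reduced set operad. -/
noncomputable def SetOperad.lin (P : SetOperad.{u}) (k : Type v) [Field k] :
    LinOperad.{v, max u v} k where
  toLinColl := P.toSymColl.lin k
  one := Finsupp.single P.one 1
  comp := multiExt k P.comp
  comp_map e := multiExt_map _ _ _ _ (P.comp_map e)
  map_comp e := map_multiExt e _ _ _ _ (P.map_comp e)
  one_comp := one_multiExt _ _ _ P.one_comp
  comp_one := multiExt_one _ _ _ P.comp_one
  comp_assoc := multiExt_assoc _ _ _ _ _ P.comp_assoc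
  aug {U} _ := linAug k U (P.obj U)
  aug_eq_zero {U} _ h x := by
    have : linAug k U (P.obj U) = 0 := if_neg h
    rw [this]
    rfl
  aug_map := linAug_map P.toSymColl
  aug_one := by
    classical
    exact (linAug_single k Unit P.one).trans (if_pos (by simp))
  aug_comp := linAug_comp P

/-- The linearisation of a right module over a set operad. -/
noncomputable def SetModule.lin {P : SetOperad.{u}} (M : SetModule.{u, w} P) (k : Type v)
    [Field k] : RightModule.{v, max u v, max w v} (P.lin k) where
  toLinColl := M.toSymColl.lin k
  act := multiExt k M.act
  act_map e := multiExt_map _ _ _ _ (M.act_map e)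
  map_act e := map_multiExt e _ _ _ _ (M.map_act e)
  act_one := multiExt_one _ _ _ M.act_one
  act_assoc := multiExt_assoc _ _ _ _ _ M.act_assoc

/-! ### Subdivisions and the cut operad -/

/-- A box `[lo 1, hi 1] × ⋯ × [lo d, hi d]` in `ℝ^d`. -/
@[ext]
structure Rect (d : ℕ) where
  lo : Fin d → ℝ
  hi : Fin d → ℝ

namespace Rect

variable {d : ℕ}

/-- The unit cube. -/
def cube (d : ℕ) : Rect d := ⟨fun _ => 0, fun _ => 1⟩

/-- The box as a set of points. -/
def points (R : Rect d) : Set (Fin d → ℝ) := Set.Icc R.lo R.hi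

/-- The point `((m - l) a_i + l b_i) / m` of the `i`-th side `[a_i, b_i]` of the box. -/
noncomputable def cutPoint (R : Rect d) (i : Fin d) (m l : ℕ) : ℝ :=
  (((m : ℝ) - l) * R.lo i + l * R.hi i) / m

/-- The `j`-th of the `m` equal parts (`j = 0, …, m - 1`) into which the box is cut by hyperplanes
orthogonal to the `i`-th direction. -/
noncomputable def part (R : Rect d) (i : Fin d) (m j : ℕ) : Rect d :=
  ⟨Function.update R.lo i (R.cutPoint i m j), Function.update R.hi i (R.cutPoint i m (j + 1))⟩

/-- The affine map with diagonal linear part that takes the unit cube to the box. -/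
def toFun (R : Rect d) (x : Fin d → ℝ) : Fin d → ℝ :=
  fun i => R.lo i + (R.hi i - R.lo i) * x i

/-- The image of the box `S` under the affine map that takes the unit cube to `R`. -/
def mul (R S : Rect d) : Rect d := ⟨R.toFun S.lo, R.toFun S.hi⟩

/-- The box has sides of positive length. -/
def Nondeg (R : Rect d) : Prop := ∀ i, R.lo i < R.hi i

theorem toFun_mul (R S : Rect d) (x : Fin d → ℝ) :
    (R.mul S).toFun x = R.toFun (S.toFun x) := by
  funext i
  simp only [mul, toFun]
  ring

theorem mul_assoc (R S T : Rect d) : (R.mul S).mul T = R.mul (S.mul T) := by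
  ext i <;> simp only [mul, toFun] <;> ring

theorem cube_mul (R : Rect d) : (cube d).mul R = R := by
  ext i <;> simp [mul, toFun, cube]

theorem mul_cube (R : Rect d) : R.mul (cube d) = R := by
  ext i <;> simp [mul, toFun, cube]

theorem cube_toFun (x : Fin d → ℝ) : (cube d).toFun x = x := by
  funext i
  simp [toFun, cube]

theorem cube_nondeg : (cube d).Nondeg := fun _ => zero_lt_one

theorem Nondeg.mul {R S : Rect d} (hR : R.Nondeg) (hS : S.Nondeg) : (R.mul S).Nondeg := by
  intro i
  have h1 := hR i
  have h2 := hS i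
  simp only [Rect.mul, toFun]
  nlinarith

theorem cutPoint_lt {R : Rect d} (hR : R.Nondeg) (i : Fin d) {m : ℕ} (hm : 2 ≤ m) {l l' : ℕ}
    (h : l < l') : R.cutPoint i m l < R.cutPoint i m l' := by
  have h1 := hR i
  have h2 : (0 : ℝ) < m := by positivity
  have h3 : (l : ℝ) < l' := by exact_mod_cast h
  unfold cutPoint
  rw [div_lt_div_iff_of_pos_right h2]
  nlinarith

theorem cutPoint_le {R : Rect d} (hR : R.Nondeg) (i : Fin d) {m : ℕ} (hm : 2 ≤ m) {l l' : ℕ}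
    (h : l ≤ l') : R.cutPoint i m l ≤ R.cutPoint i m l' := by
  rcases h.eq_or_lt with rfl | h
  · exact le_rfl
  · exact (cutPoint_lt hR i hm h).le

theorem cutPoint_zero (R : Rect d) (i : Fin d) {m : ℕ} (hm : 2 ≤ m) :
    R.cutPoint i m 0 = R.lo i := by
  have h2 : (m : ℝ) ≠ 0 := by positivity
  unfold cutPoint
  field_simp
  push_cast
  ring

theorem cutPoint_self (R : Rect d) (i : Fin d) {m : ℕ} (hm : 2 ≤ m) :
    R.cutPoint i m m = R.hi i := by
  have h2 : (m : ℝ) ≠ 0 := by positivity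
  unfold cutPoint
  field_simp
  ring

theorem Nondeg.part {R : Rect d} (hR : R.Nondeg) (i : Fin d) {m : ℕ} (hm : 2 ≤ m) (j : ℕ) :
    (R.part i m j).Nondeg := by
  intro i'
  by_cases h : i' = i
  · subst h
    simpa [Rect.part] using cutPoint_lt hR i' hm (Nat.lt_succ_self j)
  · simpa [Rect.part, h] using hR i'

theorem mul_cutPoint (R S : Rect d) (i : Fin d) {m : ℕ} (hm : 2 ≤ m) (l : ℕ) :
    (R.mul S).cutPoint i m l = R.lo i + (R.hi i - R.lo i) * S.cutPoint i m l := by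
  have h2 : (m : ℝ) ≠ 0 := by positivity
  simp only [cutPoint, mul, toFun]
  field_simp
  ring

theorem mul_part (R S : Rect d) (i : Fin d) {m : ℕ} (hm : 2 ≤ m) (j : ℕ) :
    (R.mul S).part i m j = R.mul (S.part i m j) := by
  ext i'
  · by_cases h : i' = i
    · subst h
      simp only [part, mul_cutPoint R S i' hm, Function.update_self]
      simp [mul, toFun]
    · simp [part, mul, toFun, h]
  · by_cases h : i' = i
    · subst h
      simp only [part, mul_cutPoint R S i' hm, Function.update_self]
      simp [mul, toFun]
    · simp [part, mul, toFun, h]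

/-- `S` is contained in `R`. -/
def Sub (S R : Rect d) : Prop := ∀ i, R.lo i ≤ S.lo i ∧ S.hi i ≤ R.hi i

/-- The interiors of two boxes are separated by a coordinate hyperplane. -/
def Separated (R S : Rect d) : Prop := ∃ i, R.hi i ≤ S.lo i ∨ S.hi i ≤ R.lo i

theorem Separated.mono {R S R' S' : Rect d} (h : R.Separated S) (hR : R'.Sub R)
    (hS : S'.Sub S) : R'.Separated S' := by
  obtain ⟨i, h | h⟩ := h
  · exact ⟨i, Or.inl ((hR i).2.trans (h.trans (hS i).1))⟩
  · exact ⟨i, Or.inr ((hS i).2.trans (h.trans (hR i).1))⟩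

theorem Nondeg.not_separated {R : Rect d} (hR : R.Nondeg) : ¬ R.Separated R := by
  rintro ⟨i, h | h⟩ <;> exact absurd (hR i) (not_lt.2 h)

theorem part_sub {R : Rect d} (hR : R.Nondeg) (i : Fin d) {m : ℕ} (hm : 2 ≤ m) (j : Fin m) :
    (R.part i m j).Sub R := by
  intro i'
  by_cases h : i' = i
  · subst h
    simp only [part, Function.update_self]
    constructor
    · rw [← cutPoint_zero R i' hm]
      exact cutPoint_le hR i' hm (Nat.zero_le _)
    · rw [← cutPoint_self R i' hm]
      exact cutPoint_le hR i' hm j.2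
  · simp [part, h]

theorem part_separated {R : Rect d} (hR : R.Nondeg) (i : Fin d) {m : ℕ} (hm : 2 ≤ m)
    {j j' : ℕ} (h : j ≠ j') : (R.part i m j).Separated (R.part i m j') := by
  refine ⟨i, ?_⟩
  simp only [part, Function.update_self]
  rcases lt_or_gt_of_ne h with h | h
  · exact Or.inl (cutPoint_le hR i hm h)
  · exact Or.inr (cutPoint_le hR i hm h)

theorem mul_sub {R S : Rect d} (hR : R.Nondeg) (hS : S.Sub (cube d)) : (R.mul S).Sub R := by
  intro i
  have h1 := hR i
  have h2 := hS i
  simp only [cube] at h2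
  simp only [mul, toFun]
  constructor <;> nlinarith

theorem Nondeg.toFun_injective {R : Rect d} (hR : R.Nondeg) : Function.Injective R.toFun := by
  intro x y h
  funext i
  have h1 := congrFun h i
  have h2 := hR i
  simp only [toFun] at h1
  have h3 : R.hi i - R.lo i ≠ 0 := by linarith
  exact mul_left_cancel₀ h3 (by linarith)

theorem Nondeg.mul_injective {R : Rect d} (hR : R.Nondeg) : Function.Injective R.mul := by
  intro S T h
  have h1 := congrArg Rect.lo h
  have h2 := congrArg Rect.hi h
  exact Rect.ext (hR.toFun_injective h1) (hR.toFun_injective h2)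

/-- The image of a hyperplane cut under an affine map. -/
theorem image_cut {R : Rect d} (hR : R.Nondeg) (S : Rect d) (i : Fin d) {m : ℕ} (hm : 2 ≤ m)
    (l : ℕ) (x : Fin d → ℝ) :
    R.toFun x ∈ (R.mul S).points ∧ R.toFun x i = (R.mul S).cutPoint i m l ↔
      x ∈ S.points ∧ x i = S.cutPoint i m l := by
  have hpos : ∀ i, 0 < R.hi i - R.lo i := fun i => sub_pos.2 (hR i)
  rw [mul_cutPoint R S i hm]
  simp only [points, mul, Set.mem_Icc, Pi.le_def, toFun, add_le_add_iff_left,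
    mul_le_mul_iff_right₀ (hpos _), add_right_inj, mul_eq_mul_left_iff, (hpos i).ne', or_false]

theorem Nondeg.toFun_surjective {R : Rect d} (hR : R.Nondeg) :
    Function.Surjective R.toFun := by
  intro y
  refine ⟨fun i => (y i - R.lo i) / (R.hi i - R.lo i), ?_⟩
  funext i
  have h3 : R.hi i - R.lo i ≠ 0 := (sub_pos.2 (hR i)).ne'
  simp only [toFun]
  field_simp
  ring

end Rect

section Cut

variable {d : ℕ} (X : Fin d → SymColl.{u})

/-- A possible label of a cut: a direction `i`, a number of parts `m`, and an element of
`X_i (Fin m)`. -/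
def Label : Type u := Σ i : Fin d, Σ m : ℕ, (X i).obj (Fin m)

/-- Labelled cuts: the set of all pairs of a point of some cut and a label of this cut. -/
abbrev Cuts : Type u := Set ((Fin d → ℝ) × Label X)

variable {X}

/-- The `m - 1` hyperplane cuts orthogonal to the `i`-th direction that divide the box into `m`
equal parts, all labelled by `g`. -/
def hyperplaneCuts (R : Rect d) (i : Fin d) (m : ℕ) (g : (X i).obj (Fin m)) : Cuts X :=
  {p | (∃ l : ℕ, 1 ≤ l ∧ l ≤ m - 1 ∧ p.1 ∈ R.points ∧ p.1 i = R.cutPoint i m l) ∧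
    p.2 = ⟨i, m, g⟩}

/-- `IsSubdivision G R D E`: the set of boxes `D` together with the labelled cuts `E` forms an
`X`-subdivision of `R` (with labels of the cuts in `G`). -/
inductive IsSubdivision (G : ∀ i n, Set ((X i).obj (Fin n))) :
    Rect d → Set (Rect d) → Cuts X → Prop
  | trivial (R : Rect d) : IsSubdivision G R {R} ∅
  | cut (R : Rect d) (i : Fin d) (m : ℕ) (hm : 2 ≤ m) (g : (X i).obj (Fin m)) (hg : g ∈ G i m)
      (D : Fin m → Set (Rect d)) (E : Fin m → Cuts X)
      (h : ∀ j : Fin m, IsSubdivision G (R.part i m j) (D j) (E j)) :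
      IsSubdivision G R (⋃ j, D j) (hyperplaneCuts R i m g ∪ ⋃ j, E j)

/-- The image of labelled cuts under the affine map taking the unit cube to `R`. -/
def mulCuts (R : Rect d) (E : Cuts X) : Cuts X := (fun p => (R.toFun p.1, p.2)) '' E

variable {G : ∀ i n, Set ((X i).obj (Fin n))}

theorem mulCuts_hyperplaneCuts {R : Rect d} (hR : R.Nondeg) (S : Rect d) (i : Fin d) {m : ℕ}
    (hm : 2 ≤ m) (g : (X i).obj (Fin m)) :
    mulCuts R (hyperplaneCuts S i m g) = hyperplaneCuts (R.mul S) i m g := by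
  ext ⟨y, lab⟩
  simp only [mulCuts, hyperplaneCuts, Set.mem_image, Set.mem_ofPred_eq, Prod.mk.injEq, Prod.exists]
  constructor
  · rintro ⟨x, lab', ⟨⟨l, h1, h2, h3⟩, rfl⟩, rfl, rfl⟩
    exact ⟨⟨l, h1, h2, (Rect.image_cut hR S i hm l x).2 h3⟩, rfl⟩
  · rintro ⟨⟨l, h1, h2, h3⟩, rfl⟩
    obtain ⟨x, rfl⟩ := hR.toFun_surjective y
    exact ⟨x, _, ⟨⟨l, h1, h2, (Rect.image_cut hR S i hm l x).1 h3⟩, rfl⟩, rfl, rfl⟩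

theorem mulCuts_mul (R S : Rect d) (E : Cuts X) :
    mulCuts (R.mul S) E = mulCuts R (mulCuts S E) := by
  simp only [mulCuts, Set.image_image, Rect.toFun_mul]

theorem mulCuts_cube (E : Cuts X) : mulCuts (Rect.cube d) E = E := by
  simp [mulCuts, Rect.cube_toFun]

theorem IsSubdivision.mul {R S : Rect d} (hR : R.Nondeg) {D : Set (Rect d)} {E : Cuts X}
    (h : IsSubdivision G S D E) : IsSubdivision G (R.mul S) (R.mul '' D) (mulCuts R E) := by
  induction h with
  | trivial S =>
    have := IsSubdivision.trivial (G := G) (R.mul S)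
    simpa [mulCuts] using this
  | cut S i m hm g hg D E _ ih =>
    have := IsSubdivision.cut (G := G) (R.mul S) i m hm g hg (fun j => R.mul '' D j)
      (fun j => mulCuts R (E j)) (fun j => by
        rw [Rect.mul_part R S i hm]
        exact ih j)
    rw [← Set.image_iUnion, ← mulCuts_hyperplaneCuts hR S i hm g] at this
    simpa only [mulCuts, ← Set.image_iUnion, ← Set.image_union] using this

theorem IsSubdivision.nonempty {R : Rect d} {D : Set (Rect d)} {E : Cuts X}
    (h : IsSubdivision G R D E) : D.Nonempty := by
  induction h with
  | trivial R => exact Set.singleton_nonempty R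
  | cut R i m hm g hg D E _ ih => exact Set.nonempty_iUnion.2 ⟨⟨0, by omega⟩, ih _⟩

theorem IsSubdivision.boxes {R : Rect d} {D : Set (Rect d)} {E : Cuts X}
    (h : IsSubdivision G R D E) (hR : R.Nondeg) :
    (∀ B ∈ D, B.Nondeg ∧ B.Sub R) ∧ ∀ B ∈ D, ∀ B' ∈ D, B ≠ B' → B.Separated B' := by
  induction h with
  | trivial R =>
    refine ⟨?_, ?_⟩
    · rintro B rfl
      exact ⟨hR, fun i => ⟨le_rfl, le_rfl⟩⟩
    · rintro B rfl B' rfl h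
      exact absurd rfl h
  | cut R i m hm g hg D E _ ih =>
    have ih' := fun j => ih j (hR.part i hm j)
    refine ⟨fun B hB => ?_, fun B hB B' hB' hne => ?_⟩
    · obtain ⟨j, hj⟩ := Set.mem_iUnion.1 hB
      obtain ⟨h1, h2⟩ := (ih' j).1 B hj
      refine ⟨h1, fun i' => ?_⟩
      have h3 := Rect.part_sub hR i hm j i'
      exact ⟨h3.1.trans (h2 i').1, (h2 i').2.trans h3.2⟩
    · obtain ⟨j, hj⟩ := Set.mem_iUnion.1 hB
      obtain ⟨j', hj'⟩ := Set.mem_iUnion.1 hB'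
      by_cases h : j = j'
      · subst h
        exact (ih' j).2 B hj B' hj' hne
      · exact (Rect.part_separated hR i hm (fun h' => h (Fin.ext h'))).mono
          ((ih' j).1 B hj).2 ((ih' j').1 B' hj').2

theorem IsSubdivision.subst {R : Rect d} {D : Set (Rect d)} {E : Cuts X}
    (h : IsSubdivision G R D E) (D' : Rect d → Set (Rect d)) (E' : Rect d → Cuts X)
    (h' : ∀ B ∈ D, IsSubdivision G B (D' B) (E' B)) :
    IsSubdivision G R (⋃ B ∈ D, D' B) (E ∪ ⋃ B ∈ D, E' B) := by
  induction h with
  | trivial R => simpa using h' R rfl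
  | cut R i m hm g hg D E _ ih =>
    have := IsSubdivision.cut (G := G) R i m hm g hg (fun j => ⋃ B ∈ D j, D' B)
      (fun j => E j ∪ ⋃ B ∈ D j, E' B)
      (fun j => ih j (fun B hB => h' B (Set.mem_iUnion.2 ⟨j, hB⟩)))
    rwa [Set.iUnion_union_distrib, ← Set.union_assoc, ← Set.biUnion_iUnion,
      ← Set.biUnion_iUnion] at this

variable (G)

/-- An element of the cut operad: a subdivision of the unit cube, with the parts labelled by the
elements of `U`. -/
@[ext]
structure LabelledSubdivision (U : Type) : Type u where
  cell : U → Rect d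
  cuts : Cuts X
  injective : Function.Injective cell
  isSubdivision : IsSubdivision G (Rect.cube d) (Set.range cell) cuts

variable {G}

namespace LabelledSubdivision

theorem nondeg {U : Type} (a : LabelledSubdivision G U) (x : U) : (a.cell x).Nondeg :=
  ((a.isSubdivision.boxes Rect.cube_nondeg).1 _ ⟨x, rfl⟩).1

theorem sub {U : Type} (a : LabelledSubdivision G U) (x : U) :
    (a.cell x).Sub (Rect.cube d) :=
  ((a.isSubdivision.boxes Rect.cube_nondeg).1 _ ⟨x, rfl⟩).2

/-- Relabelling. -/
def map {U V : Type} (e : U ≃ V) (a : LabelledSubdivision G V) : LabelledSubdivision G U where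
  cell x := a.cell (e x)
  cuts := a.cuts
  injective := a.injective.comp e.injective
  isSubdivision := by
    have : Set.range (fun x => a.cell (e x)) = Set.range a.cell := e.surjective.range_comp a.cell
    rw [this]
    exact a.isSubdivision

/-- The trivial subdivision. -/
def one : LabelledSubdivision G Unit where
  cell _ := Rect.cube d
  cuts := ∅
  injective _ _ _ := rfl
  isSubdivision := by
    rw [Set.range_const]
    exact .trivial _

/-- Substitution of subdivisions: the `b v` are rescaled so that the unit cube fits exactly into
the part of `a` labelled `v`, and inserted in its place. -/
def comp {V : Type} {W : V → Type} (a : LabelledSubdivision G V)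
    (b : ∀ v, LabelledSubdivision G (W v)) : LabelledSubdivision G (Σ v, W v) where
  cell p := (a.cell p.1).mul ((b p.1).cell p.2)
  cuts := a.cuts ∪ ⋃ v, mulCuts (a.cell v) (b v).cuts
  injective := by
    rintro ⟨v, w⟩ ⟨v', w'⟩ h
    have hvv : v = v' := by
      by_contra hne
      have h1 := (a.isSubdivision.boxes Rect.cube_nondeg).2 _ ⟨v, rfl⟩ _ ⟨v', rfl⟩
        (a.injective.ne hne)
      have h2 := h1.mono (Rect.mul_sub (a.nondeg v) ((b v).sub w))
        (Rect.mul_sub (a.nondeg v') ((b v').sub w'))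
      dsimp only at h
      rw [← h] at h2
      exact ((a.nondeg v).mul ((b v).nondeg w)).not_separated h2
    subst hvv
    have hw : w = w' := (b v).injective ((a.nondeg v).mul_injective h)
    rw [hw]
  isSubdivision := by
    have key := a.isSubdivision.subst
      (fun B => ⋃ v, ⋃ (_ : a.cell v = B), B.mul '' Set.range (b v).cell)
      (fun B => ⋃ v, ⋃ (_ : a.cell v = B), mulCuts B (b v).cuts) (by
        rintro _ ⟨v, rfl⟩
        have h := (b v).isSubdivision.mul (a.nondeg v)
        rw [Rect.mul_cube] at h
        convert h using 1
        · ext B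
          simp only [Set.mem_iUnion]
          constructor
          · rintro ⟨v', hv, hB⟩
            obtain rfl := a.injective hv
            exact hB
          · exact fun hB => ⟨v, rfl, hB⟩
        · ext B
          simp only [Set.mem_iUnion]
          constructor
          · rintro ⟨v', hv, hB⟩
            obtain rfl := a.injective hv
            exact hB
          · exact fun hB => ⟨v, rfl, hB⟩)
    convert key using 1
    · ext B
      simp only [Set.mem_range, Sigma.exists, Set.mem_iUnion, Set.mem_image]
      constructor
      · rintro ⟨v, w, rfl⟩
        exact ⟨_, ⟨v, rfl⟩, v, rfl, _, ⟨w, rfl⟩, rfl⟩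
      · rintro ⟨_, _, v, rfl, _, ⟨w, rfl⟩, rfl⟩
        exact ⟨v, w, rfl⟩
    · congr 1
      ext p
      simp only [Set.mem_iUnion, Set.mem_range]
      constructor
      · rintro ⟨v, h⟩
        exact ⟨_, ⟨v, rfl⟩, v, rfl, h⟩
      · rintro ⟨_, _, v, rfl, h⟩
        exact ⟨v, h⟩

end LabelledSubdivision

variable (G)

/-- The cut operad of `X`, where `G` is a chosen set of free generators of the collections
`X_1, …, X_d`. -/
def cutOperad : SetOperad.{u} where
  obj U _ := LabelledSubdivision G U
  map e := LabelledSubdivision.map e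
  map_refl _ := rfl
  map_trans _ _ _ := rfl
  reduced U _ _ := ⟨fun a => by
    obtain ⟨_, x, _⟩ := a.isSubdivision.nonempty
    exact isEmptyElim x⟩
  one := .one
  comp a b := a.comp b
  comp_map _ _ _ := rfl
  map_comp e a b := by
    refine LabelledSubdivision.ext rfl ?_
    exact congrArg (a.cuts ∪ ·)
      (e.surjective.iUnion_comp (fun v => mulCuts (a.cell v) (b v).cuts))
  one_comp b := by
    refine LabelledSubdivision.ext ?_ ?_
    · funext p
      exact Rect.cube_mul _
    · simp [LabelledSubdivision.comp, LabelledSubdivision.one, LabelledSubdivision.map,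
        mulCuts_cube]
      exact Set.iUnion_const _
  comp_one a := by
    refine LabelledSubdivision.ext ?_ ?_
    · funext p
      exact Rect.mul_cube _
    · simp [LabelledSubdivision.comp, LabelledSubdivision.one, LabelledSubdivision.map, mulCuts]
  comp_assoc a b c := by
    refine LabelledSubdivision.ext ?_ ?_
    · funext p
      exact Rect.mul_assoc _ _ _
    · simp only [LabelledSubdivision.comp, LabelledSubdivision.map, Set.iUnion_sigma,
        mulCuts_mul]
      simp only [mulCuts, Set.image_union, Set.image_iUnion, Set.iUnion_union_distrib,
        Set.union_assoc]

end Cut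

/-- The free right module, over the linearised cut operad, generated by the part of homological
degree `s` of `(𝕀 ⊕ 𝕜X₁) □ ⋯ □ (𝕀 ⊕ 𝕜X_d)`.  Linearisation takes disjoint unions to direct sums
and products to tensor products, so it may be applied after forming `□` and `∘`. -/
noncomputable def cutResolution (k : Type v) [Field k] {d : ℕ} (X : Fin d → SymColl.{u})
    (G : ∀ i n, Set ((X i).obj (Fin n))) (s : ℕ) :
    RightModule.{v, max u v, max u v} ((cutOperad G).lin k) :=
  (freeModule (cutGenDeg X s) (cutOperad G)).lin k

end CutRes

open CutRes

/-! On a finite set `U`, a basis element of the degree `s` term is a grid, cutting the cube once in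
each direction of an `s`-element set `I`, together with subdivisions filled into the boxes of the
grid. Substituting them produces a subdivision `c` of the cube with parts labelled by `U`, which may
start with a cut in any direction of `I`. The main point is that the pair `(c, I)` determines the
basis element, and that every pair with `I` contained in the set `c.dirs` of all possible first
directions occurs (`FreeBasis.total_injective`, `FreeBasis.total_surjective`).

In these terms the complex is a direct sum over `c` of augmented chain complexes of full simplices
with vertex set `c.dirs`; the differential is the alternating sum of the faces `I.erase i`. Such a
complex is contractible as soon as `c.dirs` is nonempty (`simplexBoundary_simplexCone`). The set is
empty only for the trivial subdivision, which lives in arity one and accounts for the augmentation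
module. Substitution into the parts changes `c` but not `I`, so the differential is a module map
(`faceMap_act`). The resolution is minimal since `c` has cuts in the direction `i` that the grid of
the face `I.erase i` does not have; hence some box of that grid is subdivided further
(`FreeBasis.exists_card_ne_one`).

The description by pairs rests on two facts: the label of a first cut in a given direction is unique
(`HasCut.unique`), and first cuts in several directions can be made simultaneously
(`IsSubdivision.exists_grid`). Both are reduced to dimension one by restriction to lines parallel to
an axis whose other coordinates are irrational: all cuts have rational coordinates, so such a line
never runs inside a cut orthogonal to another axis. On an interval, the leftmost of the shortest
gaps between neighbouring endpoints belongs to an innermost cut, and the points of that cut can be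
erased without disturbing the first cut; iterating until only the first cut is left identifies it
(`HasRoot.unique`). Conversely, a first cut seen on all generic lines is a first cut of the box
(`IsSubdivision.hasCut`), by interchanging cuts in different directions. Finally, the fillings of a
grid are recovered from the union of all cuts, because cuts are closed and their generic points are
dense (`gridCuts_injective`). -/

namespace CutRes

/-! ### Subdivisions of an interval: the cuts determine the first cut. -/

section Intervals

variable {L : Type*} (n : L → ℕ)

/-- The `l`-th of the points dividing `[a, b]` into `m` equal parts. -/
noncomputable def divPoint (a b : ℝ) (m l : ℕ) : ℝ := (((m : ℝ) - l) * a + l * b) / m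

theorem divPoint_zero (a b : ℝ) {m : ℕ} (hm : 2 ≤ m) : divPoint a b m 0 = a := by
  have h2 : (m : ℝ) ≠ 0 := by positivity
  unfold divPoint
  field_simp
  push_cast
  ring

theorem divPoint_self (a b : ℝ) {m : ℕ} (hm : 2 ≤ m) : divPoint a b m m = b := by
  have h2 : (m : ℝ) ≠ 0 := by positivity
  unfold divPoint
  field_simp
  ring

theorem divPoint_eq (a b : ℝ) {m : ℕ} (hm : 2 ≤ m) (l : ℕ) :
    divPoint a b m l = a + l * ((b - a) / m) := by
  have h2 : (m : ℝ) ≠ 0 := by positivity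
  unfold divPoint
  field_simp
  ring

theorem divPoint_strictMono {a b : ℝ} (hab : a < b) {m : ℕ} (hm : 2 ≤ m) :
    StrictMono (divPoint a b m) := by
  intro l l' h
  have h2 : (0 : ℝ) < m := by positivity
  have h3 : (l : ℝ) < l' := by exact_mod_cast h
  rw [divPoint_eq a b hm, divPoint_eq a b hm]
  have : 0 < (b - a) / m := div_pos (sub_pos.2 hab) h2
  nlinarith

/-- The labelled cuts dividing `[a, b]` into `n r` equal parts. -/
def divCuts (a b : ℝ) (r : L) : Set (ℝ × L) :=
  {p | (∃ l : ℕ, 1 ≤ l ∧ l ≤ n r - 1 ∧ p.1 = divPoint a b (n r) l) ∧ p.2 = r}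

/-- Iterated subdivisions of an interval, given by the set of labelled cuts. -/
inductive IntervalSubdivision : ℝ → ℝ → Set (ℝ × L) → Prop
  | trivial (a b : ℝ) : IntervalSubdivision a b ∅
  | cut (a b : ℝ) (r : L) (hr : 2 ≤ n r) (P : Fin (n r) → Set (ℝ × L))
      (h : ∀ j : Fin (n r), IntervalSubdivision (divPoint a b (n r) j)
        (divPoint a b (n r) (j + 1)) (P j)) :
      IntervalSubdivision a b (divCuts n a b r ∪ ⋃ j, P j)

/-- The set of labelled cuts `P` is that of an iterated subdivision of `[a, b]` which starts by
cutting according to `r`. -/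
def HasRoot (a b : ℝ) (P : Set (ℝ × L)) (r : L) : Prop :=
  2 ≤ n r ∧ ∃ Q : Fin (n r) → Set (ℝ × L),
    (∀ j : Fin (n r), IntervalSubdivision n (divPoint a b (n r) j)
      (divPoint a b (n r) (j + 1)) (Q j)) ∧ P = divCuts n a b r ∪ ⋃ j, Q j

variable {n}

theorem HasRoot.isSubdivision {a b : ℝ} {P : Set (ℝ × L)} {r : L} (h : HasRoot n a b P r) :
    IntervalSubdivision n a b P := by
  obtain ⟨h2, Q, hQ, rfl⟩ := h
  exact .cut a b r h2 Q hQ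

theorem mem_Ioo_of_mem_divCuts {a b : ℝ} (hab : a < b) {r : L} (hr : 2 ≤ n r) {p : ℝ × L}
    (hp : p ∈ divCuts n a b r) : p.1 ∈ Set.Ioo a b := by
  obtain ⟨⟨l, h1, h2, h3⟩, -⟩ := hp
  rw [h3]
  constructor
  · conv_lhs => rw [← divPoint_zero a b hr]
    exact divPoint_strictMono hab hr (by omega)
  · conv_rhs => rw [← divPoint_self a b hr]
    exact divPoint_strictMono hab hr (by omega)

/-- Cuts avoid the ends of the interval, so cut points made in different parts are distinct from
each other and from the division points of the enclosing cut. -/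
theorem IntervalSubdivision.mem_Ioo {a b : ℝ} {P : Set (ℝ × L)}
    (h : IntervalSubdivision n a b P) (hab : a < b) : ∀ p ∈ P, p.1 ∈ Set.Ioo a b := by
  induction h with
  | trivial a b => simp
  | cut a b r hr P _ ih =>
    have hm := divPoint_strictMono hab hr
    rintro p (hp | hp)
    · exact mem_Ioo_of_mem_divCuts hab hr hp
    · obtain ⟨j, hj⟩ := Set.mem_iUnion.1 hp
      obtain ⟨h1, h2⟩ := ih j (hm (Nat.lt_succ_self _)) p hj
      constructor
      · refine lt_of_le_of_lt ?_ h1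
        conv_lhs => rw [← divPoint_zero a b hr]
        exact hm.monotone (Nat.zero_le _)
      · refine lt_of_lt_of_le h2 ?_
        conv_rhs => rw [← divPoint_self a b hr]
        exact hm.monotone j.2

theorem IntervalSubdivision.finite {a b : ℝ} {P : Set (ℝ × L)}
    (h : IntervalSubdivision n a b P) : P.Finite := by
  induction h with
  | trivial a b => exact Set.finite_empty
  | cut a b r hr P _ ih =>
    refine Set.Finite.union ?_ (Set.finite_iUnion ih)
    refine ((Set.finite_le_nat (n r)).image (fun l => (divPoint a b (n r) l, r))).subset ?_
    rintro ⟨x, r'⟩ ⟨⟨l, h1, h2, h3⟩, h4⟩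
    refine ⟨l, ?_, ?_⟩
    · show l ≤ n r
      omega
    · exact Prod.ext h3.symm h4.symm

theorem eq_of_divPoint {a b : ℝ} (hab : a < b) {m : ℕ} (hm : 2 ≤ m) {j j' : ℕ} {y : ℝ}
    (h1 : divPoint a b m j ≤ y) (h2 : y < divPoint a b m (j + 1))
    (h3 : divPoint a b m j' ≤ y) (h4 : y < divPoint a b m (j' + 1)) : j = j' := by
  have hs := divPoint_strictMono hab hm
  have := hs.lt_iff_lt.1 (h1.trans_lt h4)
  have := hs.lt_iff_lt.1 (h3.trans_lt h2)
  omega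

theorem exists_divPoint {a b : ℝ} {m : ℕ} (hm : 2 ≤ m) {y : ℝ} (h1 : a ≤ y) (h2 : y < b) :
    ∃ j : Fin m, divPoint a b m j ≤ y ∧ y < divPoint a b m (j + 1) := by
  have : ∀ l ≤ m, y < divPoint a b m l → ∃ j : Fin m, divPoint a b m j ≤ y ∧
      y < divPoint a b m (j + 1) := by
    intro l
    induction l with
    | zero =>
      intro _ h
      rw [divPoint_zero a b hm] at h
      exact absurd h1 (not_le.2 h)
    | succ l ih =>
      intro hl h
      by_cases hy : y < divPoint a b m l
      · exact ih (by omega) hy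
      · exact ⟨⟨l, hl⟩, not_lt.1 hy, h⟩
  exact this m le_rfl (by rwa [divPoint_self a b hm])

/-- Division points are ends of the parts, whereas later cuts are interior to a single part; hence
no point is cut twice. A point of an innermost cut therefore reveals the label of that cut. -/
theorem IntervalSubdivision.label_unique {a b : ℝ} {P : Set (ℝ × L)}
    (h : IntervalSubdivision n a b P) (hab : a < b) :
    ∀ (t : ℝ) (r r' : L), (t, r) ∈ P → (t, r') ∈ P → r = r' := by
  induction h with
  | trivial a b => simp
  | cut a b r hr P hP ih =>
    have hm := divPoint_strictMono hab hr
    have hi := fun j : Fin (n r) => (hP j).mem_Ioo (hm (Nat.lt_succ_self j))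
    have key : ∀ (t : ℝ) (r' r'' : L), (t, r') ∈ divCuts n a b r → ∀ j, (t, r'') ∉ P j := by
      rintro t r' r'' ⟨⟨l, h1, h2, h3⟩, h4⟩ j hj
      have := hi j _ hj
      simp only at h3
      simp only [h3, Set.mem_Ioo, hm.lt_iff_lt] at this
      omega
    rintro t r₁ r₂ (h1 | h1) (h2 | h2)
    · exact h1.2.trans h2.2.symm
    · obtain ⟨j, hj⟩ := Set.mem_iUnion.1 h2
      exact absurd hj (key _ _ _ h1 j)
    · obtain ⟨j, hj⟩ := Set.mem_iUnion.1 h1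
      exact absurd hj (key _ _ _ h2 j)
    · obtain ⟨j, hj⟩ := Set.mem_iUnion.1 h1
      obtain ⟨j', hj'⟩ := Set.mem_iUnion.1 h2
      have h3 := hi j _ hj
      have h4 := hi j' _ hj'
      obtain rfl : j = j' := Fin.ext (eq_of_divPoint hab hr h3.1.le h3.2 h4.1.le h4.2)
      exact ih j (hm (Nat.lt_succ_self _)) _ _ _ hj hj'

/-- The endpoints of the parts. -/
def endpoints (a b : ℝ) (P : Set (ℝ × L)) : Set ℝ := insert a (insert b (Prod.fst '' P))

/-- `[x, x + c]` is the leftmost among the shortest intervals between elements of `N`. -/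
structure IsFirstMinGap (N : Set ℝ) (c x : ℝ) : Prop where
  pos : 0 < c
  sep : ∀ y ∈ N, ∀ z ∈ N, y < z → y + c ≤ z
  left_mem : x ∈ N
  right_mem : x + c ∈ N
  first : ∀ y ∈ N, y + c ∈ N → x ≤ y

theorem exists_isFirstMinGap {N : Set ℝ} (hN : N.Finite) {a b : ℝ} (ha : a ∈ N) (hb : b ∈ N)
    (hab : a < b) : ∃ c x, IsFirstMinGap N c x := by
  have hD : {p : ℝ × ℝ | p.1 ∈ N ∧ p.2 ∈ N ∧ p.1 < p.2}.Finite :=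
    (hN.prod hN).subset (fun p hp => ⟨hp.1, hp.2.1⟩)
  obtain ⟨⟨y, z⟩, ⟨hy, hz, hyz⟩, hmin⟩ :=
    Set.exists_min_image _ (fun p : ℝ × ℝ => p.2 - p.1) hD ⟨(a, b), ha, hb, hab⟩
  have hF : {x : ℝ | x ∈ N ∧ x + (z - y) ∈ N}.Finite := hN.subset (fun x hx => hx.1)
  obtain ⟨x, hx, hfirst⟩ := Set.exists_min_image _ id hF ⟨y, hy, by simpa using hz⟩
  refine ⟨z - y, x, sub_pos.2 hyz, fun s hs t ht hst => ?_, hx.1, hx.2, fun s hs hs' =>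
    hfirst s ⟨hs, hs'⟩⟩
  have := hmin (s, t) ⟨hs, ht, hst⟩
  simp only at this
  linarith

variable (n) in
/-- The labelled points `x + c, …, x + (n r - 1) c`. -/
def run (c x : ℝ) (r : L) : Set (ℝ × L) :=
  {p | (∃ l : ℕ, 1 ≤ l ∧ l ≤ n r - 1 ∧ p.1 = x + l * c) ∧ p.2 = r}

/-- The inductive step of the erasure of an innermost cut. The hypothesis `ih` is kept separate so
that the step serves both the induction in `IntervalSubdivision.reduce` and the version
`HasRoot.reduce`, which keeps track of the first cut. -/
theorem reduce_aux {a b : ℝ} (hab : a < b) {r : L} (hr : 2 ≤ n r) {P : Fin (n r) → Set (ℝ × L)}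
    (hP : ∀ j : Fin (n r), IntervalSubdivision n (divPoint a b (n r) j)
        (divPoint a b (n r) (j + 1)) (P j))
    {c x : ℝ}
    (ih : ∀ j : Fin (n r), (P j).Nonempty →
      IsFirstMinGap (endpoints (divPoint a b (n r) j) (divPoint a b (n r) (j + 1)) (P j)) c x →
      x + c < divPoint a b (n r) (j + 1) ∧ ∃ r₀, 2 ≤ n r₀ ∧ run n c x r₀ ⊆ P j ∧
        IntervalSubdivision n (divPoint a b (n r) j) (divPoint a b (n r) (j + 1))
          (P j \ run n c x r₀))
    (hg : IsFirstMinGap (endpoints a b (divCuts n a b r ∪ ⋃ j, P j)) c x) :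
    x + c < b ∧ ∃ r₀, 2 ≤ n r₀ ∧ run n c x r₀ ⊆ divCuts n a b r ∪ ⋃ j, P j ∧
      ((r = r₀ ∧ divCuts n a b r ∪ ⋃ j, P j = run n c x r₀) ∨
        HasRoot n a b ((divCuts n a b r ∪ ⋃ j, P j) \ run n c x r₀) r) := by
  have hs := divPoint_strictMono hab hr
  have hi := fun j : Fin (n r) => (hP j).mem_Ioo (hs (Nat.lt_succ_self j))
  have hsub := (IntervalSubdivision.cut a b r hr P hP).mem_Ioo hab
  have hle : ∀ y ∈ endpoints a b (divCuts n a b r ∪ ⋃ j, P j), a ≤ y ∧ y ≤ b := by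
    rintro y (rfl | rfl | ⟨p, hp, rfl⟩)
    · exact ⟨le_rfl, hab.le⟩
    · exact ⟨hab.le, le_rfl⟩
    · exact ⟨(hsub p hp).1.le, (hsub p hp).2.le⟩
  have hdiv : ∀ l ≤ n r, divPoint a b (n r) l ∈ endpoints a b (divCuts n a b r ∪ ⋃ j, P j) := by
    intro l hl
    rcases Nat.eq_zero_or_pos l with rfl | h0
    · exact Or.inl (divPoint_zero a b hr)
    rcases hl.eq_or_lt with rfl | hl
    · exact Or.inr (Or.inl (divPoint_self a b hr))
    · exact Or.inr (Or.inr ⟨(_, r), Or.inl ⟨⟨l, h0, by omega, rfl⟩, rfl⟩, rfl⟩)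
  have hchild : ∀ (j : Fin (n r)) (y : ℝ), divPoint a b (n r) j ≤ y →
      y ≤ divPoint a b (n r) (j + 1) → y ∈ endpoints a b (divCuts n a b r ∪ ⋃ j, P j) →
      y ∈ endpoints (divPoint a b (n r) j) (divPoint a b (n r) (j + 1)) (P j) := by
    intro j y h1 h2 hy
    have hl : ∀ l, y = divPoint a b (n r) l →
        y ∈ endpoints (divPoint a b (n r) j) (divPoint a b (n r) (j + 1)) (P j) := by
      rintro l rfl
      rw [hs.le_iff_le] at h1 h2
      have : l = j ∨ l = j + 1 := by omega
      rcases this with rfl | rfl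
      · exact Or.inl rfl
      · exact Or.inr (Or.inl rfl)
    rcases hy with rfl | rfl | ⟨p, hp | hp, rfl⟩
    · exact hl 0 (divPoint_zero _ b hr).symm
    · exact hl (n r) (divPoint_self a _ hr).symm
    · obtain ⟨⟨l, -, -, h⟩, -⟩ := hp
      exact hl l h
    · obtain ⟨j', hj'⟩ := Set.mem_iUnion.1 hp
      have h3 := hi j' _ hj'
      have h4 := hs.lt_iff_lt.1 (h1.trans_lt h3.2)
      have h5 := hs.lt_iff_lt.1 (h3.1.trans_le h2)
      obtain rfl : j = j' := Fin.ext (by omega)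
      exact Or.inr (Or.inr ⟨p, hj', rfl⟩)
  have hchild' : ∀ (j : Fin (n r)) (y : ℝ),
      y ∈ endpoints (divPoint a b (n r) j) (divPoint a b (n r) (j + 1)) (P j) →
      y ∈ endpoints a b (divCuts n a b r ∪ ⋃ j, P j) := by
    rintro j y (rfl | rfl | ⟨p, hp, rfl⟩)
    · exact hdiv _ j.2.le
    · exact hdiv _ j.2
    · exact Or.inr (Or.inr ⟨p, Or.inr (Set.mem_iUnion.2 ⟨j, hp⟩), rfl⟩)
  have hxb : x < b := by
    have := (hle _ hg.right_mem).2
    have := hg.pos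
    linarith
  obtain ⟨j, hj1, hj2⟩ := exists_divPoint hr (hle _ hg.left_mem).1 hxb
  -- The division points are themselves endpoints, so a shortest gap cannot straddle one: it lies in
  -- the `j`-th part and is the first shortest gap there too.
  have hxc : x + c ≤ divPoint a b (n r) (j + 1) := hg.sep _ hg.left_mem _ (hdiv _ j.2) hj2
  have hgj : IsFirstMinGap (endpoints (divPoint a b (n r) j) (divPoint a b (n r) (j + 1)) (P j))
      c x := by
    refine ⟨hg.pos, fun y hy z hz => hg.sep y (hchild' j y hy) z (hchild' j z hz),
      hchild j _ hj1 hj2.le hg.left_mem, hchild j _ ?_ hxc hg.right_mem, fun y hy hy' =>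
      hg.first y (hchild' j _ hy) (hchild' j _ hy')⟩
    have := hg.pos
    linarith
  -- If the part with the gap is uncut, the gap is the whole part and `c` is the common length of
  -- the parts. Minimality then leaves all parts uncut, and being leftmost forces `x = a`, so only
  -- the cut `r` is present. Otherwise the erasure takes place inside the `j`-th part.
  rcases (P j).eq_empty_or_nonempty with hPj | hPj
  · have hpos := hg.pos
    have hx : x = divPoint a b (n r) j := by
      have := hgj.left_mem
      simp only [endpoints, hPj, Set.image_empty, Set.mem_insert_iff,
        Set.mem_empty_iff_false, or_false] at this
      exact this.resolve_right hj2.ne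
    have hxc' : x + c = divPoint a b (n r) (j + 1) := by
      have := hgj.right_mem
      simp only [endpoints, hPj, Set.image_empty, Set.mem_insert_iff,
        Set.mem_empty_iff_false, or_false] at this
      refine this.resolve_left (fun h => ?_)
      linarith
    have hc : c = (b - a) / n r := by
      rw [hx, divPoint_eq a b hr, divPoint_eq a b hr] at hxc'
      push_cast at hxc'
      linarith
    have hxa : x = a := by
      refine le_antisymm (hg.first a (Or.inl rfl) ?_) (hle _ hg.left_mem).1
      have h1 := hdiv 1 (by omega)
      rw [divPoint_eq a b hr] at h1
      rw [hc]
      simpa using h1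
    -- A cut inside any part would be closer than `c` to the left end of that part.
    have hempty : ∀ j', P j' = ∅ := by
      intro j'
      by_contra h
      obtain ⟨p, hp⟩ := Set.nonempty_iff_ne_empty.2 h
      have h1 := hi j' p hp
      have h2 := hg.sep _ (hdiv j' j'.2.le) p.1
        (Or.inr (Or.inr ⟨p, Or.inr (Set.mem_iUnion.2 ⟨j', hp⟩), rfl⟩)) h1.1
      have h3 := h1.2
      rw [divPoint_eq a b hr] at h2 h3
      push_cast at h3
      rw [hc] at h2
      linarith
    have hrun : divCuts n a b r ∪ ⋃ j, P j = run n c x r := by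
      simp only [hempty, Set.iUnion_empty, Set.union_empty, divCuts, run, hxa, hc,
        divPoint_eq a b hr]
    refine ⟨?_, r, hr, hrun.ge, Or.inl ⟨rfl, hrun⟩⟩
    have h1 : divPoint a b (n r) 1 < divPoint a b (n r) (n r) := hs (by omega)
    rw [divPoint_self a b hr, divPoint_eq a b hr] at h1
    rw [hxa, hc]
    simpa using h1
  · obtain ⟨h1, r₀, h2, h3, h4⟩ := ih j hPj hgj
    have hr₀ : ∀ p ∈ run n c x r₀, divPoint a b (n r) j < p.1 ∧
      p.1 < divPoint a b (n r) (j + 1) := fun p hp => hi j p (h3 hp)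
    refine ⟨lt_of_lt_of_le h1 (hle _ (hdiv _ j.2)).2, r₀, h2,
      fun p hp => Or.inr (Set.mem_iUnion.2 ⟨j, h3 hp⟩), Or.inr ⟨hr, fun j' => P j' \ run n c x r₀,
        fun j' => ?_, ?_⟩⟩
    · by_cases hjj : j' = j
      · subst hjj
        exact h4
      · have : P j' \ run n c x r₀ = P j' := by
          refine sdiff_eq_left.2 (Set.disjoint_left.2 fun p hp hp' => hjj ?_)
          have h5 := hi j' p hp
          have h6 := hr₀ p hp'
          exact Fin.ext (eq_of_divPoint hab hr h5.1.le h5.2 h6.1.le h6.2)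
        dsimp only
        rw [this]
        exact hP j'
    · rw [Set.union_sdiff_distrib, Set.iUnion_sdiff]
      congr 1
      refine sdiff_eq_left.2 (Set.disjoint_left.2 fun p hp hp' => ?_)
      have h6 := hr₀ p hp'
      obtain ⟨⟨l, -, -, h⟩, -⟩ := hp
      rw [h, hs.lt_iff_lt, hs.lt_iff_lt] at h6
      omega

theorem IntervalSubdivision.reduce {a b : ℝ} {P : Set (ℝ × L)}
    (h : IntervalSubdivision n a b P) (hab : a < b) {c x : ℝ} (hne : P.Nonempty)
    (hg : IsFirstMinGap (endpoints a b P) c x) :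
    x + c < b ∧ ∃ r₀, 2 ≤ n r₀ ∧ run n c x r₀ ⊆ P ∧
      IntervalSubdivision n a b (P \ run n c x r₀) := by
  induction h with
  | trivial a b => simp at hne
  | cut a b r hr P hP ih =>
    obtain ⟨h1, r₀, h2, h3, h4⟩ := reduce_aux hab hr hP
      (fun j => ih j (divPoint_strictMono hab hr (Nat.lt_succ_self _))) hg
    refine ⟨h1, r₀, h2, h3, ?_⟩
    rcases h4 with ⟨-, h4⟩ | h4
    · rw [h4, Set.sdiff_self]
      exact .trivial a b
    · exact h4.isSubdivision

/-- Erasing an innermost cut either removes the first cut, when it is the only one, or leaves it in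
place. -/
theorem HasRoot.reduce {a b : ℝ} {P : Set (ℝ × L)} {r : L} (h : HasRoot n a b P r)
    (hab : a < b) {c x : ℝ} (hg : IsFirstMinGap (endpoints a b P) c x) :
    x + c < b ∧ ∃ r₀, 2 ≤ n r₀ ∧ run n c x r₀ ⊆ P ∧
      ((r = r₀ ∧ P = run n c x r₀) ∨ HasRoot n a b (P \ run n c x r₀) r) := by
  obtain ⟨hr, Q, hQ, rfl⟩ := h
  exact reduce_aux hab hr hQ (fun j =>
    (hQ j).reduce (divPoint_strictMono hab hr (Nat.lt_succ_self _))) hg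

theorem HasRoot.nonempty {a b : ℝ} {P : Set (ℝ × L)} {r : L} (h : HasRoot n a b P r) :
    P.Nonempty := by
  obtain ⟨hr, Q, hQ, rfl⟩ := h
  exact ⟨(_, r), Or.inl ⟨⟨1, le_rfl, by omega, rfl⟩, rfl⟩⟩

/-- The labelled cuts of an iterated subdivision of an interval determine the first cut. -/
theorem HasRoot.unique {a b : ℝ} (hab : a < b) {r r' : L} {P : Set (ℝ × L)}
    (h : HasRoot n a b P r) (h' : HasRoot n a b P r') : r = r' := by
  induction hN : P.ncard using Nat.strong_induction_on generalizing P with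
  | _ N IH =>
    have hfin := h.isSubdivision.finite
    have hNfin : (endpoints a b P).Finite := ((hfin.image _).insert _).insert _
    obtain ⟨c, x, hg⟩ := exists_isFirstMinGap hNfin (Or.inl rfl) (Or.inr (Or.inl rfl)) hab
    obtain ⟨-, r₀, h1, h2, h3⟩ := h.reduce hab hg
    obtain ⟨-, r₁, h1', h2', h3'⟩ := h'.reduce hab hg
    have hmem : ∀ r₀, 2 ≤ n r₀ → (x + c, r₀) ∈ run n c x r₀ :=
      fun r₀ h => ⟨⟨1, le_rfl, by omega, by simp⟩, rfl⟩
    obtain rfl : r₀ = r₁ := h.isSubdivision.label_unique hab _ _ _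
      (h2 (hmem _ h1)) (h2' (hmem _ h1'))
    -- Position and label of the erased run depend only on `P`, so both descriptions erase the same
    -- points. If nothing remains, neither can keep a first cut, which excludes the mixed cases.
    have hno : ∀ s, P = run n c x r₀ → ¬ HasRoot n a b (P \ run n c x r₀) s := by
      intro s hs hroot
      obtain ⟨p, hp⟩ := hroot.nonempty
      exact hp.2 (hs ▸ hp.1)
    rcases h3 with ⟨rfl, h3⟩ | h3
    · rcases h3' with ⟨rfl, -⟩ | h3'
      · rfl
      · exact absurd h3' (hno _ h3)
    · rcases h3' with ⟨rfl, h3'⟩ | h3'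
      · exact absurd h3 (hno _ h3')
      · refine IH _ ?_ h3 h3' rfl
        rw [← hN]
        exact Set.ncard_lt_ncard ⟨Set.sdiff_subset, fun hss =>
          (hss (h2 (hmem _ h1))).2 (hmem _ h1)⟩ hfin

end Intervals

/-! ### Boxes with rational vertices and their parts. -/

namespace Rect

variable {d : ℕ}

/-- All vertices of the box have rational coordinates. -/
def IsRational (R : Rect d) : Prop :=
  ∀ i, (∃ q : ℚ, R.lo i = q) ∧ ∃ q : ℚ, R.hi i = q

theorem cube_isRational : (cube d).IsRational :=
  fun _ => ⟨⟨0, by simp [cube]⟩, ⟨1, by simp [cube]⟩⟩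

theorem cutPoint_rational {R : Rect d} (hR : R.IsRational) (i : Fin d) (m l : ℕ) :
    ∃ q : ℚ, R.cutPoint i m l = q := by
  obtain ⟨⟨q, hq⟩, ⟨q', hq'⟩⟩ := hR i
  refine ⟨((m - l) * q + l * q') / m, ?_⟩
  simp only [cutPoint, hq, hq']
  push_cast
  rfl

theorem part_lo_self (R : Rect d) (i : Fin d) (m j : ℕ) :
    (R.part i m j).lo i = R.cutPoint i m j := by simp [part]

theorem part_hi_self (R : Rect d) (i : Fin d) (m j : ℕ) :
    (R.part i m j).hi i = R.cutPoint i m (j + 1) := by simp [part]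

theorem part_lo_of_ne (R : Rect d) {i i' : Fin d} (h : i' ≠ i) (m j : ℕ) :
    (R.part i m j).lo i' = R.lo i' := by simp [part, h]

theorem part_hi_of_ne (R : Rect d) {i i' : Fin d} (h : i' ≠ i) (m j : ℕ) :
    (R.part i m j).hi i' = R.hi i' := by simp [part, h]

theorem part_cutPoint_of_ne (R : Rect d) {i i' : Fin d} (h : i' ≠ i) (m j m' l : ℕ) :
    (R.part i m j).cutPoint i' m' l = R.cutPoint i' m' l := by
  simp only [cutPoint, part_lo_of_ne R h, part_hi_of_ne R h]

theorem part_part_comm (R : Rect d) {i i' : Fin d} (h : i ≠ i') (m j m' j' : ℕ) :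
    (R.part i m j).part i' m' j' = (R.part i' m' j').part i m j := by
  have e : ∀ (R : Rect d) i m j, R.part i m j = ⟨Function.update R.lo i (R.cutPoint i m j),
    Function.update R.hi i (R.cutPoint i m (j + 1))⟩ := fun _ _ _ _ => rfl
  rw [e (R.part i m j), e (R.part i' m' j')]
  simp only [part_cutPoint_of_ne R h, part_cutPoint_of_ne R h.symm]
  simp only [part, Function.update_comm h]

theorem IsRational.part {R : Rect d} (hR : R.IsRational) (i : Fin d) (m j : ℕ) :
    (R.part i m j).IsRational := by
  intro i'
  by_cases h : i' = i
  · subst h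
    rw [part_lo_self, part_hi_self]
    exact ⟨cutPoint_rational hR i' m j, cutPoint_rational hR i' m (j + 1)⟩
  · rw [part_lo_of_ne R h, part_hi_of_ne R h]
    exact hR i'

theorem mem_points_iff {R : Rect d} {x : Fin d → ℝ} :
    x ∈ R.points ↔ ∀ i, x i ∈ Set.Icc (R.lo i) (R.hi i) := by
  simp only [points, Set.mem_Icc, Pi.le_def, forall_and]

theorem Sub.points_subset {R S : Rect d} (h : S.Sub R) : S.points ⊆ R.points := by
  intro x hx
  rw [mem_points_iff] at hx ⊢
  exact fun i => ⟨(h i).1.trans (hx i).1, (hx i).2.trans (h i).2⟩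

theorem exists_mem_part_Icc {R : Rect d} (i : Fin d) {m : ℕ} (hm : 2 ≤ m)
    {y : ℝ} (hy : y ∈ Set.Icc (R.lo i) (R.hi i)) :
    ∃ j : Fin m, y ∈ Set.Icc (R.cutPoint i m j) (R.cutPoint i m (j + 1)) := by
  -- The right end of the side is not covered by the half-open parts of `exists_divPoint`; it is
  -- assigned to the last part, of index `m - 1`.
  rcases hy.2.eq_or_lt with h | h
  · refine ⟨⟨m - 1, by omega⟩, ?_, ?_⟩
    · have h2 : (0 : ℝ) < m := by positivity
      have h3 : R.cutPoint i m (m - 1 : ℕ) = R.hi i - (R.hi i - R.lo i) / m := by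
        unfold cutPoint
        rw [Nat.cast_sub (by omega)]
        field_simp
        push_cast
        ring
      rw [h3, h]
      have : 0 ≤ (R.hi i - R.lo i) / m := div_nonneg (by linarith [hy.1]) h2.le
      linarith
    · have : m - 1 + 1 = m := by omega
      simp only [this]
      rw [cutPoint_self R i hm, h]
  · obtain ⟨j, h1, h2⟩ := exists_divPoint hm hy.1 h
    exact ⟨j, h1, h2.le⟩

theorem exists_mem_part_Ioo {R : Rect d} (hR : R.IsRational) (i : Fin d) {m : ℕ} (hm : 2 ≤ m)
    {y : ℝ} (hy : y ∈ Set.Ioo (R.lo i) (R.hi i)) (hirr : Irrational y) :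
    ∃ j : Fin m, y ∈ Set.Ioo (R.cutPoint i m j) (R.cutPoint i m (j + 1)) := by
  obtain ⟨j, h1, h2⟩ := exists_divPoint hm hy.1.le hy.2
  refine ⟨j, lt_of_le_of_ne h1 (fun h => ?_), h2⟩
  obtain ⟨q, hq⟩ := cutPoint_rational hR i m j
  exact hirr ⟨q, hq.symm.trans h⟩

theorem mem_points_part_iff {R : Rect d} (hR : R.Nondeg) (i : Fin d) {m : ℕ} (hm : 2 ≤ m)
    (j : Fin m) {x : Fin d → ℝ} : x ∈ (R.part i m j).points ↔
      x ∈ R.points ∧ x i ∈ Set.Icc (R.cutPoint i m j) (R.cutPoint i m (j + 1)) := by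
  constructor
  · intro h
    refine ⟨(part_sub hR i hm j).points_subset h, ?_⟩
    have := mem_points_iff.1 h i
    rwa [part_lo_self, part_hi_self] at this
  · rintro ⟨h, h'⟩
    rw [mem_points_iff] at h ⊢
    intro i'
    by_cases hi : i' = i
    · subst hi
      rwa [part_lo_self, part_hi_self]
    · rw [part_lo_of_ne R hi, part_hi_of_ne R hi]
      exact h i'

end Rect

/-! ### Restriction of subdivisions to generic lines. -/

section Traces

variable {d : ℕ} {X : Fin d → SymColl.{u}} {G : ∀ i n, Set ((X i).obj (Fin n))}

theorem IsSubdivision.mem_cuts {R : Rect d} {D : Set (Rect d)} {E : Cuts X}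
    (h : IsSubdivision G R D E) (hR : R.Nondeg) :
    ∀ p ∈ E, p.1 ∈ R.points ∧ p.1 p.2.1 ∈ Set.Ioo (R.lo p.2.1) (R.hi p.2.1) := by
  induction h with
  | trivial R => simp
  | cut R i m hm g hg D E _ ih =>
    rintro p (⟨⟨l, h1, h2, h3, h4⟩, h5⟩ | hp)
    · refine ⟨h3, ?_⟩
      rw [h5]
      simp only
      rw [h4]
      constructor
      · conv_lhs => rw [← Rect.cutPoint_zero R i hm]
        exact Rect.cutPoint_lt hR i hm h1
      · conv_rhs => rw [← Rect.cutPoint_self R i hm]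
        exact Rect.cutPoint_lt hR i hm (by omega)
    · obtain ⟨j, hj⟩ := Set.mem_iUnion.1 hp
      obtain ⟨h1, h2⟩ := ih j (hR.part i hm j) p hj
      have h3 := Rect.part_sub hR i hm j
      exact ⟨h3.points_subset h1, (h3 _).1.trans_lt h2.1, h2.2.trans_le (h3 _).2⟩

/-- The cuts orthogonal to the `i`-th direction that are met by the line through `y` parallel to
the `i`-th axis. -/
def trace (E : Cuts X) (i : Fin d) (y : Fin d → ℝ) : Set (ℝ × Σ m, (X i).obj (Fin m)) :=
  {q | (Function.update y i q.1, (⟨i, q.2⟩ : Label X)) ∈ E}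

/-- The line through `y` parallel to the `i`-th axis meets the interior of the box `R`, and avoids
all hyperplanes orthogonal to the other axes and with rational coordinate. -/
def IsGeneric (R : Rect d) (i : Fin d) (y : Fin d → ℝ) : Prop :=
  ∀ j, j ≠ i → Irrational (y j) ∧ y j ∈ Set.Ioo (R.lo j) (R.hi j)

theorem exists_isGeneric {R : Rect d} (hR : R.Nondeg) (i : Fin d) : ∃ y, IsGeneric R i y := by
  choose y hy using fun j => exists_irrational_btwn (hR j)
  exact ⟨y, fun j _ => ⟨(hy j).1, (hy j).2⟩⟩

theorem IsGeneric.mono {R S : Rect d} {i : Fin d} {y : Fin d → ℝ} (h : IsGeneric S i y)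
    (hS : S.Sub R) : IsGeneric R i y :=
  fun j hj => ⟨(h j hj).1, (hS j).1.trans_lt (h j hj).2.1, (h j hj).2.2.trans_le (hS j).2⟩

theorem IsGeneric.part_self {R : Rect d} {i : Fin d} {y : Fin d → ℝ} (h : IsGeneric R i y)
    (m j : ℕ) : IsGeneric (R.part i m j) i y := by
  intro i' hi
  rw [Rect.part_lo_of_ne R hi, Rect.part_hi_of_ne R hi]
  exact h i' hi

theorem trace_union (E E' : Cuts X) (i : Fin d) (y : Fin d → ℝ) :
    trace (E ∪ E') i y = trace E i y ∪ trace E' i y := rfl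

theorem trace_iUnion {ι : Sort*} (E : ι → Cuts X) (i : Fin d) (y : Fin d → ℝ) :
    trace (⋃ j, E j) i y = ⋃ j, trace (E j) i y := by
  ext q
  simp only [trace, Set.mem_ofPred_eq, Set.mem_iUnion]
  exact Set.mem_iUnion

theorem trace_hyperplaneCuts_self {R : Rect d} (hR : R.Nondeg) {i : Fin d} {y : Fin d → ℝ}
    (h : IsGeneric R i y) {m : ℕ} (hm : 2 ≤ m) (g : (X i).obj (Fin m)) :
    trace (hyperplaneCuts R i m g) i y =
      divCuts (fun p : Σ m, (X i).obj (Fin m) => p.1) (R.lo i) (R.hi i) ⟨m, g⟩ := by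
  ext ⟨t, r⟩
  constructor
  · rintro ⟨⟨l, h1, h2, h3, h4⟩, h5⟩
    refine ⟨⟨l, h1, h2, ?_⟩, eq_of_heq (Sigma.mk.inj h5).2⟩
    simp only [Function.update_self] at h4
    exact h4
  · rintro ⟨⟨l, h1, h2, h3⟩, h4⟩
    simp only at h4
    subst h4
    simp only at h3 h2
    refine ⟨⟨l, h1, h2, ?_, ?_⟩, rfl⟩
    · rw [Rect.mem_points_iff]
      intro j
      by_cases hj : j = i
      · subst hj
        simp only [Function.update_self]
        change t = R.cutPoint j m l at h3
        rw [h3]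
        constructor
        · rw [← Rect.cutPoint_zero R j hm]
          exact Rect.cutPoint_le hR j hm (Nat.zero_le _)
        · conv_rhs => rw [← Rect.cutPoint_self R j hm]
          exact Rect.cutPoint_le hR j hm (by omega)
      · simp only [Function.update_of_ne hj]
        exact ⟨(h j hj).2.1.le, (h j hj).2.2.le⟩
    · simp only [Function.update_self]
      exact h3

theorem trace_hyperplaneCuts_of_ne (R : Rect d) {i i' : Fin d} (hi : i ≠ i') (y : Fin d → ℝ)
    (m : ℕ) (g : (X i').obj (Fin m)) : trace (hyperplaneCuts R i' m g) i y = ∅ := by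
  ext ⟨t, r⟩
  simp only [Set.mem_empty_iff_false, iff_false]
  rintro ⟨-, h⟩
  exact hi (Sigma.mk.inj h).1

/-- The line stays at a fixed coordinate in the direction `i'`, strictly inside the `j`-th part, so
it meets neither the cuts orthogonal to that direction nor any other part. -/
theorem trace_cut_of_ne {R : Rect d} (hR : R.Nondeg) {i i' : Fin d} (hi : i ≠ i') {y : Fin d → ℝ}
    {m : ℕ} (hm : 2 ≤ m) (g : (X i').obj (Fin m)) {D : Fin m → Set (Rect d)} {E : Fin m → Cuts X}
    (h : ∀ j : Fin m, IsSubdivision G (R.part i' m j) (D j) (E j)) (j : Fin m)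
    (hy : IsGeneric (R.part i' m j) i y) :
    trace (hyperplaneCuts R i' m g ∪ ⋃ j, E j) i y = trace (E j) i y := by
  rw [trace_union, trace_hyperplaneCuts_of_ne R hi, Set.empty_union, trace_iUnion]
  refine subset_antisymm (Set.iUnion_subset fun j' q hq => ?_) 
    (Set.subset_iUnion (fun j => trace (E j) i y) j)
  have h1 := ((h j').mem_cuts (hR.part i' hm j') _ hq).1
  rw [Rect.mem_points_part_iff hR i' hm] at h1
  have h2 := h1.2
  simp only [Function.update_of_ne hi.symm] at h2
  have h3 := (hy i' hi.symm).2
  rw [Rect.part_lo_self, Rect.part_hi_self] at h3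
  have hs : StrictMono (R.cutPoint i' m) := fun _ _ h => Rect.cutPoint_lt hR i' hm h
  have h4 := hs.lt_iff_lt.1 (h3.1.trans_le h2.2)
  have h5 := hs.lt_iff_lt.1 (h2.1.trans_lt h3.2)
  obtain rfl : j' = j := Fin.ext (by omega)
  exact hq

theorem IsGeneric.exists_part {R : Rect d} (hQ : R.IsRational)
    {i i' : Fin d} (hi : i ≠ i') {y : Fin d → ℝ} (h : IsGeneric R i y) {m : ℕ} (hm : 2 ≤ m) :
    ∃ j : Fin m, IsGeneric (R.part i' m j) i y := by
  obtain ⟨j, hj⟩ := Rect.exists_mem_part_Ioo hQ i' hm (h i' hi.symm).2 (h i' hi.symm).1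
  refine ⟨j, fun i'' hi'' => ⟨(h i'' hi'').1, ?_⟩⟩
  by_cases hii : i'' = i'
  · subst hii
    rwa [Rect.part_lo_self, Rect.part_hi_self]
  · rw [Rect.part_lo_of_ne R hii, Rect.part_hi_of_ne R hii]
    exact (h i'' hi'').2

/-- Cuts in the direction of the line become cuts of the interval; for a cut in another direction,
rationality of the division points and irrationality of the line put the line strictly inside one
part. -/
theorem IsSubdivision.trace {R : Rect d} {D : Set (Rect d)} {E : Cuts X}
    (h : IsSubdivision G R D E) (hR : R.Nondeg) (hQ : R.IsRational) {i : Fin d} {y : Fin d → ℝ}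
    (hy : IsGeneric R i y) :
    IntervalSubdivision (fun p : Σ m, (X i).obj (Fin m) => p.1) (R.lo i) (R.hi i)
      (trace E i y) := by
  induction h with
  | trivial R => exact .trivial _ _
  | cut R i' m hm g hg D E hE ih =>
    by_cases hi : i = i'
    · subst hi
      rw [trace_union, trace_hyperplaneCuts_self hR hy hm, trace_iUnion]
      refine .cut _ _ (⟨m, g⟩ : Σ m, (X i).obj (Fin m)) hm _ (fun j => ?_)
      have := ih j (hR.part i hm j) (hQ.part i m j) (hy.part_self m j)
      rwa [Rect.part_lo_self, Rect.part_hi_self] at this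
    · obtain ⟨j, hj⟩ := hy.exists_part hQ hi hm
      rw [trace_cut_of_ne hR hi hm g hE j hj]
      have := ih j (hR.part i' hm j) (hQ.part i' m j) hj
      rwa [Rect.part_lo_of_ne R hi, Rect.part_hi_of_ne R hi] at this

/-! ### The first cut -/

variable (G) in
/-- The subdivision `(D, E)` of `R` may be obtained by first cutting `R` in the direction `i` into
equal parts, labelled as prescribed by `p`. -/
def HasCut (R : Rect d) (D : Set (Rect d)) (E : Cuts X) (i : Fin d)
    (p : Σ m, (X i).obj (Fin m)) : Prop :=
  2 ≤ p.1 ∧ p.2 ∈ G i p.1 ∧ ∃ (D' : Fin p.1 → Set (Rect d)) (E' : Fin p.1 → Cuts X),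
    (∀ j : Fin p.1, IsSubdivision G (R.part i p.1 j) (D' j) (E' j)) ∧
      D = ⋃ j, D' j ∧ E = hyperplaneCuts R i p.1 p.2 ∪ ⋃ j, E' j

theorem HasCut.hasRoot {R : Rect d} {D : Set (Rect d)} {E : Cuts X} {i : Fin d}
    {p : Σ m, (X i).obj (Fin m)} (h : HasCut G R D E i p) (hR : R.Nondeg) (hQ : R.IsRational)
    {y : Fin d → ℝ} (hy : IsGeneric R i y) :
    HasRoot (fun p : Σ m, (X i).obj (Fin m) => p.1) (R.lo i) (R.hi i) (trace E i y) p := by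
  obtain ⟨h1, h2, D', E', h3, rfl, rfl⟩ := h
  refine ⟨h1, fun j => CutRes.trace (E' j) i y, fun j => ?_, ?_⟩
  · have := (h3 j).trace (hR.part i h1 j) (hQ.part i p.1 j) (hy.part_self p.1 j)
    rwa [Rect.part_lo_self, Rect.part_hi_self] at this
  · rw [trace_union, trace_hyperplaneCuts_self hR hy h1, trace_iUnion]

/-- A single generic line suffices, by `HasRoot.unique`. Only the cuts matter, so the sets of boxes
may be different. -/
theorem HasCut.unique {R : Rect d} {D D' : Set (Rect d)} {E : Cuts X} {i : Fin d}
    {p p' : Σ m, (X i).obj (Fin m)} (h : HasCut G R D E i p) (h' : HasCut G R D' E i p')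
    (hR : R.Nondeg) (hQ : R.IsRational) : p = p' := by
  obtain ⟨y, hy⟩ := exists_isGeneric hR i
  exact (h.hasRoot hR hQ hy).unique (hR i) (h'.hasRoot hR hQ hy)

/-- Hyperplane pieces of the parts fit together because a cut in another direction leaves the `i`-th
side unchanged. This makes cuts in different directions interchangeable. -/
theorem iUnion_hyperplaneCuts_part {R : Rect d} (hR : R.Nondeg) {i i' : Fin d} (hi : i ≠ i')
    {m' : ℕ} (hm' : 2 ≤ m') (m : ℕ) (g : (X i).obj (Fin m)) :
    ⋃ j : Fin m', hyperplaneCuts (R.part i' m' j) i m g = hyperplaneCuts R i m g := by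
  ext p
  simp only [Set.mem_iUnion]
  constructor
  · rintro ⟨j, ⟨l, h1, h2, h3, h4⟩, h5⟩
    rw [Rect.part_cutPoint_of_ne R hi] at h4
    exact ⟨⟨l, h1, h2, (Rect.part_sub hR i' hm' j).points_subset h3, h4⟩, h5⟩
  · rintro ⟨⟨l, h1, h2, h3, h4⟩, h5⟩
    obtain ⟨j, hj⟩ := Rect.exists_mem_part_Icc i' hm' (Rect.mem_points_iff.1 h3 i')
    refine ⟨j, ⟨l, h1, h2, (Rect.mem_points_part_iff hR i' hm' j).2 ⟨h3, hj⟩, ?_⟩, h5⟩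
    rwa [Rect.part_cutPoint_of_ne R hi]

/-- The interchange of cuts in different directions. -/
theorem HasCut.interchange {R : Rect d} (hR : R.Nondeg) {i i' : Fin d} (hi : i ≠ i')
    {m : ℕ} (hm : 2 ≤ m) {g : (X i').obj (Fin m)} (hg : g ∈ G i' m) {D : Fin m → Set (Rect d)}
    {E : Fin m → Cuts X} {p : Σ m, (X i).obj (Fin m)}
    (h : ∀ j : Fin m, HasCut G (R.part i' m j) (D j) (E j) i p) :
    HasCut G R (⋃ j, D j) (hyperplaneCuts R i' m g ∪ ⋃ j, E j) i p := by
  have hp := (h ⟨0, by omega⟩).1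
  refine ⟨hp, (h ⟨0, by omega⟩).2.1, ?_⟩
  choose D' E' h3 hD hE using fun j => (h j).2.2
  refine ⟨fun l => ⋃ j, D' j l, fun l => hyperplaneCuts (R.part i p.1 l) i' m g ∪ ⋃ j, E' j l,
    fun l => .cut _ i' m hm g hg _ _ (fun j => ?_), ?_, ?_⟩
  · rw [Rect.part_part_comm R hi]
    exact h3 j l
  · simp only [hD]
    exact Set.iUnion_comm _
  · simp only [hE, Set.iUnion_union_distrib, iUnion_hyperplaneCuts_part hR hi hm,
      iUnion_hyperplaneCuts_part hR hi.symm hp]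
    rw [Set.iUnion_comm, Set.union_left_comm]

/-- A subdivision may start by a given cut if it does so along all generic lines. -/
theorem IsSubdivision.hasCut {R : Rect d} {D : Set (Rect d)} {E : Cuts X}
    (h : IsSubdivision G R D E) (hR : R.Nondeg) (hQ : R.IsRational) {i : Fin d}
    {p : Σ m, (X i).obj (Fin m)}
    (hp : ∀ y, IsGeneric R i y →
      HasRoot (fun p : Σ m, (X i).obj (Fin m) => p.1) (R.lo i) (R.hi i) (CutRes.trace E i y) p) :
    HasCut G R D E i p := by
  induction h with
  | trivial R =>
    obtain ⟨y, hy⟩ := exists_isGeneric hR i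
    obtain ⟨q, hq⟩ := (hp y hy).nonempty
    exact absurd hq (Set.notMem_empty _)
  | cut R i' m hm g hg D E hE ih =>
    by_cases hi : i = i'
    · subst hi
      have h1 : HasCut G R (⋃ j, D j) (hyperplaneCuts R i m g ∪ ⋃ j, E j) i ⟨m, g⟩ :=
        ⟨hm, hg, D, E, hE, rfl, rfl⟩
      -- The cut by which the given construction starts is already in the direction `i`, and must be
      -- `p` by uniqueness of the first cut on one generic line.
      obtain ⟨y, hy⟩ := exists_isGeneric hR i
      rwa [← (h1.hasRoot hR hQ hy).unique (hR i) (hp y hy)]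
    -- For a first cut in another direction, lines generic for a part are generic for the whole box
    -- with the same trace; so all parts start with `p`, and the two cuts are interchanged.
    · refine HasCut.interchange hR hi hm hg (fun j => ?_)
      refine ih j (hR.part i' hm j) (hQ.part i' m j) (fun y hy => ?_)
      have := hp y (hy.mono (Rect.part_sub hR i' hm j))
      rwa [trace_cut_of_ne hR hi hm g hE j hy, ← Rect.part_lo_of_ne R hi m j,
        ← Rect.part_hi_of_ne R hi m j] at this

/-- If a subdivision may start by a cut in the direction `i`, then so may the subdivisions of its
parts with respect to a cut in a different direction. -/
theorem HasCut.part {R : Rect d} (hR : R.Nondeg) (hQ : R.IsRational) {i i' : Fin d} (hi : i ≠ i')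
    {m : ℕ} (hm : 2 ≤ m) {g : (X i').obj (Fin m)} {D₀ : Set (Rect d)} {D : Fin m → Set (Rect d)}
    {E : Fin m → Cuts X} (hE : ∀ j : Fin m, IsSubdivision G (R.part i' m j) (D j) (E j))
    {p : Σ m, (X i).obj (Fin m)}
    (h : HasCut G R D₀ (hyperplaneCuts R i' m g ∪ ⋃ j, E j) i p) (j : Fin m) :
    HasCut G (R.part i' m j) (D j) (E j) i p := by
  refine (hE j).hasCut (hR.part i' hm j) (hQ.part i' m j) (fun y hy => ?_)
  have := h.hasRoot hR hQ (hy.mono (Rect.part_sub hR i' hm j))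
  rwa [trace_cut_of_ne hR hi hm g hE j hy, ← Rect.part_lo_of_ne R hi m j,
    ← Rect.part_hi_of_ne R hi m j] at this

/-! ### Cuts are determined by their generic points -/

theorem isClosed_points (R : Rect d) : IsClosed R.points := isClosed_Icc

theorem IsSubdivision.isClosed {R : Rect d} {D : Set (Rect d)} {E : Cuts X}
    (h : IsSubdivision G R D E) (lab : Label X) : IsClosed {x | (x, lab) ∈ E} := by
  induction h with
  | trivial R => simp
  | cut R i m hm g hg D E _ ih =>
    have h1 : {x | (x, lab) ∈ hyperplaneCuts R i m g ∪ ⋃ j, E j} =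
        {x | (x, lab) ∈ hyperplaneCuts R i m g} ∪ ⋃ j, {x | (x, lab) ∈ E j} := by
      ext x
      simp
    rw [h1]
    refine IsClosed.union ?_ (isClosed_iUnion_of_finite ih)
    by_cases hl : lab = ⟨i, m, g⟩
    · have h2 : {x | (x, lab) ∈ hyperplaneCuts R i m g} =
          ⋃ l ∈ Set.Icc 1 (m - 1), R.points ∩ {x | x i = R.cutPoint i m l} := by
        ext x
        simp only [hyperplaneCuts, Set.mem_ofPred_eq, hl, Set.mem_iUnion, Set.mem_Icc,
          Set.mem_inter_iff, exists_prop, _root_.and_assoc]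
        exact and_iff_left rfl
      rw [h2]
      exact (Set.finite_Icc 1 (m - 1)).isClosed_biUnion (fun l _ => (isClosed_points R).inter
        (isClosed_eq (continuous_apply i) continuous_const))
    · have h2 : {x | (x, lab) ∈ hyperplaneCuts R i m g} = ∅ := by
        ext x
        simp [hyperplaneCuts, hl]
      rw [h2]
      exact isClosed_empty

/-- A hyperplane piece is a product of a point and closed intervals, and irrational points are dense
in each of these intervals. -/
theorem IsSubdivision.mem_closure {R : Rect d} {D : Set (Rect d)} {E : Cuts X}
    (h : IsSubdivision G R D E) (hR : R.Nondeg) {x : Fin d → ℝ} {lab : Label X}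
    (hx : (x, lab) ∈ E) :
    x ∈ closure {x' | (x', lab) ∈ E ∧ ∀ j, j ≠ lab.1 → Irrational (x' j)} := by
  induction h with
  | trivial R => exact absurd hx (Set.notMem_empty _)
  | cut R i m hm g hg D E _ ih =>
    rcases hx with ⟨⟨l, h1, h2, h3, h4⟩, h5⟩ | hx
    · simp only at h3 h4 h5
      subst h5
      have hcl : x ∈ closure (Set.pi Set.univ (fun j => if j = i then {R.cutPoint i m l} else
          Set.Ioo (R.lo j) (R.hi j) ∩ {t | Irrational t})) := by
        rw [closure_pi_set]
        intro j _
        by_cases hj : j = i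
        · subst hj
          simp [h4]
        · simp only [if_neg hj]
          -- Nondegeneracy enters here: the closure of an open side is the whole closed side.
          have h6 := closure_mono (dense_irrational.open_subset_closure_inter
            (isOpen_Ioo (a := R.lo j) (b := R.hi j)))
          rw [closure_closure, closure_Ioo (hR j).ne] at h6
          exact h6 (Rect.mem_points_iff.1 h3 j)
      refine closure_mono (fun x' hx' => ?_) hcl
      have hx'' : ∀ j, x' j ∈ (if j = i then {R.cutPoint i m l} else
          Set.Ioo (R.lo j) (R.hi j) ∩ {t | Irrational t} : Set ℝ) := fun j => hx' j (Set.mem_univ j)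
      have hi : x' i = R.cutPoint i m l := by simpa using hx'' i
      have hne : ∀ j, j ≠ i → x' j ∈ Set.Ioo (R.lo j) (R.hi j) ∩ {t | Irrational t} :=
        fun j hj => by simpa only [if_neg hj] using hx'' j
      refine ⟨Or.inl ⟨⟨l, h1, h2, Rect.mem_points_iff.2 fun j => ?_, hi⟩, rfl⟩,
        fun j hj => (hne j hj).2⟩
      by_cases hj : j = i
      · subst hj
        simp only [hi]
        rw [← h4]
        exact Rect.mem_points_iff.1 h3 j
      · exact ⟨(hne j hj).1.1.le, (hne j hj).1.2.le⟩
    · obtain ⟨j, hj⟩ := Set.mem_iUnion.1 hx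
      refine closure_mono (fun x' hx' => ?_) (ih j (hR.part i hm j) hj)
      exact ⟨Or.inr (Set.mem_iUnion.2 ⟨j, hx'.1⟩), hx'.2⟩

/-- By density and closedness, inclusions of cuts need only be tested at generic points, where
interference from the boundaries of neighbouring boxes is excluded. -/
theorem IsSubdivision.cuts_subset {R R' : Rect d} {D D' : Set (Rect d)} {E E' : Cuts X}
    (h : IsSubdivision G R D E) (hR : R.Nondeg) (h' : IsSubdivision G R' D' E')
    (hEE : ∀ p ∈ E, (∀ j, j ≠ p.2.1 → Irrational (p.1 j)) → p ∈ E') : E ⊆ E' := by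
  rintro ⟨x, lab⟩ hx
  have := closure_mono (fun x' hx' => hEE (x', lab) hx'.1 hx'.2) (h.mem_closure hR hx)
  exact (h'.isClosed lab).closure_subset this

end Traces

/-! ### Grids of simultaneous cuts in several directions. -/

section Grid

variable {d : ℕ}

/-- Also needed for `m = 1`, because a direction in which the grid makes no cut counts as having one
part. -/
theorem Rect.cutPoint_strictMono {R : Rect d} (hR : R.Nondeg) (i : Fin d) {m : ℕ} (hm : 1 ≤ m) :
    StrictMono (R.cutPoint i m) := by
  intro l l' h
  have h1 := hR i
  have h2 : (0 : ℝ) < m := by exact_mod_cast hm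
  have h3 : (l : ℝ) < l' := by exact_mod_cast h
  unfold Rect.cutPoint
  rw [div_lt_div_iff_of_pos_right h2]
  nlinarith

/-- The box with index `v` of the grid obtained by dividing the `i`-th side of `R` into `n i`
equal parts, for all `i`. -/
noncomputable def Rect.gridBox (R : Rect d) (n v : Fin d → ℕ) : Rect d :=
  ⟨fun i => R.cutPoint i (n i) (v i), fun i => R.cutPoint i (n i) (v i + 1)⟩

theorem Rect.gridBox_nondeg {R : Rect d} (hR : R.Nondeg) {n v : Fin d → ℕ} (hv : ∀ i, v i < n i) :
    (R.gridBox n v).Nondeg :=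
  fun i => cutPoint_strictMono hR i (Nat.one_le_of_lt (hv i)) (Nat.lt_succ_self _)

/-- In every coordinate two distinct grid intervals have disjoint interiors, while the box `B` has
an interior. -/
theorem Rect.eq_of_sub_gridBox {R : Rect d} (hR : R.Nondeg) {n v v' : Fin d → ℕ}
    (hv : ∀ i, v i < n i) {B : Rect d} (hB : B.Nondeg) (h : B.Sub (R.gridBox n v))
    (h' : B.Sub (R.gridBox n v')) : v = v' := by
  funext i
  have hs := cutPoint_strictMono hR i (Nat.one_le_of_lt (hv i))
  have h1 := hs.lt_iff_lt.1 ((h i).1.trans_lt ((hB i).trans_le (h' i).2))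
  have h2 := hs.lt_iff_lt.1 ((h' i).1.trans_lt ((hB i).trans_le (h i).2))
  omega

theorem Rect.gridBox_one (R : Rect d) {n v : Fin d → ℕ} (hn : ∀ i, n i = 1) (hv : ∀ i, v i = 0) :
    R.gridBox n v = R := by
  ext i <;> simp [gridBox, cutPoint, hn, hv]

/-- Cutting a hitherto uncut direction `i`, with one part of index `0`, refines the grid. This is
the geometric input for inductions that add directions one at a time. -/
theorem Rect.gridBox_part (R : Rect d) (n v : Fin d → ℕ) (i : Fin d) (j : ℕ)
    (hn : n i = 1) (hv : v i = 0) (m : ℕ) :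
    (R.part i m j).gridBox n v =
      R.gridBox (Function.update n i m) (Function.update v i j) := by
  ext i'
  · by_cases h : i' = i
    · subst h
      simp only [gridBox, Function.update_self, hn, hv]
      simp [cutPoint, part]
    · simp only [gridBox, Function.update_of_ne h, part_cutPoint_of_ne R h]
  · by_cases h : i' = i
    · subst h
      simp only [gridBox, Function.update_self, hn, hv]
      simp [cutPoint, part]
    · simp only [gridBox, Function.update_of_ne h, part_cutPoint_of_ne R h]

variable {X : Fin d → SymColl.{u}}

/-- The number of parts prescribed by an optional cut. -/
def numParts {i : Fin d} (o : Option (Σ m, (X i).obj (Fin m))) : ℕ := o.elim 1 (fun p => p.1)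

/-- The labelled cuts prescribed by an optional cut. -/
def optCuts (R : Rect d) (i : Fin d) (o : Option (Σ m, (X i).obj (Fin m))) : Cuts X :=
  {q | ∃ p, o = some p ∧ q ∈ hyperplaneCuts R i p.1 p.2}

variable (G : ∀ i n, Set ((X i).obj (Fin n))) (r : ∀ i, Option (Σ m, (X i).obj (Fin m)))

/-- `v` is an index of a box of the grid defined by `r`. -/
def IsGridIndex (v : Fin d → ℕ) : Prop := ∀ i, v i < numParts (r i)

/-- `r` prescribes cuts labelled by elements of `G`. -/
def IsGridLabel : Prop := ∀ i p, r i = some p → 2 ≤ p.1 ∧ p.2 ∈ G i p.1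

/-- A family of subdivisions of the boxes of a grid. -/
def IsGridSubdivision (R : Rect d) (D : (Fin d → ℕ) → Set (Rect d)) (E : (Fin d → ℕ) → Cuts X) :
    Prop :=
  ∀ v, IsGridIndex r v → IsSubdivision G (R.gridBox (fun i => numParts (r i)) v) (D v) (E v)

/-- The boxes of a family of subdivisions of the boxes of a grid. -/
def gridParts (D : (Fin d → ℕ) → Set (Rect d)) : Set (Rect d) := ⋃ v ∈ {v | IsGridIndex r v}, D v

/-- The cuts of a family of subdivisions of the boxes of a grid, together with the cuts of the
grid. -/
def gridCuts (R : Rect d) (E : (Fin d → ℕ) → Cuts X) : Cuts X :=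
  (⋃ i, optCuts R i (r i)) ∪ ⋃ v ∈ {v | IsGridIndex r v}, E v

variable {G r}

theorem IsGridLabel.update_none (h : IsGridLabel G r) (i : Fin d) :
    IsGridLabel G (Function.update r i none) := by
  intro i' p hp
  by_cases hi : i' = i
  · subst hi
    simp at hp
  · rw [Function.update_of_ne hi] at hp
    exact h i' p hp

theorem numParts_eq_update {i : Fin d} {p : Σ m, (X i).obj (Fin m)} (hr : r i = some p) :
    (fun i => numParts (r i)) =
      Function.update (fun i' => numParts (Function.update r i none i')) i p.1 := by
  funext i'
  by_cases hi : i' = i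
  · subst hi
    simp [hr, numParts]
  · simp [hi]

theorem isGridIndex_update {i : Fin d} {p : Σ m, (X i).obj (Fin m)} (hr : r i = some p)
    {v : Fin d → ℕ} (hv : IsGridIndex (Function.update r i none) v) (j : Fin p.1) :
    IsGridIndex r (Function.update v i j) := by
  intro i'
  by_cases hi : i' = i
  · subst hi
    simp [hr, numParts]
  · have := hv i'
    rw [Function.update_of_ne hi] at this ⊢
    exact this

theorem IsGridIndex.eq_zero {i : Fin d} {v : Fin d → ℕ}
    (hv : IsGridIndex (Function.update r i none) v) : v i = 0 := by
  have := hv i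
  rw [Function.update_self] at this
  exact Nat.lt_one_iff.1 this

theorem IsGridIndex.lt {i : Fin d} {p : Σ m, (X i).obj (Fin m)} (hr : r i = some p)
    {v : Fin d → ℕ} (hv : IsGridIndex r v) : v i < p.1 := by
  have := hv i
  rw [hr] at this
  exact this

theorem IsGridIndex.update_zero {i : Fin d} {v : Fin d → ℕ} (hv : IsGridIndex r v) :
    IsGridIndex (Function.update r i none) (Function.update v i 0) := by
  intro i'
  by_cases hi : i' = i
  · subst hi
    simp [numParts]
  · rw [Function.update_of_ne hi, Function.update_of_ne hi]
    exact hv i'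

theorem iUnion_gridIndex {α : Type*} {i : Fin d} {p : Σ m, (X i).obj (Fin m)} (hr : r i = some p)
    (D : (Fin d → ℕ) → Set α) :
    ⋃ v ∈ {v | IsGridIndex r v}, D v = ⋃ j : Fin p.1,
      ⋃ v ∈ {v | IsGridIndex (Function.update r i none) v}, D (Function.update v i j) := by
  ext x
  simp only [Set.mem_iUnion, Set.mem_ofPred_eq, exists_prop]
  constructor
  · rintro ⟨v, hv, hx⟩
    refine ⟨⟨v i, hv.lt hr⟩, Function.update v i 0, hv.update_zero, ?_⟩
    simpa using hx
  · rintro ⟨j, v, hv, hx⟩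
    exact ⟨_, isGridIndex_update hr hv j, hx⟩

theorem gridParts_eq {i : Fin d} {p : Σ m, (X i).obj (Fin m)} (hr : r i = some p)
    (D : (Fin d → ℕ) → Set (Rect d)) :
    gridParts r D = ⋃ j : Fin p.1,
      gridParts (Function.update r i none) (fun v => D (Function.update v i j)) :=
  iUnion_gridIndex hr D

/-- Splits off the cut in one direction: the grid cuts in the remaining directions are the unions of
their restrictions to the parts. -/
theorem gridCuts_eq {R : Rect d} (hR : R.Nondeg) {i : Fin d} {p : Σ m, (X i).obj (Fin m)}
    (hr : r i = some p) (hp : 2 ≤ p.1) (E : (Fin d → ℕ) → Cuts X) :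
    gridCuts r R E = hyperplaneCuts R i p.1 p.2 ∪ ⋃ j : Fin p.1,
      gridCuts (Function.update r i none) (R.part i p.1 j)
        (fun v => E (Function.update v i j)) := by
  simp only [gridCuts, Set.iUnion_union_distrib]
  rw [← iUnion_gridIndex hr, ← Set.union_assoc]
  congr 1
  ext q
  simp only [Set.mem_union, Set.mem_iUnion]
  constructor
  · rintro ⟨i', hi'⟩
    by_cases h : i' = i
    · subst h
      obtain ⟨p', h1, h2⟩ := hi'
      rw [hr, Option.some_inj] at h1
      subst h1
      exact Or.inl h2
    · obtain ⟨p', h1, h2⟩ := hi'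
      rw [← iUnion_hyperplaneCuts_part hR h hp] at h2
      obtain ⟨j, hj⟩ := Set.mem_iUnion.1 h2
      refine Or.inr ⟨j, i', p', ?_, hj⟩
      rwa [Function.update_of_ne h]
  · rintro (h | ⟨j, i', p', h1, h2⟩)
    · exact ⟨i, p, hr, h⟩
    · by_cases h : i' = i
      · subst h
        simp at h1
      · rw [Function.update_of_ne h] at h1
        refine ⟨i', p', h1, ?_⟩
        rw [← iUnion_hyperplaneCuts_part hR h hp]
        exact Set.mem_iUnion.2 ⟨j, h2⟩

theorem gridBox_part_update {i : Fin d} {p : Σ m, (X i).obj (Fin m)} (hr : r i = some p)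
    (R : Rect d) {v : Fin d → ℕ} (hv : v i = 0) (j : ℕ) :
    (R.part i p.1 j).gridBox (fun i' => numParts (Function.update r i none i')) v =
      R.gridBox (fun i => numParts (r i)) (Function.update v i j) := by
  rw [Rect.gridBox_part _ _ _ _ _ (by simp [numParts]) hv, ← numParts_eq_update hr]

theorem IsGridSubdivision.part {R : Rect d} {D : (Fin d → ℕ) → Set (Rect d)}
    {E : (Fin d → ℕ) → Cuts X} (h : IsGridSubdivision G r R D E) {i : Fin d}
    {p : Σ m, (X i).obj (Fin m)} (hr : r i = some p) (j : Fin p.1) :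
    IsGridSubdivision G (Function.update r i none) (R.part i p.1 j)
      (fun v => D (Function.update v i j)) (fun v => E (Function.update v i j)) := by
  intro v hv
  rw [gridBox_part_update hr R hv.eq_zero]
  exact h _ (isGridIndex_update hr hv j)

theorem isGridIndex_none (hr : ∀ i, r i = none) {v : Fin d → ℕ} :
    IsGridIndex r v ↔ v = 0 := by
  simp [IsGridIndex, hr, numParts, funext_iff]

theorem IsGridSubdivision.isSubdivision {R : Rect d} (hR : R.Nondeg)
    {D : (Fin d → ℕ) → Set (Rect d)} {E : (Fin d → ℕ) → Cuts X} (hl : IsGridLabel G r)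
    (h : IsGridSubdivision G r R D E) : IsSubdivision G R (gridParts r D) (gridCuts r R E) := by
  -- The induction is on a finite set `I` of directions outside which `r` prescribes no cut; at each
  -- step one cut is moved to the beginning.
  obtain ⟨I, hI⟩ : ∃ I : Finset (Fin d), ∀ i, i ∉ I → r i = none :=
    ⟨Finset.univ, fun i hi => absurd (Finset.mem_univ i) hi⟩
  induction I using Finset.induction generalizing r R D E with
  | empty =>
    have hr : ∀ i, r i = none := fun i => hI i (Finset.notMem_empty i)
    have h0 : {v | IsGridIndex r v} = {0} := Set.ext fun v => isGridIndex_none hr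
    have h1 := h 0 ((isGridIndex_none hr).2 rfl)
    rw [Rect.gridBox_one _ (by simp [hr, numParts]) (by simp)] at h1
    simpa [gridParts, gridCuts, h0, hr, optCuts] using h1
  | insert i I hi ih =>
    cases hr : r i with
    | none => exact ih hR hl h (fun i' hi' => by
        by_cases hii : i' = i
        · rw [hii, hr]
        · exact hI i' (by simp [hii, hi']))
    | some p =>
      obtain ⟨h1, h2⟩ := hl i p hr
      rw [gridParts_eq hr, gridCuts_eq hR hr h1]
      refine .cut R i p.1 h1 p.2 h2 _ _ (fun j => ih (hR.part i h1 j) (hl.update_none i)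
        (h.part hr j) (fun i' hi' => ?_))
      by_cases hii : i' = i
      · subst hii
        simp
      · rw [Function.update_of_ne hii]
        exact hI i' (by simp [hii, hi'])

theorem IsGridSubdivision.hasCut {R : Rect d} (hR : R.Nondeg)
    {D : (Fin d → ℕ) → Set (Rect d)} {E : (Fin d → ℕ) → Cuts X} (hl : IsGridLabel G r)
    (h : IsGridSubdivision G r R D E) {i : Fin d} {p : Σ m, (X i).obj (Fin m)}
    (hr : r i = some p) : HasCut G R (gridParts r D) (gridCuts r R E) i p := by
  obtain ⟨h1, h2⟩ := hl i p hr
  exact ⟨h1, h2, _, _, fun j => (h.part hr j).isSubdivision (hR.part i h1 j) (hl.update_none i),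
    gridParts_eq hr D, gridCuts_eq hR hr h1 E⟩

/-- A subdivision that may start by cuts in several directions refines the corresponding grid. -/
theorem IsSubdivision.exists_grid {R : Rect d} (hR : R.Nondeg) (hQ : R.IsRational)
    {D : Set (Rect d)} {E : Cuts X} (h : IsSubdivision G R D E)
    (hc : ∀ i p, r i = some p → HasCut G R D E i p) :
    ∃ D' E', IsGridSubdivision G r R D' E' ∧ D = gridParts r D' ∧ E = gridCuts r R E' := by
  obtain ⟨I, hI⟩ : ∃ I : Finset (Fin d), ∀ i, i ∉ I → r i = none :=
    ⟨Finset.univ, fun i hi => absurd (Finset.mem_univ i) hi⟩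
  induction I using Finset.induction generalizing r R D E with
  | empty =>
    have hr : ∀ i, r i = none := fun i => hI i (Finset.notMem_empty i)
    have h0 : {v | IsGridIndex r v} = {0} := Set.ext fun v => isGridIndex_none hr
    refine ⟨fun _ => D, fun _ => E, fun v hv => ?_, ?_, ?_⟩
    · rw [Rect.gridBox_one _ (by simp [hr, numParts])
        (fun i => congrFun ((isGridIndex_none hr).1 hv) i)]
      exact h
    · simp [gridParts, h0]
    · simp [gridCuts, h0, hr, optCuts]
  | insert i I hi ih =>
    cases hr : r i with
    | none => exact ih hR hQ h hc (fun i' hi' => by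
        by_cases hii : i' = i
        · rw [hii, hr]
        · exact hI i' (by simp [hii, hi']))
    | some p =>
      obtain ⟨h1, h2, D₁, E₁, h3, hD₁, hE₁⟩ := hc i p hr
      -- After the cut in the direction `i`, first cuts in the other directions are inherited by
      -- every part through `HasCut.part`, so the induction hypothesis applies to each part.
      have key : ∀ j : Fin p.1, ∃ D' E', IsGridSubdivision G (Function.update r i none)
          (R.part i p.1 j) D' E' ∧ D₁ j = gridParts (Function.update r i none) D' ∧
          E₁ j = gridCuts (Function.update r i none) (R.part i p.1 j) E' := by
        intro j
        refine ih (hR.part i h1 j) (hQ.part i p.1 j) (h3 j) (fun i' p' hp' => ?_)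
          (fun i' hi' => ?_)
        · by_cases hii : i' = i
          · subst hii
            simp at hp'
          · rw [Function.update_of_ne hii] at hp'
            have := hc i' p' hp'
            rw [hE₁] at this
            exact HasCut.part hR hQ hii h1 h3 this j
        · by_cases hii : i' = i
          · subst hii
            simp
          · rw [Function.update_of_ne hii]
            exact hI i' (by simp [hii, hi'])
      choose D' E' hG hD hE using key
      -- The grids of the parts are glued: the `i`-th coordinate of an index selects the part, and
      -- the empty set outside the range is irrelevant.
      let D'' : (Fin d → ℕ) → Set (Rect d) := fun v =>
        if hv : v i < p.1 then D' ⟨v i, hv⟩ (Function.update v i 0) else ∅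
      let E'' : (Fin d → ℕ) → Cuts X := fun v =>
        if hv : v i < p.1 then E' ⟨v i, hv⟩ (Function.update v i 0) else ∅
      have hup : ∀ v, IsGridIndex (Function.update r i none) v → Function.update v i 0 = v :=
        fun v hv => by
          conv_rhs => rw [← Function.update_eq_self i v, hv.eq_zero]
      have hD'' : ∀ (j : Fin p.1) v, IsGridIndex (Function.update r i none) v →
          D'' (Function.update v i j) = D' j v := by
        intro j v hv
        simp [D'', hup v hv]
      have hE'' : ∀ (j : Fin p.1) v, IsGridIndex (Function.update r i none) v →
          E'' (Function.update v i j) = E' j v := by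
        intro j v hv
        simp [E'', hup v hv]
      refine ⟨D'', E'', fun v hv => ?_, ?_, ?_⟩
      · have h4 := hG ⟨v i, hv.lt hr⟩ (Function.update v i 0) hv.update_zero
        rw [gridBox_part_update hr R (by simp)] at h4
        simp only [Function.update_idem, Function.update_eq_self] at h4
        simpa only [D'', E'', dif_pos (hv.lt hr)] using h4
      · rw [hD₁, gridParts_eq hr]
        refine Set.iUnion_congr fun j => (hD j).trans ?_
        exact (Set.iUnion₂_congr fun v hv => hD'' j v hv).symm
      · rw [hE₁, gridCuts_eq hR hr h1]
        congr 1
        refine Set.iUnion_congr fun j => (hE j).trans ?_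
        exact congrArg (fun T =>
          (⋃ i', optCuts (R.part i p.1 j) i' (Function.update r i none i')) ∪ T)
          (Set.iUnion₂_congr fun v hv => hE'' j v hv).symm

/-- Only points whose coordinates other than that of the cut direction are irrational need be
considered. They lie strictly inside the box `v`, hence on no grid cut and in no other box, so they
must come from `E' v`. -/
theorem gridCuts_cuts_subset {R : Rect d} (hR : R.Nondeg) (hQ : R.IsRational)
    {D D' : (Fin d → ℕ) → Set (Rect d)} {E E' : (Fin d → ℕ) → Cuts X}
    (h : IsGridSubdivision G r R D E) (h' : IsGridSubdivision G r R D' E')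
    (hE : gridCuts r R E ⊆ gridCuts r R E') {v : Fin d → ℕ} (hv : IsGridIndex r v) :
    E v ⊆ E' v := by
  have hn := fun i => Rect.cutPoint_strictMono hR i (Nat.one_le_of_lt (hv i))
  refine (h v hv).cuts_subset (Rect.gridBox_nondeg hR hv) (h' v hv) (fun p hp hirr => ?_)
  obtain ⟨hp1, hp2⟩ := (h v hv).mem_cuts (Rect.gridBox_nondeg hR hv) p hp
  simp only [Rect.gridBox] at hp2
  rcases hE (Or.inr (Set.mem_iUnion₂.2 ⟨v, hv, hp⟩)) with h1 | h1
  · obtain ⟨i, p', h2, ⟨l, -, -, -, h3⟩, h4⟩ := Set.mem_iUnion.1 h1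
    -- The coordinate in the direction `i` would be a division point lying strictly between two
    -- consecutive ones.
    exfalso
    have h5 : p.2.1 = i := by rw [h4]
    rw [h5, h3] at hp2
    have h6 : numParts (r i) = p'.1 := by rw [h2]; rfl
    rw [← h6] at hp2
    have h7 := (hn i).lt_iff_lt.1 hp2.1
    have h8 := (hn i).lt_iff_lt.1 hp2.2
    omega
  · obtain ⟨v', hv', hp'⟩ := Set.mem_iUnion₂.1 h1
    obtain ⟨h1, h2⟩ := (h' v' hv').mem_cuts (Rect.gridBox_nondeg hR hv') p hp'
    have : v = v' := by
      funext j
      have h3 : R.cutPoint j (numParts (r j)) (v j) < R.cutPoint j (numParts (r j)) (v' j + 1) ∧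
          R.cutPoint j (numParts (r j)) (v' j) < R.cutPoint j (numParts (r j)) (v j + 1) := by
        -- In the cut direction both boxes contain the point strictly inside by `mem_cuts`; in the
        -- other directions equality with a rational division point is impossible.
        by_cases hj : j = p.2.1
        · subst hj
          exact ⟨hp2.1.trans h2.2, h2.1.trans hp2.2⟩
        · have h4 := Rect.mem_points_iff.1 hp1 j
          have h5 := Rect.mem_points_iff.1 h1 j
          have hne : ∀ l, R.cutPoint j (numParts (r j)) l ≠ p.1 j := by
            intro l hl
            obtain ⟨q, hq⟩ := Rect.cutPoint_rational hQ j (numParts (r j)) l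
            exact hirr j hj ⟨q, hq.symm.trans hl⟩
          exact ⟨(lt_of_le_of_ne h4.1 (hne _)).trans_le h5.2,
            (lt_of_le_of_ne h5.1 (hne _)).trans_le h4.2⟩
      rw [(hn j).lt_iff_lt, (hn j).lt_iff_lt] at h3
      omega
    rwa [this]

theorem gridCuts_injective {R : Rect d} (hR : R.Nondeg) (hQ : R.IsRational)
    {D D' : (Fin d → ℕ) → Set (Rect d)} {E E' : (Fin d → ℕ) → Cuts X}
    (h : IsGridSubdivision G r R D E) (h' : IsGridSubdivision G r R D' E')
    (hE : gridCuts r R E = gridCuts r R E') {v : Fin d → ℕ} (hv : IsGridIndex r v) :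
    E v = E' v :=
  (gridCuts_cuts_subset hR hQ h h' hE.le hv).antisymm
    (gridCuts_cuts_subset hR hQ h' h hE.ge hv)

end Grid

/-! ### Generators of the free modules as labelled grids. -/

section Generators

variable {d : ℕ} (X : Fin d → SymColl.{u}) (G : ∀ i n, Set ((X i).obj (Fin n)))

/-- The collections `X i` are free with free generators `G i`, and vanish in arities `0`, `1`. -/
structure IsFreelyGenerated : Prop where
  free : ∀ i, (X i).IsFree
  empty_zero : ∀ i, IsEmpty ((X i).obj (Fin 0))
  empty_one : ∀ i, IsEmpty ((X i).obj (Fin 1))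
  generating : ∀ i, (X i).IsGenerating (G i)

variable {X G}

theorem IsFreelyGenerated.two_le (H : IsFreelyGenerated X G) {i : Fin d}
    (p : Σ m, (X i).obj (Fin m)) : 2 ≤ p.1 := by
  obtain ⟨m, g⟩ := p
  match m, g with
  | 0, g => exact ((H.empty_zero i).false g).elim
  | 1, g => exact ((H.empty_one i).false g).elim
  | m + 2, _ => exact Nat.le_add_left 2 m

theorem IsFreelyGenerated.exists_generator (H : IsFreelyGenerated X G) {i : Fin d} {A : Type}
    [Finite A] (y : (X i).obj A) :
    ∃ p : Σ m, (X i).obj (Fin m), p.2 ∈ G i p.1 ∧ ∃ e : A ≃ Fin p.1, (X i).map e p.2 = y := by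
  have e₀ : A ≃ Fin (Nat.card A) := Finite.equivFin A
  obtain ⟨g, ⟨hg, σ, h⟩, -⟩ := H.generating i (Nat.card A) ((X i).map e₀.symm y)
  refine ⟨⟨_, g⟩, hg, e₀.trans σ, ?_⟩
  rw [(X i).map_trans, h, ← (X i).map_trans, Equiv.self_trans_symm, (X i).map_refl]

/-- The generator is unique because it represents an orbit; the numbering is unique because the
action is free. -/
theorem IsFreelyGenerated.generator_unique (H : IsFreelyGenerated X G) {i : Fin d} {A : Type}
    [Finite A] {p p' : Σ m, (X i).obj (Fin m)} (hp : p.2 ∈ G i p.1) (hp' : p'.2 ∈ G i p'.1)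
    (e : A ≃ Fin p.1) (e' : A ≃ Fin p'.1) (h : (X i).map e p.2 = (X i).map e' p'.2) :
    p = p' ∧ ∀ a, (e a : ℕ) = e' a := by
  obtain ⟨m, g⟩ := p
  obtain ⟨m', g'⟩ := p'
  obtain rfl : m = m' := by simpa using Nat.card_congr (e.symm.trans e')
  have h1 : (X i).map (e'.symm.trans e) g = g' := by
    rw [(X i).map_trans, h, ← (X i).map_trans, Equiv.symm_trans_self, (X i).map_refl]
  obtain rfl : g = g' := (H.generating i m g').unique ⟨hp, _, h1⟩
    ⟨hp', Equiv.refl _, (X i).map_refl _⟩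
  have h2 := H.free i m _ _ h1
  refine ⟨rfl, fun a => ?_⟩
  have h3 := congrArg (fun f : Equiv.Perm (Fin m) => f (e' a)) h2
  simp only [Equiv.trans_apply, Equiv.symm_apply_apply, Equiv.Perm.one_apply] at h3
  rw [h3]

/-- The generator from which an element of `𝕀 ⊕ X i` is obtained, if it belongs to `X i`. -/
noncomputable def slotLabel (H : IsFreelyGenerated X G) {i : Fin d} {A : Type} [Finite A] :
    (SymColl.unit.sum (X i)).obj A → Option (Σ m, (X i).obj (Fin m))
  | Sum.inl _ => none
  | Sum.inr y => some (H.exists_generator y).choose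

/-- The numbering by which an element of `𝕀 ⊕ X i` is obtained from a generator. -/
noncomputable def slotPos (H : IsFreelyGenerated X G) {i : Fin d} {A : Type} [Finite A] :
    (SymColl.unit.sum (X i)).obj A → A → ℕ
  | Sum.inl _ => fun _ => 0
  | Sum.inr y => fun a => (H.exists_generator y).choose_spec.2.choose a

variable (H : IsFreelyGenerated X G)

/-- Makes the choices in `slotLabel` and `slotPos` harmless: any presentation by a generator and a
numbering gives the same values. -/
theorem slot_inr {i : Fin d} {A : Type} [Finite A] {p : Σ m, (X i).obj (Fin m)}
    (hp : p.2 ∈ G i p.1) (e : A ≃ Fin p.1) :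
    slotLabel H (Sum.inr ((X i).map e p.2) : (SymColl.unit.sum (X i)).obj A) = some p ∧
      ∀ a, slotPos H (Sum.inr ((X i).map e p.2) : (SymColl.unit.sum (X i)).obj A) a = e a := by
  have h := (H.exists_generator ((X i).map e p.2)).choose_spec
  obtain ⟨h1, h2⟩ := H.generator_unique h.1 hp h.2.choose e h.2.choose_spec
  exact ⟨congrArg some h1, h2⟩

theorem slot_cases {i : Fin d} {A : Type} [Finite A] (y : (SymColl.unit.sum (X i)).obj A) :
    (y.isRight = false ∧ slotLabel H y = none ∧ Nat.card A = 1 ∧ slotPos H y = fun _ => 0) ∨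
      ∃ (p : Σ m, (X i).obj (Fin m)) (_ : p.2 ∈ G i p.1) (e : A ≃ Fin p.1),
        y = Sum.inr ((X i).map e p.2) := by
  rcases y with y | y
  · exact Or.inl ⟨rfl, rfl, y.down.down, rfl⟩
  · obtain ⟨p, hp, e, he⟩ := H.exists_generator y
    exact Or.inr ⟨p, hp, e, by rw [he]⟩

theorem slot_map {i : Fin d} {A B : Type} [Finite A] [Finite B] (e : A ≃ B)
    (y : (SymColl.unit.sum (X i)).obj B) :
    slotLabel H ((SymColl.unit.sum (X i)).map e y) = slotLabel H y ∧
      ∀ a, slotPos H ((SymColl.unit.sum (X i)).map e y) a = slotPos H y (e a) := by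
  rcases y with y | y
  · exact ⟨rfl, fun _ => rfl⟩
  · obtain ⟨p, hp, f, rfl⟩ := H.exists_generator y
    have h1 := slot_inr H hp f
    have h2 := slot_inr H hp (e.trans f)
    rw [(X i).map_trans] at h2
    exact ⟨h2.1.trans h1.1.symm, fun a => (h2.2 a).trans (h1.2 (e a)).symm⟩

theorem isSome_slotLabel {i : Fin d} {A : Type} [Finite A]
    (y : (SymColl.unit.sum (X i)).obj A) : (slotLabel H y).isSome = y.isRight := by
  rcases y with y | y <;> rfl

theorem slotLabel_mem {i : Fin d} {A : Type} [Finite A] (y : (SymColl.unit.sum (X i)).obj A)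
    {p : Σ m, (X i).obj (Fin m)} (h : slotLabel H y = some p) : p.2 ∈ G i p.1 := by
  rcases slot_cases H y with ⟨-, h1, -⟩ | ⟨p', hp', e, rfl⟩
  · rw [h1] at h
    cases h
  · rw [(slot_inr H hp' e).1, Option.some_inj] at h
    exact h ▸ hp'

theorem slotPos_lt {i : Fin d} {A : Type} [Finite A] (y : (SymColl.unit.sum (X i)).obj A)
    (a : A) : slotPos H y a < numParts (slotLabel H y) := by
  rcases slot_cases H y with ⟨-, h1, -, h2⟩ | ⟨p', hp', e, rfl⟩
  · rw [h1, h2]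
    exact Nat.one_pos
  · obtain ⟨h1, h2⟩ := slot_inr H hp' e
    rw [h1, h2]
    exact (e a).2

theorem slotPos_injective {i : Fin d} {A : Type} [Finite A]
    (y : (SymColl.unit.sum (X i)).obj A) : Function.Injective (slotPos H y) := by
  intro a b hab
  rcases slot_cases H y with ⟨-, h1, h2, -⟩ | ⟨p', hp', e, rfl⟩
  · exact (Nat.card_eq_one_iff_unique.1 h2).1.elim a b
  · obtain ⟨h1, h2⟩ := slot_inr H hp' e
    rw [h2, h2] at hab
    exact e.injective (Fin.ext hab)

theorem exists_slotPos {i : Fin d} {A : Type} [Finite A]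
    (y : (SymColl.unit.sum (X i)).obj A) {l : ℕ} (hl : l < numParts (slotLabel H y)) :
    ∃ a, slotPos H y a = l := by
  rcases slot_cases H y with ⟨-, h1, h2, h3⟩ | ⟨p', hp', e, rfl⟩
  · obtain ⟨a⟩ := (Nat.card_eq_one_iff_unique.1 h2).2
    rw [h1] at hl
    exact ⟨a, by rw [h3]; exact (Nat.lt_one_iff.1 hl).symm⟩
  · obtain ⟨h1, h2⟩ := slot_inr H hp' e
    rw [h1] at hl
    exact ⟨e.symm ⟨l, hl⟩, by rw [h2]; simp⟩

/-- Together with `exists_slot` this identifies elements of `𝕀 ⊕ X i` on `A` with an optional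
generator and a bijective numbering of `A` by its parts; the unit corresponds to one part and no
cut. -/
theorem slot_ext {i : Fin d} {A : Type} [Finite A]
    {y y' : (SymColl.unit.sum (X i)).obj A} (h : slotLabel H y = slotLabel H y')
    (h' : ∀ a, slotPos H y a = slotPos H y' a) : y = y' := by
  rcases slot_cases H y with ⟨h1, h2, -⟩ | ⟨p, hp, e, rfl⟩
  · have h3 : y'.isRight = false := by rw [← isSome_slotLabel H, ← h, h2]; rfl
    rcases y with y | y
    · rcases y' with y' | y'
      · exact congrArg Sum.inl (show (⟨⟨y.down.down⟩⟩ : ULift (PLift (Nat.card A = 1))) =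
          ⟨⟨y'.down.down⟩⟩ from rfl)
      · cases h3
    · cases h1
  · rcases slot_cases H y' with ⟨-, h2, -⟩ | ⟨p', hp', e', rfl⟩
    · rw [(slot_inr H hp e).1, h2] at h
      cases h
    · rw [(slot_inr H hp e).1, (slot_inr H hp' e').1, Option.some_inj] at h
      subst h
      obtain rfl : e = e' := Equiv.ext fun a => Fin.ext (by
        rw [← (slot_inr H hp e).2, ← (slot_inr H hp' e').2, h'])
      rfl

theorem exists_slot {i : Fin d} {A : Type} [Finite A] {o : Option (Σ m, (X i).obj (Fin m))}
    (ho : ∀ p, o = some p → p.2 ∈ G i p.1) {f : A → ℕ} (hf : Function.Injective f)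
    (hlt : ∀ a, f a < numParts o) (hs : ∀ l < numParts o, ∃ a, f a = l) :
    ∃ y : (SymColl.unit.sum (X i)).obj A, slotLabel H y = o ∧ slotPos H y = f := by
  cases o with
  | none =>
    obtain ⟨a, -⟩ := hs 0 Nat.one_pos
    have hc : Nat.card A = 1 := Nat.card_eq_one_iff_unique.2 ⟨⟨fun a b => hf (by
      have h1 := Nat.lt_one_iff.1 (hlt a)
      have h2 := Nat.lt_one_iff.1 (hlt b)
      rw [h1, h2])⟩, ⟨a⟩⟩
    exact ⟨Sum.inl ⟨⟨hc⟩⟩, rfl, funext fun a => (Nat.lt_one_iff.1 (hlt a)).symm⟩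
  | some p =>
    let e : A ≃ Fin p.1 := Equiv.ofBijective (fun a => (⟨f a, hlt a⟩ : Fin p.1))
      ⟨fun a b h => hf (Fin.mk.inj h), fun l => by
        obtain ⟨a, ha⟩ := hs l l.2
        exact ⟨a, Fin.ext ha⟩⟩
    obtain ⟨h1, h2⟩ := slot_inr H (ho p rfl) e
    exact ⟨_, h1, funext h2⟩

/-! ### The subdivision into a grid -/

/-- The cuts of the grid corresponding to a generator. -/
noncomputable def gridLabel {Q : Type} [Finite Q] (h : (cutGen X).obj Q) (i : Fin d) :
    Option (Σ m, (X i).obj (Fin m)) := slotLabel H (h.2 i)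

/-- The position of a box in the grid corresponding to a generator. -/
noncomputable def gridPos {Q : Type} [Finite Q] (h : (cutGen X).obj Q) (q : Q) (i : Fin d) : ℕ :=
  slotPos H (h.2 i) (Quotient.mk _ q)

theorem isGridLabel_gridLabel {Q : Type} [Finite Q] (h : (cutGen X).obj Q) :
    IsGridLabel G (gridLabel H h) :=
  fun _ p hp => ⟨H.two_le p, slotLabel_mem H _ hp⟩

theorem isGridIndex_gridPos {Q : Type} [Finite Q] (h : (cutGen X).obj Q) (q : Q) :
    IsGridIndex (gridLabel H h) (gridPos H h q) := fun _ => slotPos_lt H _ _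

theorem gridPos_apply_eq_iff {Q : Type} [Finite Q] (h : (cutGen X).obj Q) (q q' : Q) (i : Fin d) :
    gridPos H h q i = gridPos H h q' i ↔ (h.1.1 i) q q' :=
  (slotPos_injective H (h.2 i)).eq_iff.trans Quotient.eq

/-- This is the uniqueness half of orthogonality; the existence half gives `exists_gridPos`. Thus
the set `Q` is in bijection with the boxes of the grid. -/
theorem gridPos_injective {Q : Type} [Finite Q] (h : (cutGen X).obj Q) :
    Function.Injective (gridPos H h) := by
  intro q q' hq
  refine (h.1.2 (fun i => Quotient.mk _ q)).unique (fun i => rfl) (fun i => ?_)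
  exact (Quotient.sound ((gridPos_apply_eq_iff H h q q' i).1 (congrFun hq i))).symm

theorem exists_gridPos {Q : Type} [Finite Q] (h : (cutGen X).obj Q) {v : Fin d → ℕ}
    (hv : IsGridIndex (gridLabel H h) v) : ∃ q, gridPos H h q = v := by
  choose B hB using fun i => exists_slotPos H (h.2 i) (hv i)
  obtain ⟨q, hq, -⟩ := h.1.2 B
  exact ⟨q, funext fun i => (congrArg (slotPos H (h.2 i)) (hq i)).trans (hB i)⟩

/-- The box in the grid corresponding to a generator. -/
noncomputable def gridCell {Q : Type} [Finite Q] (h : (cutGen X).obj Q) (q : Q) : Rect d :=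
  (Rect.cube d).gridBox (fun i => numParts (gridLabel H h i)) (gridPos H h q)

theorem gridCell_nondeg {Q : Type} [Finite Q] (h : (cutGen X).obj Q) (q : Q) :
    (gridCell H h q).Nondeg := Rect.gridBox_nondeg Rect.cube_nondeg (isGridIndex_gridPos H h q)

theorem gridLabel_map {Q Q' : Type} [Finite Q] [Finite Q'] (e : Q ≃ Q')
    (h : (cutGen X).obj Q') : gridLabel H ((cutGen X).map e h) = gridLabel H h :=
  funext fun i => (slot_map H (quotEquiv e e.surjective (h.1.1 i)) (h.2 i)).1

theorem gridPos_map {Q Q' : Type} [Finite Q] [Finite Q'] (e : Q ≃ Q')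
    (h : (cutGen X).obj Q') (q : Q) : gridPos H ((cutGen X).map e h) q = gridPos H h (e q) :=
  funext fun i => (slot_map H (quotEquiv e e.surjective (h.1.1 i)) (h.2 i)).2 _

theorem gridCell_map {Q Q' : Type} [Finite Q] [Finite Q'] (e : Q ≃ Q')
    (h : (cutGen X).obj Q') (q : Q) : gridCell H ((cutGen X).map e h) q = gridCell H h (e q) := by
  simp only [gridCell, gridLabel_map, gridPos_map]

/-- The family of subdivisions of the boxes of a grid obtained by rescaling subdivisions of the
unit cube: the sets of boxes. -/
def fillParts {Q : Type} [Finite Q] (h : (cutGen X).obj Q) {W : Q → Type}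
    (b : ∀ q, LabelledSubdivision G (W q)) (v : Fin d → ℕ) : Set (Rect d) :=
  ⋃ (q) (_ : gridPos H h q = v), (gridCell H h q).mul '' Set.range (b q).cell

/-- The family of subdivisions of the boxes of a grid obtained by rescaling subdivisions of the
unit cube: the sets of cuts. -/
def fillCuts {Q : Type} [Finite Q] (h : (cutGen X).obj Q) {W : Q → Type}
    (b : ∀ q, LabelledSubdivision G (W q)) (v : Fin d → ℕ) : Cuts X :=
  ⋃ (q) (_ : gridPos H h q = v), mulCuts (gridCell H h q) (b q).cuts

theorem fillParts_gridPos {Q : Type} [Finite Q] (h : (cutGen X).obj Q) {W : Q → Type}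
    (b : ∀ q, LabelledSubdivision G (W q)) (q : Q) :
    fillParts H h b (gridPos H h q) = (gridCell H h q).mul '' Set.range (b q).cell := by
  simp only [fillParts, (gridPos_injective H h).eq_iff, Set.iUnion_iUnion_eq_left]

theorem fillCuts_gridPos {Q : Type} [Finite Q] (h : (cutGen X).obj Q) {W : Q → Type}
    (b : ∀ q, LabelledSubdivision G (W q)) (q : Q) :
    fillCuts H h b (gridPos H h q) = mulCuts (gridCell H h q) (b q).cuts := by
  simp only [fillCuts, (gridPos_injective H h).eq_iff, Set.iUnion_iUnion_eq_left]

theorem isGridSubdivision_fill {Q : Type} [Finite Q] (h : (cutGen X).obj Q) {W : Q → Type}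
    (b : ∀ q, LabelledSubdivision G (W q)) :
    IsGridSubdivision G (gridLabel H h) (Rect.cube d) (fillParts H h b) (fillCuts H h b) := by
  intro v hv
  obtain ⟨q, rfl⟩ := exists_gridPos H h hv
  rw [fillParts_gridPos, fillCuts_gridPos]
  have := (b q).isSubdivision.mul (gridCell_nondeg H h q)
  rwa [Rect.mul_cube] at this

theorem biUnion_gridIndex {α : Type*} {Q : Type} [Finite Q] (h : (cutGen X).obj Q)
    (F : (Fin d → ℕ) → Set α) :
    ⋃ v ∈ {v | IsGridIndex (gridLabel H h) v}, F v = ⋃ q, F (gridPos H h q) := by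
  ext x
  simp only [Set.mem_iUnion, Set.mem_ofPred_eq, exists_prop]
  constructor
  · rintro ⟨v, hv, hx⟩
    obtain ⟨q, rfl⟩ := exists_gridPos H h hv
    exact ⟨q, hx⟩
  · rintro ⟨q, hx⟩
    exact ⟨_, isGridIndex_gridPos H h q, hx⟩

/-- Filling every box trivially returns the bare grid, so properties of the grid follow from those
of filled grids. -/
theorem gridParts_fill_one {Q : Type} [Finite Q] (h : (cutGen X).obj Q) :
    gridParts (gridLabel H h) (fillParts H h (fun _ : Q =>
      (LabelledSubdivision.one : LabelledSubdivision G Unit))) = Set.range (gridCell H h) := by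
  simp only [gridParts, biUnion_gridIndex, fillParts_gridPos]
  simp [LabelledSubdivision.one, Rect.mul_cube, Set.iUnion_singleton_eq_range]

theorem gridCuts_fill_one {Q : Type} [Finite Q] (h : (cutGen X).obj Q) :
    gridCuts (gridLabel H h) (Rect.cube d) (fillCuts H h (fun _ : Q =>
      (LabelledSubdivision.one : LabelledSubdivision G Unit))) =
        ⋃ i, optCuts (Rect.cube d) i (gridLabel H h i) := by
  simp only [gridCuts, biUnion_gridIndex, fillCuts_gridPos]
  simp [LabelledSubdivision.one, mulCuts]

/-- The subdivision of the unit cube into a grid that corresponds to a generator. -/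
noncomputable def gridSubdivision {Q : Type} [Finite Q] (h : (cutGen X).obj Q) :
    LabelledSubdivision G Q where
  cell := gridCell H h
  cuts := ⋃ i, optCuts (Rect.cube d) i (gridLabel H h i)
  injective q q' hq := by
    refine gridPos_injective H h (Rect.eq_of_sub_gridBox Rect.cube_nondeg
      (isGridIndex_gridPos H h q) (gridCell_nondeg H h q) (fun i => ⟨le_rfl, le_rfl⟩)
      (?_ : (gridCell H h q).Sub (gridCell H h q')))
    rw [hq]
    exact fun i => ⟨le_rfl, le_rfl⟩
  isSubdivision := by
    have h1 := (isGridSubdivision_fill H h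
      (fun _ : Q => (LabelledSubdivision.one : LabelledSubdivision G Unit))).isSubdivision
      Rect.cube_nondeg (isGridLabel_gridLabel H h)
    rwa [gridParts_fill_one, gridCuts_fill_one] at h1

end Generators

/-! ### The subdivision associated with a basis element, and injectivity. -/

section Total

variable {d : ℕ} {X : Fin d → SymColl.{u}} {G : ∀ i n, Set ((X i).obj (Fin n))}
  (H : IsFreelyGenerated X G)

/-- The directions of the cuts of the grid corresponding to a generator. -/
def gridDirs {Q : Type} [Finite Q] (h : (cutGen X).obj Q) : Finset (Fin d) :=
  Finset.univ.filter (fun i : Fin d => (h.2 i).isRight = true)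

theorem mem_gridDirs {Q : Type} [Finite Q] (h : (cutGen X).obj Q) (i : Fin d) :
    i ∈ gridDirs h ↔ (gridLabel H h i).isSome := by
  rw [gridLabel, isSome_slotLabel]
  simp [gridDirs]

theorem gridDirs_map {Q Q' : Type} [Finite Q] [Finite Q'] (e : Q ≃ Q')
    (h : (cutGen X).obj Q') : gridDirs ((cutGen X).map e h) = gridDirs h := by
  ext i
  simp [gridDirs, cutGen, matrixProd, SymColl.sum]

variable (G) in
/-- The bases of the free modules of the resolution. -/
abbrev FreeBasis (s : ℕ) (U : Type) [Finite U] : Type u :=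
  (freeModule (cutGenDeg X s) (cutOperad G)).obj U

/-- The generator that is the first component of a basis element. -/
def FreeBasis.gen {s : ℕ} {U : Type} [Finite U] (x : FreeBasis G s U) :
    (cutGen X).obj (Quotient x.1) := x.2.1.1

/-- The subdivisions that are the second component of a basis element. -/
def FreeBasis.fill {s : ℕ} {U : Type} [Finite U] (x : FreeBasis G s U) (q : Quotient x.1) :
    LabelledSubdivision G {u : U // Quotient.mk x.1 u = q} := x.2.2 q

/-- The directions of the cuts of the grid corresponding to a basis element. -/
def FreeBasis.dirs {s : ℕ} {U : Type} [Finite U] (x : FreeBasis G s U) : Finset (Fin d) :=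
  gridDirs x.gen

theorem FreeBasis.card_dirs {s : ℕ} {U : Type} [Finite U] (x : FreeBasis G s U) :
    x.dirs.card = s := x.2.1.2

/-- The subdivision obtained by substituting the second component of a basis element into the
grid corresponding to the first one. -/
noncomputable def FreeBasis.total {s : ℕ} {U : Type} [Finite U] (x : FreeBasis G s U) :
    LabelledSubdivision G U :=
  ((gridSubdivision H x.gen).comp x.fill).map
    (Equiv.sigmaFiberEquiv (Quotient.mk x.1)).symm

theorem FreeBasis.total_cell {s : ℕ} {U : Type} [Finite U] (x : FreeBasis G s U) (u : U) :
    (x.total H).cell u =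
      (gridCell H x.gen (Quotient.mk _ u)).mul ((x.fill (Quotient.mk _ u)).cell ⟨u, rfl⟩) := rfl

theorem FreeBasis.total_cuts {s : ℕ} {U : Type} [Finite U] (x : FreeBasis G s U) :
    (x.total H).cuts = (⋃ i, optCuts (Rect.cube d) i (gridLabel H x.gen i)) ∪
      ⋃ q, mulCuts (gridCell H x.gen q) (x.fill q).cuts := rfl

theorem FreeBasis.total_cuts_eq {s : ℕ} {U : Type} [Finite U] (x : FreeBasis G s U) :
    (x.total H).cuts = gridCuts (gridLabel H x.gen) (Rect.cube d) (fillCuts H x.gen x.fill) := by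
  simp only [gridCuts, biUnion_gridIndex, fillCuts_gridPos, total_cuts]

theorem FreeBasis.range_total_cell {s : ℕ} {U : Type} [Finite U] (x : FreeBasis G s U) :
    Set.range (x.total H).cell = gridParts (gridLabel H x.gen) (fillParts H x.gen x.fill) := by
  simp only [gridParts, biUnion_gridIndex, fillParts_gridPos]
  ext B
  simp only [Set.mem_range, Set.mem_iUnion, Set.mem_image, Subtype.exists]
  constructor
  · rintro ⟨u, rfl⟩
    exact ⟨Quotient.mk _ u, _, ⟨u, rfl, rfl⟩, rfl⟩
  · rintro ⟨_, _, ⟨u, rfl, rfl⟩, rfl⟩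
    exact ⟨u, rfl⟩

/-- The subdivision may start by a cut in the direction `i`. -/
def LabelledSubdivision.HasCutIn {U : Type} (c : LabelledSubdivision G U) (i : Fin d) : Prop :=
  ∃ p, HasCut G (Rect.cube d) (Set.range c.cell) c.cuts i p

theorem FreeBasis.hasCut {s : ℕ} {U : Type} [Finite U] (x : FreeBasis G s U) {i : Fin d}
    {p : Σ m, (X i).obj (Fin m)} (hp : gridLabel H x.gen i = some p) :
    HasCut G (Rect.cube d) (Set.range (x.total H).cell) (x.total H).cuts i p := by
  rw [x.total_cuts_eq, x.range_total_cell]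
  exact (isGridSubdivision_fill H x.gen x.fill).hasCut Rect.cube_nondeg
    (isGridLabel_gridLabel H x.gen) hp

theorem FreeBasis.hasCutIn {s : ℕ} {U : Type} [Finite U] (x : FreeBasis G s U) {i : Fin d}
    (hi : i ∈ x.dirs) : (x.total H).HasCutIn i := by
  obtain ⟨p, hp⟩ := Option.isSome_iff_exists.1 ((mem_gridDirs H _ i).1 hi)
  exact ⟨p, x.hasCut H hp⟩

theorem LabelledSubdivision.cuts_inj {U V : Type} (a : LabelledSubdivision G V) (v : V)
    {b b' : LabelledSubdivision G U}
    (h : ∀ u, (a.cell v).mul (b.cell u) = (a.cell v).mul (b'.cell u))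
    (h' : mulCuts (a.cell v) b.cuts = mulCuts (a.cell v) b'.cuts) : b = b' := by
  refine LabelledSubdivision.ext (funext fun u => (a.nondeg v).mul_injective (h u)) ?_
  refine Set.image_injective.2 ?_ h'
  rintro ⟨x, l⟩ ⟨x', l'⟩ hx
  exact Prod.ext ((a.nondeg v).toFun_injective (congrArg Prod.fst hx)) (congrArg Prod.snd hx :)

/-- The labels of the grid are unique first cuts, the position of each block is the grid box
containing its parts, and the fillings are what the total subdivision induces in the boxes. -/
theorem FreeBasis.total_injective {s : ℕ} {U : Type} [Finite U] {x x' : FreeBasis G s U}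
    (h : x.total H = x'.total H) (hd : x.dirs = x'.dirs) : x = x' := by
  have hlab : gridLabel H x.gen = gridLabel H x'.gen := by
    funext i
    by_cases hi : i ∈ x.dirs
    · obtain ⟨p, hp⟩ := Option.isSome_iff_exists.1 ((mem_gridDirs H _ i).1 hi)
      rw [hd] at hi
      obtain ⟨p', hp'⟩ := Option.isSome_iff_exists.1 ((mem_gridDirs H _ i).1 hi)
      have h1 := x.hasCut H hp
      have h2 := x'.hasCut H hp'
      rw [← h] at h2
      rw [hp, hp', h1.unique h2 Rect.cube_nondeg Rect.cube_isRational]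
    · have h1 := (mem_gridDirs H _ i).not.1 hi
      rw [hd] at hi
      have h2 := (mem_gridDirs H _ i).not.1 hi
      rw [Option.not_isSome_iff_eq_none] at h1 h2
      rw [h1, h2]
  -- The grids now coincide, and a part of the total subdivision fits into only one grid box.
  have hpos : ∀ u : U, gridPos H x.gen (Quotient.mk _ u) = gridPos H x'.gen (Quotient.mk _ u) := by
    intro u
    have h1 : ∀ x : FreeBasis G s U, ((x.total H).cell u).Sub
        (gridCell H x.gen (Quotient.mk _ u)) := fun x =>
      Rect.mul_sub (gridCell_nondeg H _ _) ((x.fill _).sub _)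
    have h2 := h1 x'
    rw [← h, gridCell, ← hlab] at h2
    exact Rect.eq_of_sub_gridBox Rect.cube_nondeg (isGridIndex_gridPos H _ _)
      ((x.total H).nondeg u) (h1 x) h2
  have hcell : ∀ u : U, gridCell H x.gen (Quotient.mk _ u) =
      gridCell H x'.gen (Quotient.mk _ u) := by
    intro u
    rw [gridCell, gridCell, hlab, hpos]
  have hfill := fun u : U => congrArg (fun c : LabelledSubdivision G U => c.cell u) h
  have hcuts := congrArg LabelledSubdivision.cuts h
  rw [total_cuts_eq, total_cuts_eq, ← hlab] at hcuts
  have hg' := isGridSubdivision_fill H x'.gen x'.fill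
  rw [← hlab] at hg'
  have hcuts' := fun u : U => gridCuts_injective Rect.cube_nondeg Rect.cube_isRational
    (isGridSubdivision_fill H x.gen x.fill) hg' hcuts
    (isGridIndex_gridPos H x.gen (Quotient.mk _ u))
  have hcuts'' : ∀ u : U, mulCuts (gridCell H x.gen (Quotient.mk _ u))
      (x.fill (Quotient.mk _ u)).cuts = mulCuts (gridCell H x.gen (Quotient.mk _ u))
      (x'.fill (Quotient.mk _ u)).cuts := by
    intro u
    have := hcuts' u
    rw [fillCuts_gridPos, hpos, fillCuts_gridPos] at this
    rw [this, hcell]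
  clear hcuts hg' hcuts' hd
  obtain ⟨S, ⟨⟨⟨π, hπ⟩, y⟩, hs⟩, p⟩ := x
  obtain ⟨S', ⟨⟨⟨π', hπ'⟩, y'⟩, hs'⟩, p'⟩ := x'
  -- Both the partition of `U` and the orthogonal partitions of its blocks are read off from
  -- positions: equal positions for the former, equal `i`-th coordinates for the latter.
  obtain rfl : S = S' := by
    refine Setoid.ext fun a b => ?_
    rw [← Quotient.eq (r := S), ← Quotient.eq (r := S')]
    have h1 := (gridPos_injective H (FreeBasis.gen (G := G) (s := s)
      ⟨S, ⟨⟨⟨π, hπ⟩, y⟩, hs⟩, p⟩)).eq_iff (a := Quotient.mk S a) (b := Quotient.mk S b)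
    have h2 := (gridPos_injective H (FreeBasis.gen (G := G) (s := s)
      ⟨S', ⟨⟨⟨π', hπ'⟩, y'⟩, hs'⟩, p'⟩)).eq_iff (a := Quotient.mk S' a) (b := Quotient.mk S' b)
    rw [← h1, ← h2]
    exact iff_of_eq (congrArg₂ _ (hpos a) (hpos b))
  obtain rfl : π = π' := by
    funext i
    refine Setoid.ext fun a b => ?_
    induction a using Quotient.inductionOn with | h a =>
    induction b using Quotient.inductionOn with | h b =>
    have h1 := gridPos_apply_eq_iff H (FreeBasis.gen (G := G) (s := s)
      ⟨S, ⟨⟨⟨π, hπ⟩, y⟩, hs⟩, p⟩) (Quotient.mk S a) (Quotient.mk S b) i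
    have h2 := gridPos_apply_eq_iff H (FreeBasis.gen (G := G) (s := s)
      ⟨S, ⟨⟨⟨π', hπ'⟩, y'⟩, hs'⟩, p'⟩) (Quotient.mk S a) (Quotient.mk S b) i
    rw [hpos a, hpos b] at h1
    exact h1.symm.trans h2
  obtain rfl : y = y' := by
    funext i
    refine slot_ext H (congrFun hlab i) (fun a => ?_)
    induction a using Quotient.inductionOn with | h a =>
    induction a using Quotient.inductionOn with | h a =>
    exact congrFun (hpos a) i
  refine CompObj.ext (A := cutGenDeg X s) (P := (cutOperad G).toSymColl) (U := U) (S := S) rfl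
    (fun u => ?_)
  refine LabelledSubdivision.cuts_inj
    (gridSubdivision H (Q := Quotient S) (⟨⟨π, hπ⟩, y⟩ : (cutGen X).obj (Quotient S)))
    (Quotient.mk _ u) (fun u' => ?_) (hcuts'' u)
  obtain ⟨u', hu'⟩ := u'
  have key : ∀ q (hq : Quotient.mk S u' = q),
      (gridCell H (⟨⟨π, hπ⟩, y⟩ : (cutGen X).obj (Quotient S)) q).mul ((p q).cell ⟨u', hq⟩) =
      (gridCell H (⟨⟨π, hπ⟩, y⟩ : (cutGen X).obj (Quotient S)) q).mul ((p' q).cell ⟨u', hq⟩) := by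
    rintro q rfl
    exact hfill u'
  exact key _ hu'

end Total

/-! ### Rescaling a box back to the unit cube. -/

section Inverse

variable {d : ℕ}

/-- The image of the unit cube under the inverse of the affine map taking the unit cube to `R`. -/
noncomputable def Rect.inv (R : Rect d) : Rect d :=
  ⟨fun i => -R.lo i / (R.hi i - R.lo i), fun i => (1 - R.lo i) / (R.hi i - R.lo i)⟩

theorem Rect.Nondeg.inv {R : Rect d} (hR : R.Nondeg) : R.inv.Nondeg := by
  intro i
  have h := sub_pos.2 (hR i)
  simp only [Rect.inv]
  rw [div_lt_div_iff_of_pos_right h]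
  linarith

theorem Rect.Nondeg.inv_mul {R : Rect d} (hR : R.Nondeg) : R.inv.mul R = Rect.cube d := by
  have h := fun i => (sub_pos.2 (hR i)).ne'
  ext i <;> simp only [Rect.inv, Rect.mul, Rect.toFun, Rect.cube] <;> field_simp [h i] <;> ring

theorem Rect.Nondeg.mul_inv {R : Rect d} (hR : R.Nondeg) : R.mul R.inv = Rect.cube d := by
  have h := fun i => (sub_pos.2 (hR i)).ne'
  ext i <;> simp only [Rect.inv, Rect.mul, Rect.toFun, Rect.cube] <;> field_simp [h i] <;> ring

theorem Rect.Nondeg.mul_inv_mul {R : Rect d} (hR : R.Nondeg) (B : Rect d) :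
    R.mul (R.inv.mul B) = B := by
  rw [← Rect.mul_assoc, hR.mul_inv, Rect.cube_mul]

end Inverse

/-! ### Every admissible pair occurs; compatibility with relabelling and substitution. -/

section Total

variable {d : ℕ} {X : Fin d → SymColl.{u}} {G : ∀ i n, Set ((X i).obj (Fin n))}
  (H : IsFreelyGenerated X G)

/-- By `IsSubdivision.exists_grid`, `c` refines the grid of its first cuts in the directions of `I`;
the basis element consists of this grid and of the rescaled contents of its boxes. -/
theorem FreeBasis.total_surjective {U : Type} [Finite U] (c : LabelledSubdivision G U)
    (I : Finset (Fin d)) (hI : ∀ i ∈ I, c.HasCutIn i) :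
    ∃ x : FreeBasis G I.card U, x.total H = c ∧ x.dirs = I := by
  classical
  let r : ∀ i, Option (Σ m, (X i).obj (Fin m)) := fun i =>
    if h : i ∈ I then some (hI i h).choose else none
  have hr : ∀ i p, r i = some p → HasCut G (Rect.cube d) (Set.range c.cell) c.cuts i p := by
    intro i p hp
    by_cases h : i ∈ I
    · simp only [r, dif_pos h, Option.some_inj] at hp
      exact hp ▸ (hI i h).choose_spec
    · simp [r, dif_neg h] at hp
  have hrI : ∀ i, (r i).isSome ↔ i ∈ I := by
    intro i
    by_cases h : i ∈ I <;> simp [r, h]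
  clear_value r
  obtain ⟨D, E, hDE, hD, hE⟩ := c.isSubdivision.exists_grid Rect.cube_nondeg
    Rect.cube_isRational hr
  have hmem : ∀ u, ∃ v, IsGridIndex r v ∧ c.cell u ∈ D v := by
    intro u
    have : c.cell u ∈ gridParts r D := hD ▸ ⟨u, rfl⟩
    simpa [gridParts] using this
  choose v hv hvD using hmem
  have hvu : ∀ u v', IsGridIndex r v' → c.cell u ∈ D v' → v u = v' := by
    intro u v' hv' hu
    exact Rect.eq_of_sub_gridBox Rect.cube_nondeg (hv u) (c.nondeg u)
      ((((hDE _ (hv u)).boxes (Rect.gridBox_nondeg Rect.cube_nondeg (hv u))).1 _ (hvD u)).2)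
      ((((hDE _ hv').boxes (Rect.gridBox_nondeg Rect.cube_nondeg hv')).1 _ hu).2)
  have hDu : ∀ v', IsGridIndex r v' → ∀ B ∈ D v', ∃ u, v u = v' ∧ c.cell u = B := by
    intro v' hv' B hB
    have h1 : B ∈ gridParts r D := Set.mem_iUnion₂.2 ⟨v', hv', hB⟩
    rw [← hD] at h1
    obtain ⟨u, rfl⟩ := h1
    exact ⟨u, hvu u v' hv' hB, rfl⟩
  -- A block consists of the parts in one grid box. The partition `π i` then groups blocks by their
  -- `i`-th coordinate, and orthogonality says that every combination of coordinates is exactly one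
  -- box.
  let S : Setoid U := Setoid.ker v
  let vq : Quotient S → Fin d → ℕ := Setoid.kerLift v
  have hvq : Function.Injective vq := Setoid.kerLift_injective v
  have hvqI : ∀ q, IsGridIndex r (vq q) := fun q => Quotient.inductionOn q hv
  have hvqs : ∀ v', IsGridIndex r v' → ∃ q, vq q = v' := by
    intro v' hv'
    obtain ⟨B, hB⟩ := (hDE v' hv').nonempty
    obtain ⟨u, hu, -⟩ := hDu v' hv' B hB
    exact ⟨Quotient.mk _ u, hu⟩
  let π : Fin d → Setoid (Quotient S) := fun i => Setoid.ker (fun q => vq q i)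
  let f : ∀ i, Quotient (π i) → ℕ := fun i => Setoid.kerLift (fun q => vq q i)
  have hf : ∀ i, Function.Injective (f i) := fun i => Setoid.kerLift_injective _
  have hfI : ∀ i B, f i B < numParts (r i) := fun i B => Quotient.inductionOn B (fun q => hvqI q i)
  have hπ : Orthogonal π := by
    intro B
    obtain ⟨q, hq⟩ := hvqs (fun i => f i (B i)) (fun i => hfI i (B i))
    refine ⟨q, fun i => hf i (congrFun hq i), fun q' hq' => hvq ?_⟩
    rw [hq]
    funext i
    exact congrArg (f i) (hq' i)
  have hfs : ∀ i, ∀ l < numParts (r i), ∃ B, f i B = l := by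
    intro i l hl
    have h1 : ∀ i, 0 < numParts (r i) := fun i => by
      cases h : r i with
      | none => exact Nat.one_pos
      | some p => exact lt_of_lt_of_le two_pos (H.two_le p)
    -- To show that layer `l` in the direction `i` is inhabited, the box with all other coordinates
    -- `0` is used.
    obtain ⟨q, hq⟩ := hvqs (Function.update (fun _ => 0) i l) (fun j => by
      by_cases hj : j = i
      · subst hj
        simpa using hl
      · simpa [hj] using h1 j)
    refine ⟨Quotient.mk _ q, (congrFun hq i).trans (by simp)⟩
  choose y hy1 hy2 using fun i => exists_slot H (i := i) (o := r i)
    (fun p hp => (hr i p hp).2.1) (hf i) (hfI i) (hfs i)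
  let h : (cutGen X).obj (Quotient S) := ⟨⟨π, hπ⟩, y⟩
  have hlab : gridLabel H h = r := funext hy1
  have hpos : ∀ q, gridPos H h q = vq q := fun q => funext fun i =>
    congrFun (hy2 i) (Quotient.mk _ q)
  have hdirs : gridDirs h = I := by
    ext i
    rw [mem_gridDirs H, hlab, hrI]
  have hcell : ∀ q, gridCell H h q =
      (Rect.cube d).gridBox (fun i => numParts (r i)) (vq q) := by
    intro q
    rw [gridCell, hlab, hpos]
  -- The content of each grid box is carried to the unit cube by the inverse of the map that places
  -- it there.
  let p : ∀ q : Quotient S, LabelledSubdivision G {u : U // Quotient.mk S u = q} := fun q =>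
    { cell := fun u => (gridCell H h q).inv.mul (c.cell u.1)
      cuts := mulCuts (gridCell H h q).inv (E (vq q))
      injective := fun u u' huu => Subtype.ext
        (c.injective ((gridCell_nondeg H h q).inv.mul_injective huu))
      isSubdivision := by
        have h1 := (hDE _ (hvqI q)).mul (gridCell_nondeg H h q).inv
        rw [← hcell, (gridCell_nondeg H h q).inv_mul] at h1
        convert h1 using 1
        ext B
        constructor
        · rintro ⟨⟨u, rfl⟩, rfl⟩
          exact ⟨_, hvD u, rfl⟩
        · rintro ⟨B, hB, rfl⟩
          obtain ⟨u, hu, rfl⟩ := hDu _ (hvqI q) B hB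
          exact ⟨⟨u, hvq hu⟩, rfl⟩ }
  let x : FreeBasis G I.card U := ⟨S, ⟨h, congrArg Finset.card hdirs⟩, p⟩
  refine ⟨x, ?_, hdirs⟩
  refine LabelledSubdivision.ext (funext fun u => ?_) ?_
  · exact (gridCell_nondeg H h _).mul_inv_mul _
  · have h1 : ∀ q, mulCuts (gridCell H h q) (p q).cuts = E (vq q) := by
      intro q
      simp only [p]
      rw [← mulCuts_mul, (gridCell_nondeg H h q).mul_inv, mulCuts_cube]
    rw [FreeBasis.total_cuts, hE]
    simp only [gridCuts]
    rw [← hlab, biUnion_gridIndex H h]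
    simp only [hpos, ← h1]
    rfl

theorem FreeBasis.total_map {s : ℕ} {U V : Type} [Finite U] [Finite V] (e : U ≃ V)
    (x : FreeBasis G s V) :
    FreeBasis.total H ((freeModule (cutGenDeg X s) (cutOperad G)).map e x : FreeBasis G s U) =
      (x.total H).map e := by
  refine LabelledSubdivision.ext (funext fun u => ?_) ?_
  · exact congrArg (fun R : Rect d => R.mul ((x.fill (Quotient.mk _ (e u))).cell ⟨e u, rfl⟩))
      (gridCell_map H (quotEquiv e e.surjective x.1) x.gen (Quotient.mk _ u))
  · refine congrArg₂ (· ∪ ·) ?_ ?_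
    · exact congrArg (fun r : ∀ i, Option (Σ m, (X i).obj (Fin m)) =>
        ⋃ i, optCuts (Rect.cube d) i (r i)) (gridLabel_map H (quotEquiv e e.surjective x.1) x.gen)
    · refine Eq.trans (Set.iUnion_congr fun q => ?_)
        ((quotEquiv e e.surjective x.1).surjective.iUnion_comp
          (fun q => mulCuts (gridCell H x.gen q) (x.fill q).cuts))
      exact congrArg (fun R : Rect d => mulCuts R (x.fill (quotEquiv e e.surjective x.1 q)).cuts)
        (gridCell_map H (quotEquiv e e.surjective x.1) x.gen q)

theorem FreeBasis.dirs_map {s : ℕ} {U V : Type} [Finite U] [Finite V] (e : U ≃ V)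
    (x : FreeBasis G s V) :
    FreeBasis.dirs ((freeModule (cutGenDeg X s) (cutOperad G)).map e x : FreeBasis G s U) =
      x.dirs := gridDirs_map (quotEquiv e e.surjective x.1) x.gen

theorem FreeBasis.dirs_act {s : ℕ} {V : Type} {W : V → Type} [Finite V] [∀ v, Finite (W v)]
    (x : FreeBasis G s V) (b : ∀ v, (cutOperad G).obj (W v)) :
    FreeBasis.dirs ((freeModule (cutGenDeg X s) (cutOperad G)).act x b :
      FreeBasis G s (Σ v, W v)) = x.dirs :=
  gridDirs_map (quotEquiv Sigma.fst ((cutOperad G).fst_surjective b) x.1) x.gen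

/-- Associativity of substitution: the action only relabels the blocks of the grid, and substitutes
inside the fillings. -/
theorem FreeBasis.total_act {s : ℕ} {V : Type} {W : V → Type} [Finite V] [∀ v, Finite (W v)]
    (x : FreeBasis G s V) (b : ∀ v, (cutOperad G).obj (W v)) :
    FreeBasis.total H ((freeModule (cutGenDeg X s) (cutOperad G)).act x b :
      FreeBasis G s (Σ v, W v)) = (x.total H).comp b := by
  have hf := (cutOperad G).fst_surjective b
  refine LabelledSubdivision.ext (funext fun u => ?_) ?_
  · refine Eq.trans ?_ (Rect.mul_assoc _ _ _).symm
    exact congrArg (fun R : Rect d => R.mul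
      (((x.fill (Quotient.mk _ u.1)).cell ⟨u.1, rfl⟩).mul
        ((b u.1 : LabelledSubdivision G (W u.1)).cell u.2)))
      (gridCell_map H (quotEquiv Sigma.fst hf x.1) x.gen (Quotient.mk _ u))
  · refine Eq.trans ?_ (Set.union_assoc _ _ _).symm
    refine congrArg₂ (· ∪ ·) ?_ ?_
    · exact congrArg (fun r : ∀ i, Option (Σ m, (X i).obj (Fin m)) =>
        ⋃ i, optCuts (Rect.cube d) i (r i)) (gridLabel_map H (quotEquiv Sigma.fst hf x.1) x.gen)
    · refine Eq.trans (Set.iUnion_congr fun q => ?_)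
        (((quotEquiv Sigma.fst hf x.1).surjective.iUnion_comp
          (fun q => mulCuts (gridCell H x.gen q) ((x.fill q).comp
            (fun v : {v : V // Quotient.mk x.1 v = q} =>
              (b v.1 : LabelledSubdivision G (W v.1)))).cuts)).trans ?_)
      · exact congrArg (fun R : Rect d => mulCuts R ((x.fill (quotEquiv Sigma.fst hf x.1 q)).comp
          (fun v : {v : V // Quotient.mk x.1 v = _} =>
            (b v.1 : LabelledSubdivision G (W v.1)))).cuts)
          (gridCell_map H (quotEquiv Sigma.fst hf x.1) x.gen q)
      · simp only [LabelledSubdivision.comp, mulCuts, Set.image_union, Set.image_iUnion,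
          Set.iUnion_union_distrib]
        congr 1
        ext z
        simp only [Set.mem_iUnion]
        constructor
        · rintro ⟨_, ⟨v, rfl⟩, hz⟩
          refine ⟨v, ?_⟩
          rw [Set.image_image] at hz
          simpa only [FreeBasis.total_cell, Rect.toFun_mul] using hz
        · rintro ⟨v, hz⟩
          refine ⟨_, ⟨v, rfl⟩, ?_⟩
          rw [Set.image_image]
          simpa only [FreeBasis.total_cell, Rect.toFun_mul] using hz

end Total

/-! ### Chain complexes of full simplices, with the empty face included. -/

section Koszul

variable (k : Type v) [Field k] {C : Type u} {ι : Type} [LinearOrder ι]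

/-- The sign with which the face opposite to `i` enters the boundary of the simplex `I`. -/
def faceSign (i : ι) (I : Finset ι) : k := (-1) ^ (I.filter (· < i)).card

/-- The boundary map of the direct sum of simplices indexed by `C`. -/
noncomputable def simplexBoundary : (C × Finset ι →₀ k) →ₗ[k] (C × Finset ι →₀ k) :=
  Finsupp.linearCombination k (fun p =>
    ∑ i ∈ p.2, faceSign k i p.2 • Finsupp.single (p.1, p.2.erase i) (1 : k))

theorem simplexBoundary_single (p : C × Finset ι) :
    simplexBoundary k (Finsupp.single p 1) =
      ∑ i ∈ p.2, faceSign k i p.2 • Finsupp.single (p.1, p.2.erase i) (1 : k) := by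
  simp [simplexBoundary]

theorem faceSign_erase_of_lt {i j : ι} {I : Finset ι} (hi : i ∈ I) (h : i < j) :
    faceSign k j I = -faceSign k j (I.erase i) := by
  unfold faceSign
  have h1 : I.filter (· < j) = insert i ((I.erase i).filter (· < j)) := by
    ext l
    by_cases hl : l = i <;> simp [hl, hi, h]
  rw [h1, Finset.card_insert_of_notMem (by simp), pow_succ, mul_neg_one]

theorem faceSign_erase_of_not_lt {i j : ι} (I : Finset ι) (h : ¬ i < j) :
    faceSign k j (I.erase i) = faceSign k j I := by
  unfold faceSign
  congr 2
  ext l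
  by_cases hl : l = i <;> simp [hl, h]

/-- Deleting the smaller of two vertices first shifts the position of the larger by one; in the
other order nothing shifts. -/
theorem faceSign_mul_faceSign {i j : ι} {I : Finset ι} (hi : i ∈ I) (hj : j ∈ I) (h : i ≠ j) :
    faceSign k i I * faceSign k j (I.erase i) =
      -(faceSign k j I * faceSign k i (I.erase j)) := by
  rcases lt_or_gt_of_ne h with h | h
  · rw [faceSign_erase_of_lt k hi h, faceSign_erase_of_not_lt k I h.not_gt]
    ring
  · rw [faceSign_erase_of_lt k hj h, faceSign_erase_of_not_lt k I h.not_gt]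
    ring

theorem simplexBoundary_comp_self :
    (simplexBoundary k : (C × Finset ι →₀ k) →ₗ[k] _) ∘ₗ simplexBoundary k = 0 := by
  refine Finsupp.lhom_ext' fun p => LinearMap.ext_ring ?_
  obtain ⟨c, I⟩ := p
  simp only [LinearMap.comp_apply, Finsupp.lsingle_apply, simplexBoundary_single, map_sum, map_smul,
    Finset.smul_sum, smul_smul]
  rw [Finset.sum_sigma']
  -- The two orders of deleting a pair of vertices cancel.
  refine Finset.sum_involution (fun q _ => ⟨q.2, q.1⟩) ?_ ?_ ?_ ?_
  · rintro ⟨i, j⟩ h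
    simp only [Finset.mem_sigma, Finset.mem_erase] at h
    simp only
    rw [faceSign_mul_faceSign k h.1 h.2.2 h.2.1.symm, Finset.erase_right_comm, neg_smul,
      neg_add_cancel]
  · rintro ⟨i, j⟩ h _ h'
    simp only [Finset.mem_sigma, Finset.mem_erase] at h
    exact h.2.1 (congrArg Sigma.fst h')
  · rintro ⟨i, j⟩ h
    simp only [Finset.mem_sigma, Finset.mem_erase] at h ⊢
    exact ⟨h.2.2, h.2.1.symm, h.1⟩
  · rintro ⟨i, j⟩ _
    rfl

theorem simplexBoundary_lmapDomain {C' : Type w} (f : C → C') (z : C × Finset ι →₀ k) :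
    simplexBoundary k (Finsupp.lmapDomain k k (Prod.map f id) z) =
      Finsupp.lmapDomain k k (Prod.map f id) (simplexBoundary k z) := by
  have : (simplexBoundary k ∘ₗ Finsupp.lmapDomain k k (Prod.map f (id : Finset ι → Finset ι))) =
      Finsupp.lmapDomain k k (Prod.map f id) ∘ₗ simplexBoundary k := by
    refine Finsupp.lhom_ext' fun p => LinearMap.ext_ring ?_
    simp [simplexBoundary_single, Finsupp.mapDomain_single]
  exact congrArg (fun L => L z) this

/-- The cone operator of the direct sum of the full simplices on the sets `D c`. -/
noncomputable def simplexCone (D : C → Finset ι) :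
    (C × Finset ι →₀ k) →ₗ[k] (C × Finset ι →₀ k) :=
  Finsupp.linearCombination k (fun p =>
    if h : (D p.1).Nonempty then
      if (D p.1).min' h ∈ p.2 then 0
      else Finsupp.single (p.1, insert ((D p.1).min' h) p.2) (1 : k)
    else 0)

theorem simplexCone_single (D : C → Finset ι) {c : C} (I : Finset ι) (h : (D c).Nonempty) :
    simplexCone k D (Finsupp.single (c, I) 1) =
      if (D c).min' h ∈ I then 0
      else Finsupp.single (c, insert ((D c).min' h) I) (1 : k) := by
  simp [simplexCone, h]

theorem faceSign_eq_one {i : ι} {I : Finset ι} (h : ∀ j ∈ I, i ≤ j) : faceSign k i I = 1 := by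
  have : I.filter (· < i) = ∅ := by
    rw [Finset.filter_eq_empty_iff]
    exact fun j hj => (h j hj).not_gt
  rw [faceSign, this, Finset.card_empty, pow_zero]

/-- The cone with apex the least vertex contracts the augmented complex of a full simplex. The least
vertex is chosen so that its face has sign `1`. -/
theorem simplexBoundary_simplexCone (D : C → Finset ι) {c : C} {I : Finset ι}
    (h : (D c).Nonempty) (hI : I ⊆ D c) :
    simplexBoundary k (simplexCone k D (Finsupp.single (c, I) 1)) +
      simplexCone k D (simplexBoundary k (Finsupp.single (c, I) 1)) =
        Finsupp.single (c, I) 1 := by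
  rw [simplexBoundary_single, map_sum]
  simp only [map_smul, simplexCone_single k D _ h]
  set m := (D c).min' h with hm
  have hle : ∀ j ∈ D c, m ≤ j := fun j hj => (D c).min'_le j hj
  -- If the apex belongs to `I`, only the face without it survives the cone operator. If not, the
  -- face of the cone opposite to the apex is `I`, and the other faces cancel against the cones on
  -- the faces of `I`.
  by_cases hmI : m ∈ I
  · rw [if_pos hmI, map_zero, zero_add, Finset.sum_eq_single m]
    · rw [if_neg (Finset.notMem_erase m I), Finset.insert_erase hmI,
        faceSign_eq_one k (fun j hj => hle j (hI hj)), one_smul]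
    · intro i _ hi
      rw [if_pos (Finset.mem_erase.2 ⟨hi.symm, hmI⟩), smul_zero]
    · exact fun h => absurd hmI h
  · rw [if_neg hmI, simplexBoundary_single]
    simp only
    rw [Finset.sum_insert hmI, Finset.erase_insert hmI, faceSign_eq_one k, one_smul, add_assoc,
      ← Finset.sum_add_distrib, Finset.sum_eq_zero, add_zero]
    · intro i hi
      have hne : m ≠ i := fun h => hmI (h ▸ hi)
      rw [if_neg (fun h => hmI (Finset.mem_of_mem_erase h)),
        faceSign_erase_of_lt k (Finset.mem_insert_self m I) (lt_of_le_of_ne (hle i (hI hi)) hne),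
        Finset.erase_insert hmI, Finset.erase_insert_of_ne hne, neg_smul, neg_add_cancel]
    · intro j hj
      rcases Finset.mem_insert.1 hj with rfl | hj
      · exact le_rfl
      · exact hle j (hI hj)

end Koszul

/-! ### The differentials -/

section Differential

variable (k : Type v) [Field k] {d : ℕ} {X : Fin d → SymColl.{u}}
  {G : ∀ i n, Set ((X i).obj (Fin n))} (H : IsFreelyGenerated X G)

/-- The directions in which a subdivision may start by a cut. -/
noncomputable def LabelledSubdivision.dirs {U : Type} (c : LabelledSubdivision G U) :
    Finset (Fin d) :=
  open Classical in Finset.univ.filter c.HasCutIn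

theorem LabelledSubdivision.mem_dirs {U : Type} (c : LabelledSubdivision G U) (i : Fin d) :
    i ∈ c.dirs ↔ c.HasCutIn i := by
  simp [dirs]

/-- The pair of a subdivision and a set of directions that determines a basis element. -/
noncomputable def FreeBasis.pair {s : ℕ} {U : Type} [Finite U] (x : FreeBasis G s U) :
    LabelledSubdivision G U × Finset (Fin d) := (x.total H, x.dirs)

theorem FreeBasis.pair_injective (s : ℕ) (U : Type) [Finite U] :
    Function.Injective (FreeBasis.pair H : FreeBasis G s U → _) := fun _ _ h =>
  FreeBasis.total_injective H (congrArg Prod.fst h) (congrArg Prod.snd h)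

theorem FreeBasis.exists_pair {s : ℕ} {U : Type} [Finite U] (c : LabelledSubdivision G U)
    {I : Finset (Fin d)} (hI : I ⊆ c.dirs) (hs : I.card = s) :
    ∃ x : FreeBasis G s U, x.pair H = (c, I) := by
  subst hs
  obtain ⟨x, h1, h2⟩ := FreeBasis.total_surjective H c I (fun i hi => (c.mem_dirs i).1 (hI hi))
  exact ⟨x, Prod.ext h1 h2⟩

theorem FreeBasis.dirs_subset {s : ℕ} {U : Type} [Finite U] (x : FreeBasis G s U) :
    x.dirs ⊆ (x.total H).dirs :=
  fun i hi => (LabelledSubdivision.mem_dirs _ i).2 (x.hasCutIn H hi)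

theorem FreeBasis.exists_face {s : ℕ} {U : Type} [Finite U] (x : FreeBasis G (s + 1) U)
    {i : Fin d} (hi : i ∈ x.dirs) :
    ∃ y : FreeBasis G s U, y.pair H = (x.total H, x.dirs.erase i) :=
  FreeBasis.exists_pair H _ ((Finset.erase_subset i _).trans (x.dirs_subset H))
    (by rw [Finset.card_erase_of_mem hi, x.card_dirs, Nat.add_sub_cancel])

/-- The basis element obtained by leaving out the direction `i` of the grid. -/
noncomputable def FreeBasis.face {s : ℕ} {U : Type} [Finite U] (x : FreeBasis G (s + 1) U)
    {i : Fin d} (hi : i ∈ x.dirs) : FreeBasis G s U := (x.exists_face H hi).choose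

theorem FreeBasis.pair_face {s : ℕ} {U : Type} [Finite U] (x : FreeBasis G (s + 1) U)
    {i : Fin d} (hi : i ∈ x.dirs) : (x.face H hi).pair H = (x.total H, x.dirs.erase i) :=
  (x.exists_face H hi).choose_spec

/-- The linear extension of `FreeBasis.pair`. -/
noncomputable def pairMap (s : ℕ) (U : Type) [Finite U] :
    (FreeBasis G s U →₀ k) →ₗ[k] (LabelledSubdivision G U × Finset (Fin d) →₀ k) :=
  Finsupp.lmapDomain k k (FreeBasis.pair H)

theorem pairMap_single {s : ℕ} {U : Type} [Finite U] (x : FreeBasis G s U) :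
    pairMap k H s U (Finsupp.single x 1) = Finsupp.single (x.pair H) 1 := by
  simp [pairMap]

theorem pairMap_injective (s : ℕ) (U : Type) [Finite U] :
    Function.Injective (pairMap k H s U) :=
  Finsupp.mapDomain_injective (FreeBasis.pair_injective H s U)

/-- The differential of the resolution: the alternating sum of the faces. -/
noncomputable def faceMap (s : ℕ) (U : Type) [Finite U] :
    (FreeBasis G (s + 1) U →₀ k) →ₗ[k] (FreeBasis G s U →₀ k) :=
  Finsupp.linearCombination k (fun x =>
    ∑ i ∈ x.dirs.attach, faceSign k i.1 x.dirs • Finsupp.single (x.face H i.2) (1 : k))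

theorem faceMap_single {s : ℕ} {U : Type} [Finite U] (x : FreeBasis G (s + 1) U) :
    faceMap k H s U (Finsupp.single x 1) =
      ∑ i ∈ x.dirs.attach, faceSign k i.1 x.dirs • Finsupp.single (x.face H i.2) (1 : k) := by
  simp [faceMap]

/-- Since `pairMap` is injective, this transfers identities for the simplicial boundary to
`faceMap`. -/
theorem pairMap_faceMap {s : ℕ} {U : Type} [Finite U] (z : FreeBasis G (s + 1) U →₀ k) :
    pairMap k H s U (faceMap k H s U z) = simplexBoundary k (pairMap k H (s + 1) U z) := by
  have : pairMap k H s U ∘ₗ faceMap k H s U = simplexBoundary k ∘ₗ pairMap k H (s + 1) U := by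
    refine Finsupp.lhom_ext' fun x => LinearMap.ext_ring ?_
    simp only [LinearMap.comp_apply, Finsupp.lsingle_apply, faceMap_single, pairMap_single,
      simplexBoundary_single, map_sum, map_smul, FreeBasis.pair_face]
    exact Finset.sum_attach x.dirs (fun i => faceSign k i x.dirs •
      Finsupp.single (x.total H, x.dirs.erase i) (1 : k))
  exact congrArg (fun L => L z) this

theorem pairMap_map {s : ℕ} {U V : Type} [Finite U] [Finite V] (e : U ≃ V)
    (z : FreeBasis G s V →₀ k) :
    pairMap k H s U (Finsupp.lmapDomain k k ((freeModule (cutGenDeg X s) (cutOperad G)).map e) z) =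
      Finsupp.lmapDomain k k (Prod.map (LabelledSubdivision.map e) id) (pairMap k H s V z) := by
  have : pairMap k H s U ∘ₗ
      Finsupp.lmapDomain k k ((freeModule (cutGenDeg X s) (cutOperad G)).map e) =
      Finsupp.lmapDomain k k (Prod.map (LabelledSubdivision.map e) id) ∘ₗ pairMap k H s V := by
    simp only [pairMap, ← Finsupp.lmapDomain_comp]
    congr 1
    funext x
    exact Prod.ext (FreeBasis.total_map H e x) (FreeBasis.dirs_map e x)
  exact congrArg (fun L => L z) this

theorem pairMap_act {s : ℕ} {V : Type} {W : V → Type} [Finite V] [∀ v, Finite (W v)]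
    (z : FreeBasis G s V →₀ k) (b : ∀ v, (cutOperad G).obj (W v)) :
    pairMap k H s (Σ v, W v) (multiExt k (freeModule (cutGenDeg X s) (cutOperad G)).act z
      (fun v => Finsupp.single (b v) 1)) =
      Finsupp.lmapDomain k k (Prod.map (fun c : LabelledSubdivision G V => c.comp b) id)
        (pairMap k H s V z) := by
  rw [multiExt_one (freeModule (cutGenDeg X s) (cutOperad G)).act b
    (fun x => (freeModule (cutGenDeg X s) (cutOperad G)).act x b) (fun _ => rfl)]
  have : pairMap k H s (Σ v, W v) ∘ₗ Finsupp.lmapDomain k k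
        (fun x => (freeModule (cutGenDeg X s) (cutOperad G)).act x b) =
      Finsupp.lmapDomain k k (Prod.map (fun c : LabelledSubdivision G V => c.comp b) id) ∘ₗ
        pairMap k H s V := by
    simp only [pairMap, ← Finsupp.lmapDomain_comp]
    congr 1
    funext x
    exact Prod.ext (FreeBasis.total_act H x b) (FreeBasis.dirs_act x b)
  exact congrArg (fun L => L z) this

/-- By multilinearity it is enough to act by basis elements. On pairs the action then affects only
the subdivision, while the boundary affects only the set of directions. -/
theorem faceMap_act {s : ℕ} {V : Type} {W : V → Type} [Finite V] [∀ v, Finite (W v)]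
    (x : FreeBasis G (s + 1) V →₀ k) (b : ∀ v, (cutOperad G).obj (W v) →₀ k) :
    faceMap k H s (Σ v, W v) (multiExt k (freeModule (cutGenDeg X (s + 1)) (cutOperad G)).act x b) =
      multiExt k (freeModule (cutGenDeg X s) (cutOperad G)).act (faceMap k H s V x) b := by
  refine multi_ext
    (f := fun b => faceMap k H s _
      (multiExt k (freeModule (cutGenDeg X (s + 1)) (cutOperad G)).act x b))
    (g := fun b => multiExt k (freeModule (cutGenDeg X s) (cutOperad G)).act
      (faceMap k H s V x) b)
    ((isMulti_map _).linear (faceMap k H s (Σ v, W v))) (isMulti_map _) (fun c => ?_) b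
  refine pairMap_injective k H s _ ?_
  rw [pairMap_act, pairMap_faceMap, pairMap_act, pairMap_faceMap, simplexBoundary_lmapDomain]

/-- The differential of the resolution. -/
noncomputable def cutDifferential (s : ℕ) :
    RightModule.Hom (cutResolution k X G (s + 1)) (cutResolution k X G s) where
  app U _ := faceMap k H s U
  app_map {U V} _ _ e x := by
    refine pairMap_injective k H s U ?_
    refine (pairMap_faceMap k H _).trans ?_
    refine Eq.trans ?_ (pairMap_map k H e (faceMap k H s V x)).symm
    refine (congrArg (simplexBoundary k) (pairMap_map k H e x)).trans ?_
    refine (simplexBoundary_lmapDomain k _ _).trans ?_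
    exact congrArg _ (pairMap_faceMap k H x).symm
  app_act x b := faceMap_act k H x b

/-! ### The augmentation -/

/-- On basis elements both sides are `0` or `1`: a disjoint union of nonempty sets is a point only
if its index set and all of its members are. -/
theorem linAug_act {k : Type v} [Field k] {P : SetOperad.{u}} (M : SetModule.{u, w} P) {V : Type}
    {W : V → Type} [Fintype V] [∀ v, Finite (W v)] (a : M.obj V →₀ k)
    (b : ∀ v, P.obj (W v) →₀ k) :
    linAug k (Σ v, W v) _ (multiExt k M.act a b) =
      linAug k V _ a * ∏ v, linAug k (W v) _ (b v) := by
  classical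
  induction a using lin_induction with
  | zero => simp only [map_zero, zero_apply, zero_mul]
  | add x y hx hy => simp only [map_add, add_apply, hx, hy, add_mul]
  | smul r x hx => simp only [map_smul, smul_apply, hx, smul_mul_assoc]
  | single a =>
    refine multi_ext
      (f := fun b => linAug k (Σ v, W v) _ (multiExt k M.act (Finsupp.single a 1) b))
      (g := fun b => linAug k V (M.obj V) (Finsupp.single a 1) *
        ∏ v, linAug k (W v) (P.obj (W v)) (b v))
      ((isMulti_map (multiExt k M.act (Finsupp.single a 1))).linear (linAug k _ _))
      ((isMulti_map ((MultilinearMap.mkPiAlgebra k V k).compLinearMap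
        (fun v => linAug k (W v) (P.obj (W v))))).linear
          (LinearMap.mulLeft k (linAug k V (M.obj V) (Finsupp.single a 1))))
      (fun b => ?_) b
    have : ∀ v, Nonempty (W v) := fun v => by
      by_contra hv
      have := not_nonempty_iff.1 hv
      exact (P.reduced (W v)).false (b v)
    simp only [multiExt_single, linAug_single, card_sigma_eq_one]
    by_cases h1 : Nat.card V = 1
    · by_cases h2 : ∀ v, Nat.card (W v) = 1
      · rw [if_pos ⟨h1, h2⟩, if_pos h1, Finset.prod_congr rfl (fun v _ => if_pos (h2 v))]
        simp
      · obtain ⟨v, hv⟩ := not_forall.1 h2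
        rw [if_neg (fun h => h2 h.2), Finset.prod_eq_zero (Finset.mem_univ v) (if_neg hv),
          mul_zero]
    · rw [if_neg h1, if_neg (fun h => h1 h.1), zero_mul]

theorem linAug_eq_zero (k : Type v) [Field k] {U : Type} (A : Type u) (h : Nat.card U ≠ 1) :
    linAug k U A = 0 := if_neg h

/-- The linearisation of a right module over a set operad is augmented by the sum of coefficients
in arity one. -/
noncomputable def linAugHom (k : Type v) [Field k] {P : SetOperad.{u}} (M : SetModule.{u, w} P) :
    RightModule.Hom (M.lin k) (augModule (P.lin k)) where
  app U _ := (linAug k U (M.obj U)).codRestrict (unitSpace k U)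
    (fun x h => by rw [linAug_eq_zero k _ h]; rfl)
  app_map e x := Subtype.ext (linAug_map M.toSymColl e x)
  app_act {V W} _ _ x b := by
    let _ := Fintype.ofFinite V
    exact Subtype.ext (linAug_act M x b)

/-! ### Exactness -/

/-- Any cut creates at least two parts with disjoint interiors, and each of them contains a box of
the subdivision. -/
theorem LabelledSubdivision.not_hasCutIn {U : Type} (hU : Nat.card U = 1)
    (c : LabelledSubdivision G U) (i : Fin d) : ¬ c.HasCutIn i := by
  rintro ⟨p, hp, -, D, E, hD, h, -⟩
  have := (Nat.card_eq_one_iff_unique.1 hU).1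
  obtain ⟨B, hB⟩ := (hD ⟨0, by omega⟩).nonempty
  obtain ⟨B', hB'⟩ := (hD ⟨1, by omega⟩).nonempty
  obtain ⟨u, hu⟩ : B ∈ Set.range c.cell := h ▸ Set.mem_iUnion.2 ⟨_, hB⟩
  obtain ⟨u', hu'⟩ : B' ∈ Set.range c.cell := h ▸ Set.mem_iUnion.2 ⟨_, hB'⟩
  obtain rfl : B = B' := by rw [← hu, ← hu', Subsingleton.elim u u']
  have h0 := ((hD _).boxes (Rect.cube_nondeg.part i hp _)).1 B hB
  have h1 := ((hD _).boxes (Rect.cube_nondeg.part i hp _)).1 B hB'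
  exact h0.1.not_separated
    ((Rect.part_separated Rect.cube_nondeg i hp zero_ne_one).mono h0.2 h1.2)

theorem LabelledSubdivision.cases {U : Type} (c : LabelledSubdivision G U) :
    (Set.range c.cell = {Rect.cube d} ∧ c.cuts = ∅) ∨ ∃ i, c.HasCutIn i := by
  obtain ⟨cell, cuts, hinj, h⟩ := c
  simp only [HasCutIn]
  generalize Set.range cell = D at h
  generalize hR : Rect.cube d = R at h ⊢
  cases h with
  | trivial => exact Or.inl ⟨rfl, rfl⟩
  | cut _ i m hm g hg D E h => exact Or.inr ⟨i, ⟨m, g⟩, hm, hg, D, E, h, rfl, rfl⟩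

theorem LabelledSubdivision.dirs_nonempty {U : Type} (hU : Nat.card U ≠ 1)
    (c : LabelledSubdivision G U) : c.dirs.Nonempty := by
  rcases c.cases with ⟨h, -⟩ | ⟨i, hi⟩
  · have h1 := Nat.card_range_of_injective c.injective
    rw [h, Nat.card_unique] at h1
    exact absurd h1.symm hU
  · exact ⟨i, (c.mem_dirs i).2 hi⟩

theorem LabelledSubdivision.eq_trivial {U : Type} (hU : Nat.card U = 1)
    (c : LabelledSubdivision G U) : (∀ u, c.cell u = Rect.cube d) ∧ c.cuts = ∅ := by
  rcases c.cases with ⟨h, h'⟩ | ⟨i, hi⟩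
  · refine ⟨fun u => ?_, h'⟩
    have : c.cell u ∈ Set.range c.cell := ⟨u, rfl⟩
    rwa [h] at this
  · exact absurd hi (c.not_hasCutIn hU i)

theorem faceMap_comp_faceMap (s : ℕ) (U : Type) [Finite U] :
    faceMap k H s U ∘ₗ faceMap k H (s + 1) U = 0 := by
  refine LinearMap.ext fun z => pairMap_injective k H s U ?_
  rw [LinearMap.comp_apply, pairMap_faceMap, pairMap_faceMap]
  exact congrArg (fun L => L (pairMap k H (s + 1 + 1) U z)) (simplexBoundary_comp_self k)

/-- The apex is chosen in `c.dirs`, so the cone on an admissible pair is again admissible and comes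
from a basis element. -/
theorem exists_pairMap_eq_simplexCone {s : ℕ} {U : Type} [Finite U] (z : FreeBasis G s U →₀ k) :
    ∃ y, pairMap k H (s + 1) U y =
      simplexCone k LabelledSubdivision.dirs (pairMap k H s U z) := by
  induction z using lin_induction with
  | zero => exact ⟨0, by simp only [map_zero]⟩
  | add x y hx hy =>
    obtain ⟨x', hx⟩ := hx
    obtain ⟨y', hy⟩ := hy
    exact ⟨x' + y', by simp only [map_add, hx, hy]⟩
  | smul r x hx =>
    obtain ⟨x', hx⟩ := hx
    exact ⟨r • x', by simp only [map_smul, hx]⟩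
  | single x =>
    rw [pairMap_single]
    by_cases h : (x.total H).dirs.Nonempty
    · rw [FreeBasis.pair, simplexCone_single k _ _ h]
      split_ifs with hm
      · exact ⟨0, map_zero _⟩
      · obtain ⟨y, hy⟩ := FreeBasis.exists_pair H (s := s + 1) (x.total H)
          (I := insert ((x.total H).dirs.min' h) x.dirs)
          (Finset.insert_subset (Finset.min'_mem _ h) (x.dirs_subset H))
          (by rw [Finset.card_insert_of_notMem hm, x.card_dirs])
        exact ⟨Finsupp.single y 1, by rw [pairMap_single, hy]⟩
    · exact ⟨0, by simp [simplexCone, FreeBasis.pair, h]⟩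

theorem simplexBoundary_simplexCone_pairMap {s : ℕ} {U : Type} [Finite U]
    (hU : ∀ x : FreeBasis G s U, (x.total H).dirs.Nonempty) (z : FreeBasis G s U →₀ k) :
    simplexBoundary k (simplexCone k LabelledSubdivision.dirs (pairMap k H s U z)) +
      simplexCone k LabelledSubdivision.dirs (simplexBoundary k (pairMap k H s U z)) =
        pairMap k H s U z := by
  induction z using lin_induction with
  | zero => simp only [map_zero, add_zero]
  | add x y hx hy =>
    simp only [map_add]
    rw [add_add_add_comm, hx, hy]
  | smul r x hx =>
    simp only [map_smul]
    rw [← smul_add, hx]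
  | single x =>
    rw [pairMap_single]
    exact simplexBoundary_simplexCone k _ (hU x) (x.dirs_subset H)

/-- The contracting homotopy exhibits cycles as boundaries. The cycle condition is stated for
`simplexBoundary` so that it also makes sense for `s = 0`, where no differential leaves the module.
-/
theorem mem_range_faceMap {s : ℕ} {U : Type} [Finite U]
    (hU : ∀ x : FreeBasis G s U, (x.total H).dirs.Nonempty) {z : FreeBasis G s U →₀ k}
    (hz : simplexBoundary k (pairMap k H s U z) = 0) :
    z ∈ LinearMap.range (faceMap k H s U) := by
  obtain ⟨y, hy⟩ := exists_pairMap_eq_simplexCone k H z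
  refine ⟨y, pairMap_injective k H s U ?_⟩
  have := simplexBoundary_simplexCone_pairMap k H hU z
  rw [hz, map_zero, add_zero] at this
  rw [pairMap_faceMap, hy, this]

theorem ker_faceMap (s : ℕ) (U : Type) [Finite U] :
    LinearMap.ker (faceMap k H s U) = LinearMap.range (faceMap k H (s + 1) U) := by
  refine le_antisymm (fun z hz => mem_range_faceMap k H (fun x => ?_) ?_) ?_
  -- In positive degree the grid itself supplies a possible first direction.
  · have h : x.dirs.Nonempty := by
      rw [← Finset.card_pos, x.card_dirs]
      exact Nat.succ_pos s
    exact h.mono (x.dirs_subset H)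
  · rw [← pairMap_faceMap, LinearMap.mem_ker.1 hz, map_zero]
  · rw [LinearMap.range_le_ker_iff]
    exact faceMap_comp_faceMap k H s U

theorem FreeBasis.dirs_eq_empty {U : Type} [Finite U] (x : FreeBasis G 0 U) : x.dirs = ∅ :=
  Finset.card_eq_zero.1 x.card_dirs

theorem isEmpty_freeBasis_one (H : IsFreelyGenerated X G) {U : Type} [Finite U]
    (hU : Nat.card U = 1) :
    IsEmpty (FreeBasis G 1 U) := by
  refine ⟨fun x => ?_⟩
  obtain ⟨i, hi⟩ := Finset.card_pos.1 (x.card_dirs.symm ▸ Nat.one_pos)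
  exact LabelledSubdivision.not_hasCutIn hU _ i (x.hasCutIn H hi)

theorem subsingleton_freeBasis_zero (H : IsFreelyGenerated X G) {U : Type} [Finite U]
    (hU : Nat.card U = 1) :
    Subsingleton (FreeBasis G 0 U) := by
  refine ⟨fun x y => FreeBasis.total_injective H ?_ (x.dirs_eq_empty.trans y.dirs_eq_empty.symm)⟩
  obtain ⟨h1, h2⟩ := (x.total H).eq_trivial hU
  obtain ⟨h3, h4⟩ := (y.total H).eq_trivial hU
  exact LabelledSubdivision.ext (funext fun u => (h1 u).trans (h3 u).symm) (h2.trans h4.symm)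

/-- In arity one there is at most one basis element in degree `0` and none in degree `1`. In other
arities the augmentation vanishes and every subdivision has a first cut, so the simplices are
contractible. -/
theorem ker_linAug (U : Type) [Finite U] :
    LinearMap.ker (linAug k U (FreeBasis G 0 U)) = LinearMap.range (faceMap k H 0 U) := by
  by_cases hU : Nat.card U = 1
  · have := isEmpty_freeBasis_one H hU
    have := subsingleton_freeBasis_zero H hU
    have h1 : LinearMap.range (faceMap k H 0 U) = ⊥ := by
      rw [LinearMap.range_eq_bot]
      exact LinearMap.ext fun z => by rw [Subsingleton.elim z 0, map_zero, map_zero]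
    rw [h1, LinearMap.ker_eq_bot']
    intro z hz
    ext x
    have h2 : z = Finsupp.single x (z x) := by
      ext y
      rw [Subsingleton.elim y x, Finsupp.single_eq_same]
    rw [h2] at hz
    simpa [linAug, hU] using hz
  · rw [linAug_eq_zero k _ hU, LinearMap.ker_zero, eq_comm, eq_top_iff]
    refine fun z _ => mem_range_faceMap k H (fun x => LabelledSubdivision.dirs_nonempty hU _) ?_
    -- Every degree `0` chain is a cycle, its directions being empty.
    induction z using lin_induction with
    | zero => simp only [map_zero]
    | add x y hx hy => rw [map_add, map_add, hx Submodule.mem_top, hy Submodule.mem_top, add_zero]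
    | smul r x hx => rw [map_smul, map_smul, hx Submodule.mem_top, smul_zero]
    | single x =>
      rw [pairMap_single, simplexBoundary_single]
      simp [FreeBasis.pair, x.dirs_eq_empty]

theorem linAug_surjective (H : IsFreelyGenerated X G) {U : Type} [Finite U]
    (hU : Nat.card U = 1) (r : k) :
    ∃ z, linAug k U (FreeBasis G 0 U) z = r := by
  obtain ⟨_, ⟨u⟩⟩ := Nat.card_eq_one_iff_unique.1 hU
  let e : U ≃ Unit := ⟨fun _ => (), fun _ => u, fun _ => Subsingleton.elim _ _, fun _ => rfl⟩
  obtain ⟨x, -⟩ := FreeBasis.exists_pair H (s := 0)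
    (LabelledSubdivision.one.map e : LabelledSubdivision G U) (Finset.empty_subset _) rfl
  exact ⟨Finsupp.single x r, by simp [linAug, hU]⟩

/-! ### Minimality -/

/-- Supplies the bare grid of `x` as a basis element, from which `x` is obtained by acting with its
own fillings. -/
theorem exists_freeBasis_total_eq_gridSubdivision {s : ℕ} {U : Type} [Finite U]
    (x : FreeBasis G s U) :
    ∃ y : FreeBasis G s (Quotient x.1), y.total H = gridSubdivision H x.gen ∧ y.dirs = x.dirs := by
  have hcut : ∀ i ∈ x.dirs, (gridSubdivision H x.gen).HasCutIn i := by
    intro i hi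
    obtain ⟨p, hp⟩ := Option.isSome_iff_exists.1 ((mem_gridDirs H _ i).1 hi)
    refine ⟨p, ?_⟩
    have := (isGridSubdivision_fill H x.gen (fun _ =>
      (LabelledSubdivision.one : LabelledSubdivision G Unit))).hasCut Rect.cube_nondeg
      (isGridLabel_gridLabel H x.gen) hp
    rwa [gridParts_fill_one, gridCuts_fill_one] at this
  obtain ⟨y, hy⟩ := FreeBasis.exists_pair H (gridSubdivision H x.gen) (I := x.dirs)
    (fun i hi => (LabelledSubdivision.mem_dirs _ i).2 (hcut i hi)) x.card_dirs
  exact ⟨y, congrArg Prod.fst hy, congrArg Prod.snd hy⟩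

/-- If the subdivision of a basis element may start by a cut in a direction which does not occur
in the grid, then some box of the grid is subdivided. -/
theorem FreeBasis.exists_card_ne_one {s : ℕ} {U : Type} [Finite U] (x : FreeBasis G s U)
    {i : Fin d} (hi : i ∉ x.dirs) (hc : (x.total H).HasCutIn i) :
    ∃ q : Quotient x.1, Nat.card {u : U // Quotient.mk x.1 u = q} ≠ 1 := by
  -- If all boxes had a single part, the fillings would have no cuts, and the grid has none in the
  -- direction `i`; but a first cut in that direction leaves a trace on every generic line.
  by_contra! hcard
  obtain ⟨p, hp⟩ := hc
  obtain ⟨y, hy⟩ := exists_isGeneric (Rect.cube_nondeg (d := d)) i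
  obtain ⟨q, hq⟩ := (hp.hasRoot Rect.cube_nondeg Rect.cube_isRational hy).nonempty
  change (Function.update y i q.1, (⟨i, q.2⟩ : Label X)) ∈ (x.total H).cuts at hq
  rw [x.total_cuts] at hq
  rcases hq with hq | hq
  · obtain ⟨i', p', h1, -, h2⟩ := Set.mem_iUnion.1 hq
    obtain rfl : i = i' := congrArg Sigma.fst h2
    exact hi ((mem_gridDirs H _ i).2 (Option.isSome_iff_exists.2 ⟨p', h1⟩))
  · obtain ⟨q', hq'⟩ := Set.mem_iUnion.1 hq
    rw [((x.fill q').eq_trivial (hcard q')).2] at hq'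
    simp only [mulCuts, Set.image_empty] at hq'
    exact Set.notMem_empty _ hq'

theorem single_mem_decomposables {s : ℕ} {U : Type} [Finite U] (x : FreeBasis G s U)
    {i : Fin d} (hi : i ∉ x.dirs) (hc : (x.total H).HasCutIn i) :
    (Finsupp.single x 1 : FreeBasis G s U →₀ k) ∈ (cutResolution k X G s).decomposables U := by
  classical
  obtain ⟨y, hy1, hy2⟩ := exists_freeBasis_total_eq_gridSubdivision H x
  obtain ⟨q, hq⟩ := x.exists_card_ne_one H hi hc
  refine Submodule.subset_span ⟨Quotient x.1, fun q => {u : U // Quotient.mk x.1 u = q},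
    inferInstance, fun _ => inferInstance, (Equiv.sigmaFiberEquiv (Quotient.mk x.1)).symm,
    (Finsupp.single y 1 : FreeBasis G s (Quotient x.1) →₀ k),
    fun q => (Finsupp.single (x.fill q) 1 : LabelledSubdivision G _ →₀ k), ⟨q, ?_⟩, ?_⟩
  · exact (linAug_single k _ (x.fill q)).trans (if_neg hq)
  · let z : FreeBasis G s U := (freeModule (cutGenDeg X s) (cutOperad G)).map
      (Equiv.sigmaFiberEquiv (Quotient.mk x.1)).symm
      ((freeModule (cutGenDeg X s) (cutOperad G)).act y x.fill)
    -- Both sides have the same total subdivision and the same directions, so `total_injective`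
    -- identifies them.
    have hz : z = x := by
      refine FreeBasis.total_injective H ?_ ?_
      · exact (FreeBasis.total_map H _ _).trans (congrArg (LabelledSubdivision.map _)
          ((FreeBasis.total_act H y x.fill).trans
            (congrArg (fun a : LabelledSubdivision G (Quotient x.1) => a.comp x.fill) hy1)))
      · exact (FreeBasis.dirs_map _ _).trans ((FreeBasis.dirs_act y x.fill).trans hy2)
    have h1 := multiExt_single k (freeModule (cutGenDeg X s) (cutOperad G)).act y x.fill
    have h2 : Finsupp.lmapDomain k k ((freeModule (cutGenDeg X s) (cutOperad G)).map
        (Equiv.sigmaFiberEquiv (Quotient.mk x.1)).symm)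
        (multiExt k (freeModule (cutGenDeg X s) (cutOperad G)).act (Finsupp.single y 1)
          (fun q => Finsupp.single (x.fill q) 1)) = Finsupp.single z 1 := by
      rw [h1, Finsupp.lmapDomain_apply, Finsupp.mapDomain_single]
    rw [hz] at h2
    exact h2.symm

/-- A face omits the direction `i` from the grid, while its total subdivision, unchanged, may still
start by a cut in that direction; such basis elements are decomposable. -/
theorem range_faceMap_le_decomposables (s : ℕ) (U : Type) [Finite U] :
    LinearMap.range (faceMap k H s U) ≤ (cutResolution k X G s).decomposables U := by
  rintro _ ⟨z, rfl⟩
  induction z using lin_induction with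
  | zero =>
    rw [map_zero]
    exact Submodule.zero_mem ((cutResolution k X G s).decomposables U)
  | add x y hx hy =>
    rw [map_add]
    exact Submodule.add_mem ((cutResolution k X G s).decomposables U) hx hy
  | smul r x hx =>
    rw [map_smul]
    exact Submodule.smul_mem ((cutResolution k X G s).decomposables U) r hx
  | single x =>
    rw [faceMap_single]
    refine Submodule.sum_mem ((cutResolution k X G s).decomposables U) (fun i _ =>
      Submodule.smul_mem ((cutResolution k X G s).decomposables U) _ ?_)
    have h := x.pair_face H i.2
    refine single_mem_decomposables k H _ (i := i.1) ?_ ?_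
    · rw [show (x.face H i.2).dirs = _ from congrArg Prod.snd h]
      exact Finset.notMem_erase _ _
    · rw [show (x.face H i.2).total H = _ from congrArg Prod.fst h]
      exact x.hasCutIn H i.2

end Differential

end CutRes

theorem mainTheorem3 (k : Type v) [Field k] (d : ℕ) (X : Fin d → SymColl.{u})
    (hfree : ∀ i, (X i).IsFree)
    (h0 : ∀ i, IsEmpty ((X i).obj (Fin 0))) (h1 : ∀ i, IsEmpty ((X i).obj (Fin 1)))
    (G : ∀ i n, Set ((X i).obj (Fin n))) (hG : ∀ i, (X i).IsGenerating (G i)) :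
    ∃ (δ : ∀ s, RightModule.Hom (cutResolution k X G (s + 1)) (cutResolution k X G s))
      (ε : RightModule.Hom (cutResolution k X G 0) (augModule ((cutOperad G).lin k))),
      RightModule.IsMinimalResolution (cutResolution k X G)
        (augModule ((cutOperad G).lin k)) δ ε := by
  have H : IsFreelyGenerated X G := ⟨hfree, h0, h1, hG⟩
  refine ⟨cutDifferential k H, linAugHom k (freeModule (cutGenDeg X 0) (cutOperad G)), ?_⟩
  refine ⟨fun s U _ => faceMap_comp_faceMap k H s U, fun s U _ => ker_faceMap k H s U,
    fun U _ => ?_, fun U _ => ?_, fun s U _ => range_faceMap_le_decomposables k H s U⟩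
  · exact (LinearMap.ker_codRestrict _ _ _).trans (ker_linAug k H U)
  · rintro ⟨r, hr⟩
    by_cases hU : Nat.card U = 1
    · obtain ⟨z, hz⟩ := linAug_surjective k H hU r
      exact ⟨z, Subtype.ext hz⟩
    · exact ⟨0, Subtype.ext ((congrArg Subtype.val (map_zero _)).trans (hr hU).symm)⟩
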